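/- **Setting.** Let $\mathbb F_\ell\subseteq\mathbb F_q$ be finite fields, $\{0\}=W_0<W_1<\dots<W_w=W\subseteq\mathbb F_q$ a flag of $\mathbb F_\ell$-subspaces with $\dim W_i=i$, $T\le\mathbb F_\ell^*$ the subgroup of order $t=q_1\cdots q_\mu$ (with $q_j\ge2$, $t\mid \ell-1$) and $T_i$ its subgroup of order $q_1\cdots q_i$. Put $r=w+\mu$, $(p_1,\dots,p_r)=(\ell,\dots,\ell,q_1,\dots,q_\mu)$, $n=\ell^wt=p_1\cdots p_r$, $m_s=p_1\cdots p_s$, $n_s=n/m_s$. Let $G_i=\{1\}\ltimes W_i$ for $i\le w$, $G_i=T_{i-w}\ltimes W$ for $i\ge w$, and let $x_i=\prod_{(\beta,v)\in G_i}\beta^{-1}(\beta x+v)\in\mathbb F_q[x]$. Write $\mathbf x^{\mathbf u}=x_0^{u_0}\cdots x_{r-1}^{u_{r-1}}$, where $u=\sum_i u_i\,p_1\cdots p_i$ with $0\le u_i<p_{i+1}$. Fix $\gamma\in\mathbb F_q\setminus W$; the G-FFT point set is $\mathcal P=\{u(\gamma+v): u\in T,\ v\in W\}$, which has $n$ elements.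 For $1\le k<n$, $\mathrm{RS}[n,k]$ is the code of all $(f(P))_{P\in\mathcal P}$ with $f\in\mathbb F_q[x]$, $\deg f<k$, for a given ordering of $\mathcal P$. A decoder $D:\mathbb F_q^n\to\mathbb F_q^n$ *corrects burst errors of length less than $L$ with miscorrection probability at most $\delta$* if, for every integer $0\le l<L$, every window of $l$ consecutive positions and every codeword $c$, the probability that $D(c+E)\ne c$ is at most $\delta$ when $E$ is uniformly distributed on the vectors supported on the window. Time is the number of instructions (field operations, constants, zero tests) of an algebraic computation tree over $\mathbb F_q$. For $w\le s\le r$, an ordering of $\mathcal P$ is *adapted to $s$* if, for some $\xi$ and some $\alpha$ of order $n_s$ in $\mathbb F_q^*$, the polynomial $x_s$ takes the constant value $\xi\alpha^{j-1}$ on the $j$-th block of $m_s$ consecutive points, $j=1,\dots,n_s$. In that case *Algorithm 2* is the following decoder. Fold the received word into an $m_s\times n_s$ matrix whose $j$-th column is the $j$-th block; replace each column by the coefficients in the basis $\mathbf x^{\mathbf 0},\dots,\mathbf x^{\mathbf{m_s-1}}$ of its interpolation polynomial of degree less than $m_s$; decode, for $0\le i<m_s$, the $i$-th row by the generalized Wu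 algorithm (described next) for the Reed–Solomon code of dimension $k_i=\lfloor (k-1-i)/m_s\rfloor+1$ on $\xi,\xi\alpha,\dots,\xi\alpha^{n_s-1}$; interpolate the decoded rows by polynomials $f_i$; return the evaluations of $\sum_i f_i(x_s)\mathbf x^{\mathbf i}$ on $\mathcal P$. *Generalized Wu algorithm* for dimension $\kappa$ on $X_j=\xi\alpha^{j-1}$, $1\le j\le N$, input $y$, $\rho=N-\kappa$: let $\Lambda_h$ be the coefficients of $\prod_{j=1}^{\rho-1}(1-X_jx)$, $S_h=\sum_j y_j\prod_{i\ne j}(X_j-X_i)^{-1}X_j^h$ and $\Gamma(x)=\sum_{h=0}^{\rho-1}S_{\rho-1-h}\Lambda_hx^h$. Find a longest sequence $\alpha^{i-1},\alpha^{i-2},\dots,\alpha^{i-R}$ ($R\le\rho$) of roots of $\Gamma$, with the least such $i\ge1$, and put $l=\rho-R$. Erase the $l$ cyclically consecutive positions starting at $i$: with $\lambda(x)$ the product of $x-X_j$ over the erased $j$, and $F$ of degree less than $N$ the interpolation polynomial of $\lambda(X_j)y_j$ at the other positions and $0$ at the erased ones, replace $y_j$ by $F'(X_j)/\lambda'(X_j)$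 at the erased positions. **Theorem.** 1. For every ordering of $\mathcal P$, every $1\le k<n$, every real $\epsilon\ge 1/n$ and every integer $e\ge1$, there is a decoder for $\mathrm{RS}[n,k]$ that corrects burst errors of length less than $n-k-n\epsilon(e+2)$ with miscorrection probability at most $\epsilon/q^{e-1}$. 2. Let $w\le s\le r$, let the ordering of $\mathcal P$ be adapted to $s$, and let $1\le k<n$. For every real $\epsilon\ge 1/n_s$ and every integer $e\ge1$, Algorithm 2 corrects burst errors of length less than $n-m_s\lceil k/m_s\rceil-n\epsilon(e+2)$ with miscorrection probability at most $\epsilon/q^{e-1}$. 3. For every $B$ there is a constant $c$, depending only on $B$, such that the following holds whenever all prime factors of $n$ are at most $B$. Let $s$, the ordering and $k$ be as in 2, and $1/n_s\le\epsilon\le1$. If $p_j\le B$ for all $j$, then Algorithm 2 runs in time at most $c\,\frac1\epsilon\, n\log n$. In any case there is a decoder running in time at most $c\,\frac1\epsilon\, n\log n$ which, for every integer $e\ge1$, corrects burst errors of length less than $n-k-n\epsilon(e+2)$ with miscorrection probability at most $\epsilon/q^{e-1}$. -/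

import Mathlib

open Polynomial

universe u

noncomputable section

/-! ### Reed-Solomon codes, burst errors, miscorrection probability -/

/-- The Reed-Solomon code of dimension `k` on the (ordered) evaluation points `pts`. -/
def RSCode {F : Type u} [Field F] {n : ℕ} (pts : Fin n → F) (k : ℕ) : Set (Fin n → F) :=
  {c | ∃ f ∈ Polynomial.degreeLT F k, c = fun i => f.eval (pts i)}

/-- The error vectors supported on the window `{a, a + 1, …, a + l - 1}` of `l` consecutive
positions. -/
def burstErrors (F : Type u) [Field F] (n a l : ℕ) : Set (Fin n → F) :=
  {err | ∀ i : Fin n, err i ≠ 0 → a ≤ (i : ℕ) ∧ (i : ℕ) < a + l}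

/-- The probability that the decoder `dec` does not return the transmitted word `c`, when the
channel adds to `c` an error drawn uniformly from all vectors supported on the window of length
`l` that starts at position `a`. -/
def miscorrectionProb {F : Type u} [Field F] {n : ℕ} (dec : (Fin n → F) → (Fin n → F))
    (c : Fin n → F) (a l : ℕ) : ℝ :=
  (Set.ncard {err ∈ burstErrors F n a l | dec (c + err) ≠ c} : ℝ) /
    (Set.ncard (burstErrors F n a l) : ℝ)

/-- `dec` corrects, for the code `C`, every burst of length less than `L` with miscorrection
probability at most `δ`: whatever the transmitted codeword and the position of the burst. -/
def CorrectsBursts {F : Type u} [Field F] {n : ℕ} (C : Set (Fin n → F))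
    (dec : (Fin n → F) → (Fin n → F)) (L δ : ℝ) : Prop :=
  ∀ l : ℕ, (l : ℝ) < L → ∀ a : ℕ, a + l ≤ n → ∀ c ∈ C, miscorrectionProb dec c a l ≤ δ

/-! ### Algebraic computation trees: the number of operations in the field -/

/-- Algebraic computation trees over `F`, acting on registers numbered by `ℕ`. An instruction
loads a constant, or applies a field operation to two registers and writes the result to register
`d`, or branches on whether a register holds `0`. -/
inductive CompTree (F : Type u) : Type u
  | halt : CompTree F
  | const (d : ℕ) (c : F) (next : CompTree F) : CompTree F
  | add (d a b : ℕ) (next : CompTree F) : CompTree F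
  | sub (d a b : ℕ) (next : CompTree F) : CompTree F
  | mul (d a b : ℕ) (next : CompTree F) : CompTree F
  | div (d a b : ℕ) (next : CompTree F) : CompTree F
  | ifZero (a : ℕ) (yes no : CompTree F) : CompTree F

namespace CompTree

/-- The contents of the registers when the tree halts. -/
def run {F : Type u} [Field F] : CompTree F → (ℕ → F) → (ℕ → F)
  | halt, σ => σ
  | const d c t, σ => t.run (Function.update σ d c)
  | add d a b t, σ => t.run (Function.update σ d (σ a + σ b))
  | sub d a b t, σ => t.run (Function.update σ d (σ a - σ b))
  | mul d a b t, σ => t.run (Function.update σ d (σ a * σ b))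
  | div d a b t, σ => t.run (Function.update σ d (σ a / σ b))
  | ifZero a t t', σ =>
      haveI := Classical.propDecidable (σ a = 0)
      if σ a = 0 then t.run σ else t'.run σ

/-- The worst-case number of instructions (field operations, constants, zero tests). -/
def cost {F : Type u} : CompTree F → ℕ
  | halt => 0
  | const _ _ t => t.cost + 1
  | add _ _ _ t => t.cost + 1
  | sub _ _ _ t => t.cost + 1
  | mul _ _ _ t => t.cost + 1
  | div _ _ _ t => t.cost + 1
  | ifZero _ t t' => max t.cost t'.cost + 1

/-- The input is in the registers `0, …, n - 1`, all the other registers hold `0`. -/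
def load {F : Type u} [Field F] {n : ℕ} (r : Fin n → F) : ℕ → F :=
  fun i => if h : i < n then r ⟨i, h⟩ else 0

/-- The map computed by a tree: the output is read from the registers `0, …, n - 1`. -/
def toMap {F : Type u} [Field F] (t : CompTree F) (n : ℕ) (r : Fin n → F) : Fin n → F :=
  fun i => t.run (load r) i

end CompTree

/-! ### The group `T ⋉ W`, its chain of subgroups, and the evaluation points -/

/-- The data behind a G-FFT over the field `F = 𝔽_q` with a subfield `K = 𝔽_ℓ`: a flag
`0 = W 0 < W 1 < ⋯ < W w = W` of `K`-subspaces of `F`, with `dim (W i) = i` (only the values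
`W i` with `i ≤ w` matter); an integer `t = q 0 * ⋯ * q (μ - 1)` dividing `ℓ - 1`, which is the
order of the subgroup `T` of `Kˣ` (only the `q j` with `j < μ` matter); and an element `γ` of `F`
outside `W`. -/
structure GFFTData (K F : Type u) [Field K] [Field F] [Algebra K F] where
  w : ℕ
  W : ℕ → Submodule K F
  W_le : ∀ i < w, W i ≤ W (i + 1)
  finrank_W : ∀ i ≤ w, Module.finrank K (W i) = i
  μ : ℕ
  q : ℕ → ℕ
  two_le_q : ∀ j < μ, 2 ≤ q j
  q_dvd : (∏ j ∈ Finset.range μ, q j) ∣ Nat.card K - 1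
  γ : F
  γ_notMem : γ ∉ W w

namespace GFFTData

variable {K F : Type u} [Field K] [Field F] [Algebra K F]

/-- The number of steps of the chain of subgroups `G 0 < G 1 < ⋯ < G r = T ⋉ W`. -/
def r (D : GFFTData K F) : ℕ := D.w + D.μ

/-- The index of `G j` in `G (j + 1)`: first `w` times `ℓ`, then `q 0, q 1, …`. -/
def p (D : GFFTData K F) (j : ℕ) : ℕ := if j < D.w then Nat.card K else D.q (j - D.w)

/-- The order of `G s`. -/
def m (D : GFFTData K F) (s : ℕ) : ℕ := ∏ j ∈ Finset.range s, D.p j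

/-- The index of `G s` in `T ⋉ W`. -/
def ns (D : GFFTData K F) (s : ℕ) : ℕ := ∏ j ∈ Finset.Ico s D.r, D.p j

/-- The order of `T ⋉ W`, which is the length of the codes. -/
def n (D : GFFTData K F) : ℕ := D.m D.r

theorem ns_mul_m (D : GFFTData K F) {s : ℕ} (hs : s ≤ D.r) : D.ns s * D.m s = D.n := by
  rw [mul_comm]
  exact Finset.prod_range_mul_prod_Ico _ hs

/-- The subgroup of order `q 0 * ⋯ * q (i - 1)` of the cyclic group `Kˣ`. -/
def T (D : GFFTData K F) (i : ℕ) : Subgroup Kˣ :=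
  rootsOfUnity (∏ j ∈ Finset.range i, D.q j) K

/-- The evaluation points `u * (γ + v)` with `u ∈ T` and `v ∈ W`. -/
def points (D : GFFTData K F) : Set F :=
  {x | ∃ β ∈ D.T D.μ, ∃ v ∈ D.W D.w, x = algebraMap K F β * (D.γ + v)}

/-- The polynomial `x_i`, the product of all `σ(x) = β⁻¹ (β x + v)` where `σ = (β, v)` runs through
`G i = T_{i - w} ⋉ W_{min(i, w)}`. -/
def xpoly (D : GFFTData K F) [Finite K] [Finite F] (i : ℕ) : F[X] :=
  ∏ β ∈ (Set.toFinite {β : Kˣ | β ∈ D.T (i - D.w)}).toFinset,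
    ∏ v ∈ (Set.toFinite {v : F | v ∈ D.W (min i D.w)}).toFinset,
      C (algebraMap K F β)⁻¹ * (C (algebraMap K F β) * X + C v)

/-- The basis polynomial `x_0 ^ u_0 * x_1 ^ u_1 * ⋯ * x_{r-1} ^ u_{r-1}` where the `u_i` are the
digits of `u` in the mixed radix `p 0, p 1, …`. -/
def basisPoly (D : GFFTData K F) [Finite K] [Finite F] (u : ℕ) : F[X] :=
  ∏ i ∈ Finset.range D.r, D.xpoly i ^ (u / D.m i % D.p i)

/-- Position `a` of block `j`, when the `n` positions are cut into `ns s` consecutive blocks of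
length `m s`. -/
def pos (D : GFFTData K F) {s : ℕ} (hs : s ≤ D.r) (j : Fin (D.ns s)) (a : Fin (D.m s)) :
    Fin D.n :=
  Fin.cast (D.ns_mul_m hs) (finProdFinEquiv (j, a))

/-- An arrangement of the evaluation points at level `s`: the `j`-th block of `m s` consecutive
points consists of the points lying over the `j`-th element of `ξ, ξ α, ξ α ^ 2, …`, a coset of a
cyclic group of order `ns s`, under the map `x ↦ x_s`. -/
structure Arrangement (D : GFFTData K F) [Finite K] [Finite F] {s : ℕ} (hs : s ≤ D.r) where
  pts : Fin D.n → F
  injective : Function.Injective pts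
  range_eq : Set.range pts = D.points
  ξ : F
  α : F
  orderOf_α : orderOf α = D.ns s
  xpoly_eval : ∀ j a, (D.xpoly s).eval (pts (D.pos hs j a)) = ξ * α ^ (j : ℕ)

end GFFTData

/-! ### Burst decoding of Reed-Solomon codes on a coset of a cyclic group -/

namespace CyclicBurst

variable {F : Type u} [Field F] (N k : ℕ) (ξ α : F)

/-- The reciprocal error locator of the first `N - k - 1` positions. -/
def locator : F[X] := ∏ j ∈ Finset.range (N - k - 1), (1 - C (ξ * α ^ j) * X)

/-- The coefficient of `x ^ h` in `∑ j, y j * δ j / (1 - ξ α ^ j x)` where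
`δ j = ∏ i ≠ j, (ξ α ^ j - ξ α ^ i)⁻¹`. -/
def syndrome (y : Fin N → F) (h : ℕ) : F :=
  ∑ j : Fin N, y j *
    (∏ i ∈ Finset.univ.erase j, (ξ * α ^ (j : ℕ) - ξ * α ^ (i : ℕ))⁻¹) * (ξ * α ^ (j : ℕ)) ^ h

/-- The polynomial whose consecutive roots among the powers of `α` reveal the burst. -/
def Γ (y : Fin N → F) : F[X] :=
  ∑ h ∈ Finset.range (N - k),
    C (syndrome N ξ α y (N - k - 1 - h) * (locator N k ξ α).coeff h) * X ^ h

/-- `α ^ i, α ^ (i - 1), …, α ^ (i - R + 1)` are roots of `Γ`. -/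
def IsRun (y : Fin N → F) (i R : ℕ) : Prop :=
  ∀ h < R, (Γ N k ξ α y).eval (α ^ ((i : ℤ) - (h : ℤ))) = 0

open Classical in
/-- The length (at most `N - k`) of the longest cyclically consecutive sequence of roots of `Γ`. -/
def maxRun (y : Fin N → F) : ℕ :=
  Nat.findGreatest (fun R => ∃ i, IsRun N k ξ α y i R) (N - k)

/-- The first position of the burst: a starting exponent of a longest sequence of roots. -/
def start (y : Fin N → F) : ℕ := sInf {i | IsRun N k ξ α y i (maxRun N k ξ α y)}

/-- The length of the burst. -/
def len (y : Fin N → F) : ℕ := N - k - maxRun N k ξ α y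

/-- Position `j` belongs to the window of length `l` that starts, cyclically, at `i`. -/
def Erased (i l : ℕ) (j : Fin N) : Prop := ∃ h < l, (j : ℕ) = (i + h) % N

/-- The erasure locator of the window of length `l` that starts at `i`. -/
def erasureLocator (i l : ℕ) : F[X] := ∏ h ∈ Finset.range l, (X - C (ξ * α ^ (i + h)))

open Classical in
/-- Erasure decoding of `y` on the window of length `l` that starts at `i`: interpolate
`F = λ f` from the positions that are not erased, and evaluate `f = F' / λ'` at the erased ones. -/
def erasureDecode (i l : ℕ) (y : Fin N → F) : Fin N → F :=
  let x : Fin N → F := fun j => ξ * α ^ (j : ℕ)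
  let lam := erasureLocator ξ α i l
  let G : F[X] := Lagrange.interpolate Finset.univ x
    (fun j => if Erased N i l j then 0 else lam.eval (x j) * y j)
  fun j => if Erased N i l j then
    (derivative G).eval (x j) / (derivative lam).eval (x j) else y j

/-- The generalized Wu algorithm for the code of dimension `k` on `ξ, ξ α, …, ξ α ^ (N - 1)`. -/
def decode (y : Fin N → F) : Fin N → F :=
  erasureDecode N ξ α (start N k ξ α y) (len N k ξ α y) y

end CyclicBurst

/-! ### The decoding algorithm on the G-FFT points -/

namespace GFFTData

variable {K F : Type u} [Field K] [Field F] [Algebra K F] [Finite K] [Finite F]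

/-- The matrix of the column G-FFT at block `j`: evaluation of the basis polynomials of index
`i < m s` at the points of the block. -/
def gfft (D : GFFTData K F) {s : ℕ} {hs : s ≤ D.r} (A : D.Arrangement hs) (j : Fin (D.ns s)) :
    Matrix (Fin (D.m s)) (Fin (D.m s)) F :=
  Matrix.of fun a i => (D.basisPoly i).eval (A.pts (D.pos hs j a))

/-- The dimension `⌊(k - 1 - i) / m s⌋ + 1` of the `i`-th row code, for `i < m s`. -/
def rowDim (D : GFFTData K F) (s k i : ℕ) : ℕ := (k + (D.m s - 1 - i)) / D.m s

/-- Fold the word `y` and apply the inverse G-FFT to every column. -/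
def foldIFFT (D : GFFTData K F) {s : ℕ} {hs : s ≤ D.r} (A : D.Arrangement hs)
    (y : Fin D.n → F) : Matrix (Fin (D.m s)) (Fin (D.ns s)) F :=
  Matrix.of fun i j => ((D.gfft A j)⁻¹.mulVec fun a => y (D.pos hs j a)) i

/-- Probabilistic unique decoding: fold, invert the G-FFT on the columns, run the generalized Wu
algorithm on every row, interpolate the rows to polynomials `f_i`, and evaluate
`∑ i, f_i(x_s) * x^i` at all the points. -/
def burstDecode (D : GFFTData K F) {s : ℕ} {hs : s ≤ D.r} (A : D.Arrangement hs) (k : ℕ)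
    (y : Fin D.n → F) : Fin D.n → F :=
  let f : F[X] := ∑ i : Fin (D.m s),
    (Lagrange.interpolate Finset.univ (fun j : Fin (D.ns s) => A.ξ * A.α ^ (j : ℕ))
      (CyclicBurst.decode (D.ns s) (D.rowDim s k i) A.ξ A.α (D.foldIFFT A y i))).comp
        (D.xpoly s) * D.basisPoly i
  fun b => f.eval (A.pts b)

end GFFTData

end

/-!
# Burst decoding of Reed-Solomon codes on the G-FFT points

**Counting.** Fix a burst window. A decoder that always returns a codeword explaining the received
word by *some* burst of length at most `l` errs only if the error is *confusable*: it differs by a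
nonzero codeword from a vector supported on another window. Two explanations of length `l` overlap
in too few positions for this to happen often: a fixed other window is responsible for a proportion
of at most `q ^ l / q ^ (n - k)` of the errors (`card_confusable_mul_le`), and there are few windows.
For the decoder that picks a shortest window this is the Singleton-bound statement
(`exists_correctsBursts`).

**Rows.** The value of `Γ` at `α ^ u` is the parity check of the cyclic code that is blind to the
`N - k - 1` positions from `u` on (`CyclicBurst.eval_Γ`). Hence a burst on a window of length `l`
gives a run of `N - k - l` roots, and conversely a run of `R` roots gives a window of `N - k - R`
positions off which the word agrees with a codeword (`CyclicBurst.exists_degreeLT_of_isRun`), which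
erasure decoding then returns. So the generalized Wu algorithm fails only on confusable errors. The
fold maps a uniform burst to a row error that is uniform on a set of blocks, so the count applies to
every row (`GFFTData.burstDecode_correctsBursts`).

**Joint decoding.** To avoid the loss from rounding `k` up to a multiple of `m`, all rows are decoded
with one common window, given by a longest run of roots common to all rows. A wrong window must then
explain all the rows at once, which is unlikely enough to pay for the rounding
(`GFFTData.jointDecode_correctsBursts`). This works for rows taken in any basis of polynomials graded
by degree.

**Running time.** If `x' = g(x)` with `deg g = p`, a full fibre of `x'` splits into `p` full fibres of
`x`, and evaluation in the basis `x ^ u * b i` reduces to evaluations in the basis `b i` by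
`p`-by-`p` Vandermonde matrices (`FastOnFibres.step`). This one step gives the Fourier transform of
smooth length, the G-FFT of the given chain when its radices are bounded, and in general a fast
transform for another basis, from a refinement of the chain to prime indices
(`GFFTData.exists_fastOnFibres_xpoly`). Everything else in the decoders is `O(n)` operations, `n`
zero tests included: in a computation tree the window may be any function of the pattern of zeros.
Both decoders therefore take `O(n log n)` instructions, and the factor `1 / ε` is not needed.
-/

/-! ### Counting the errors that two explanations share -/

/-- The errors of `V` whose image under `φ` is explained, modulo the code `C`, by a different error
`err'` supported on `W`. If `φ` acts as a uniform error on the coordinates `S` and as `0` elsewhere,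
and every nonzero word of `C` has weight greater than `d`, their proportion in `V` is at most
`q ^ |W| / q ^ d`. Words `z` on a set `A ⊆ S ∪ W` of `d` positions can be added to `err` on `A ∩ S`
and subtracted from `err'` on `A \ S` without losing information: this is an injection from
pairs (confusable error, `z`) to pairs (error, word on `W`). -/
theorem card_confusable_mul_le {ι F M : Type*} [Fintype ι] [DecidableEq ι] [Field F] [Finite F]
    [AddCommGroup M] [Module F M] [Finite M] (V : Submodule F M) (φ : M →ₗ[F] ι → F)
    (C : Submodule F (ι → F)) (d : ℕ)
    (hC : ∀ c ∈ C, ∀ A : Finset ι, A.card ≤ d → (∀ i ∉ A, c i = 0) → c = 0)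
    (S W : Finset ι) (hS : ∀ x ∈ V, ∀ j ∉ S, φ x j = 0)
    (hS' : ∀ j ∈ S, ∃ x ∈ V, φ x = Pi.single j 1) :
    {x ∈ (V : Set M) | ∃ y : ι → F, (∀ j ∉ W, y j = 0) ∧ φ x - y ∈ C ∧ φ x ≠ y}.ncard *
      Nat.card F ^ d ≤ (V : Set M).ncard * Nat.card F ^ W.card := by
  classical
  set bad : Set M := {x ∈ (V : Set M) | ∃ y : ι → F, (∀ j ∉ W, y j = 0) ∧ φ x - y ∈ C ∧ φ x ≠ y}
    with hbad
  by_cases hd : d ≤ (S ∪ W).card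
  swap
  · have : bad = ∅ := by
      ext x
      simp only [hbad, Set.mem_ofPred_eq, Set.mem_empty_iff_false, iff_false]
      rintro ⟨hx, y, hy, hc, hne⟩
      apply hne
      have := hC _ hc (S ∪ W) (by omega) (by
        intro i hi
        rw [Finset.mem_union, not_or] at hi
        simp [hS x hx i hi.1, hy i hi.2])
      exact sub_eq_zero.mp this
    simp [this]
  obtain ⟨A, hA, hAd⟩ := Finset.exists_subset_card_eq hd
  choose! b hbV hb using hS'
  choose! Y hYW hYC hYne using fun x (hx : x ∈ bad) => hx.2
  -- the map that adds `z` to the pair of explanations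
  let f : bad × (A → F) → V × (W → F) := fun p =>
    (⟨p.1.1 + ∑ j : A, (if j.1 ∈ S then p.2 j else 0) • (if j.1 ∈ S then b j.1 else 0),
      V.add_mem p.1.2.1 (V.sum_mem fun j _ => V.smul_mem _ (by
        split_ifs with h
        · exact hbV _ h
        · exact V.zero_mem))⟩,
     fun w => Y p.1.1 w.1 - if h : w.1 ∈ A ∧ w.1 ∉ S then p.2 ⟨w.1, h.1⟩ else 0)
  have hφ : ∀ p : bad × (A → F), φ (f p).1.1 =
      φ p.1.1 + fun i => if h : i ∈ A ∧ i ∈ S then p.2 ⟨i, h.1⟩ else 0 := by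
    intro p
    simp only [f, map_add, map_sum, map_smul]
    congr 1
    funext i
    rw [Finset.sum_apply]
    by_cases hi : i ∈ A ∧ i ∈ S
    · rw [dif_pos hi, Finset.sum_eq_single ⟨i, hi.1⟩]
      · simp [hi.2, hb i hi.2]
      · intro j _ hj
        have : i ≠ j.1 := fun h => hj (Subtype.ext h.symm)
        by_cases hjS : j.1 ∈ S
        · simp [hjS, hb _ hjS, this]
        · simp [hjS]
      · simp
    · rw [dif_neg hi]
      refine Finset.sum_eq_zero fun j _ => ?_
      by_cases hjS : j.1 ∈ S
      · have : i ≠ j.1 := fun h => hi ⟨h ▸ j.2, h ▸ hjS⟩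
        simp [hjS, hb _ hjS, this]
      · simp [hjS]
  have hinj : Function.Injective f := by
    rintro ⟨x₁, z₁⟩ ⟨x₂, z₂⟩ h
    have h1 : φ (f (x₁, z₁)).1.1 = φ (f (x₂, z₂)).1.1 := by rw [h]
    rw [hφ, hφ] at h1
    have h2 : ∀ i, Y x₁.1 i - (if h : i ∈ A ∧ i ∉ S then z₁ ⟨i, h.1⟩ else 0) =
        Y x₂.1 i - (if h : i ∈ A ∧ i ∉ S then z₂ ⟨i, h.1⟩ else 0) := by
      intro i
      by_cases hi : i ∈ W
      · exact congrFun (congrArg Prod.snd h) ⟨i, hi⟩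
      · have : ¬ (i ∈ A ∧ i ∉ S) := fun hh =>
          (Finset.mem_union.mp (hA hh.1)).elim hh.2 hi
        rw [dif_neg this, dif_neg this, hYW _ x₁.2 i hi, hYW _ x₂.2 i hi]
    have h3 : z₁ = z₂ := by
      have key : (φ x₁.1 - Y x₁.1) - (φ x₂.1 - Y x₂.1) = fun i =>
          if h : i ∈ A then z₂ ⟨i, h⟩ - z₁ ⟨i, h⟩ else 0 := by
        funext i
        have a1 := congrFun h1 i
        have a2 := h2 i
        simp only [Pi.add_apply] at a1
        simp only [Pi.sub_apply]
        by_cases hi : i ∈ A <;> by_cases hi' : i ∈ S <;> simp only [hi, hi', and_true, and_false,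
          not_true, not_false_iff, dite_true, dite_false] at a1 a2 ⊢ <;>
          linear_combination a1 - a2
      have hz := hC _ (C.sub_mem (hYC _ x₁.2) (hYC _ x₂.2)) A hAd.le (by
        intro i hi
        rw [key]
        simp [hi])
      rw [key] at hz
      funext i
      have := congrFun hz i.1
      simp only [i.2, dite_true, Pi.zero_apply] at this
      exact (sub_eq_zero.mp this).symm
    subst h3
    have h4 := congrArg (fun p => (p.1 : M)) h
    simp only [f] at h4
    rw [add_left_inj] at h4
    rw [Prod.mk.injEq]
    exact ⟨Subtype.ext h4, rfl⟩
  have := Nat.card_le_card_of_injective f hinj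
  rw [Nat.card_prod, Nat.card_prod, Nat.card_fun, Nat.card_fun, Nat.card_eq_fintype_card (α := A),
    Nat.card_eq_fintype_card (α := W), Fintype.card_coe, Fintype.card_coe, hAd] at this
  exact this

/-- The Reed-Solomon code as a subspace. -/
noncomputable def rsSubmodule {F : Type u} [Field F] {n : ℕ} (pts : Fin n → F) (k : ℕ) :
    Submodule F (Fin n → F) :=
  (Polynomial.degreeLT F k).map (LinearMap.pi fun i => Polynomial.leval (pts i))

theorem coe_rsSubmodule {F : Type u} [Field F] {n : ℕ} (pts : Fin n → F) (k : ℕ) :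
    (rsSubmodule pts k : Set (Fin n → F)) = RSCode pts k := by
  ext c
  rw [SetLike.mem_coe, rsSubmodule, Submodule.mem_map]
  constructor
  · rintro ⟨f, hf, rfl⟩
    exact ⟨f, hf, rfl⟩
  · rintro ⟨f, hf, rfl⟩
    exact ⟨f, hf, rfl⟩

theorem mem_rsSubmodule {F : Type u} [Field F] {n : ℕ} {pts : Fin n → F} {k : ℕ}
    {c : Fin n → F} : c ∈ rsSubmodule pts k ↔ c ∈ RSCode pts k := by
  rw [← coe_rsSubmodule]; rfl

theorem RSCode_mono {F : Type u} [Field F] {n : ℕ} {pts : Fin n → F} {k k' : ℕ} (h : k ≤ k') :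
    RSCode pts k ⊆ RSCode pts k' := by
  rintro c ⟨f, hf, rfl⟩
  exact ⟨f, Polynomial.degreeLT_mono h hf, rfl⟩

/-- A polynomial of degree less than `k` that vanishes outside `n - k` of `n` distinct points. -/
theorem rsSubmodule_eq_zero {F : Type u} [Field F] {n k : ℕ} {pts : Fin n → F}
    (hpts : Function.Injective pts) (hk : k ≤ n) :
    ∀ c ∈ rsSubmodule pts k, ∀ A : Finset (Fin n), A.card ≤ n - k → (∀ i ∉ A, c i = 0) →
      c = 0 := by
  classical
  intro c hc A hA h0
  obtain ⟨f, hf, rfl⟩ := mem_rsSubmodule.mp hc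
  have hcard : k ≤ (Aᶜ).card := by
    rw [Finset.card_compl, Fintype.card_fin]; omega
  have : f = 0 := by
    refine Polynomial.eq_zero_of_degree_lt_of_eval_finset_eq_zero ((Aᶜ).image pts) ?_ ?_
    · rw [Finset.card_image_of_injective _ hpts]
      exact (Polynomial.mem_degreeLT.mp hf).trans_le (by exact_mod_cast hcard)
    · intro x hx
      obtain ⟨i, hi, rfl⟩ := Finset.mem_image.mp hx
      exact h0 i (Finset.mem_compl.mp hi)
  simp [this]
  rfl

/-- The subspace of the errors supported on a window. -/
def burstSubmodule (F : Type u) [Field F] (n a l : ℕ) : Submodule F (Fin n → F) where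
  carrier := burstErrors F n a l
  add_mem' := by
    intro x y hx hy i hi
    by_cases h : x i = 0
    · exact hy i (by intro h'; simp [h, h'] at hi)
    · exact hx i h
  zero_mem' := by intro i hi; simp at hi
  smul_mem' := by
    intro c x hx i hi
    exact hx i (by intro h'; simp [h'] at hi)

/-- From counting to probability: the failures are covered by `N₀` sets of proportion at most
`q ^ w / q ^ d`. -/
theorem miscorrectionProb_le_of_subset {F : Type u} [Field F] [Finite F] {n : ℕ}
    {dec : (Fin n → F) → (Fin n → F)} {c : Fin n → F} {a l : ℕ} {ι : Type*} (I : Finset ι)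
    (bad : ι → Set (Fin n → F)) {w d N₀ N₁ e : ℕ} {ε : ℝ}
    (hsub : ∀ err ∈ burstErrors F n a l, dec (c + err) ≠ c → ∃ i ∈ I, err ∈ bad i)
    (hbad : ∀ i ∈ I, (bad i).ncard * Nat.card F ^ d ≤
      (burstErrors F n a l).ncard * Nat.card F ^ w)
    (hI : I.card ≤ N₀) (hN₁ : 1 ≤ N₁) (hε : 1 / (N₁ : ℝ) ≤ ε)
    (hd : N₀ * N₁ * Nat.card F ^ (w + (e - 1)) ≤ Nat.card F ^ d) :
    miscorrectionProb dec c a l ≤ ε / (Nat.card F : ℝ) ^ (e - 1) := by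
  classical
  have : Fintype F := Fintype.ofFinite F
  set q := Nat.card F
  have hq : 0 < q := Nat.card_pos
  set V := (burstErrors F n a l).ncard with hV
  have hVpos : 0 < V := by
    rw [hV, Set.ncard_pos (Set.toFinite _)]
    exact ⟨0, fun i hi => by simp at hi⟩
  set X := {err ∈ burstErrors F n a l | dec (c + err) ≠ c} with hX
  have h1 : X.ncard ≤ ∑ i ∈ I, (bad i).ncard := by
    have : X ⊆ ⋃ i ∈ I, bad i := by
      intro err herr
      obtain ⟨i, hi, h⟩ := hsub err herr.1 herr.2
      exact Set.mem_biUnion hi h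
    exact (Set.ncard_le_ncard this (Set.toFinite _)).trans (Finset.set_ncard_biUnion_le _ _)
  have h2 : X.ncard * q ^ d ≤ N₀ * (V * q ^ w) := by
    calc X.ncard * q ^ d ≤ (∑ i ∈ I, (bad i).ncard) * q ^ d := Nat.mul_le_mul_right _ h1
      _ = ∑ i ∈ I, (bad i).ncard * q ^ d := Finset.sum_mul _ _ _
      _ ≤ ∑ i ∈ I, V * q ^ w := Finset.sum_le_sum hbad
      _ = I.card * (V * q ^ w) := by rw [Finset.sum_const, smul_eq_mul]
      _ ≤ _ := Nat.mul_le_mul_right _ hI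
  have h3 : X.ncard * N₁ * q ^ (e - 1) ≤ V := by
    have h4 : (X.ncard * N₁ * q ^ (e - 1)) * q ^ d ≤ V * q ^ d := by
      calc (X.ncard * N₁ * q ^ (e - 1)) * q ^ d = (X.ncard * q ^ d) * (N₁ * q ^ (e - 1)) := by ring
        _ ≤ (N₀ * (V * q ^ w)) * (N₁ * q ^ (e - 1)) := Nat.mul_le_mul_right _ h2
        _ = V * (N₀ * N₁ * q ^ (w + (e - 1))) := by rw [pow_add]; ring
        _ ≤ _ := Nat.mul_le_mul_left _ hd
    exact Nat.le_of_mul_le_mul_right h4 (pow_pos hq _)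
  have hN₁' : (0 : ℝ) < N₁ := by exact_mod_cast hN₁
  have hqe : (0 : ℝ) < (q : ℝ) ^ (e - 1) := by positivity
  have hV' : (0 : ℝ) < V := by exact_mod_cast hVpos
  have h5 : (X.ncard : ℝ) * N₁ * (q : ℝ) ^ (e - 1) ≤ V := by exact_mod_cast h3
  calc miscorrectionProb dec c a l = (X.ncard : ℝ) / V := rfl
    _ ≤ (1 / N₁) / (q : ℝ) ^ (e - 1) := by
      rw [div_div, div_le_div_iff₀ hV' (by positivity)]
      linarith
    _ ≤ _ := by gcongr

theorem card_filter_window_le (n a l : ℕ) :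
    (Finset.univ.filter fun i : Fin n => a ≤ (i : ℕ) ∧ (i : ℕ) < a + l).card ≤ l := by
  have h := Finset.card_le_card_of_injOn (s := Finset.univ.filter
    fun i : Fin n => a ≤ (i : ℕ) ∧ (i : ℕ) < a + l) (t := Finset.Ico a (a + l)) (fun i => (i : ℕ))
    (by intro i hi; simpa using hi) (by intro i _ j _ h; exact Fin.ext h)
  simpa using h

theorem length_le_card_of_injective {F : Type u} [Field F] [Finite F] {n : ℕ} {pts : Fin n → F}
    (hpts : Function.Injective pts) : n ≤ Nat.card F := by
  have := Nat.card_le_card_of_injective pts hpts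
  simpa using this

theorem two_le_card (F : Type u) [Field F] [Finite F] : 2 ≤ Nat.card F :=
  Finite.one_lt_card

/-- Decoding to a codeword whose distance pattern lies in a shortest window corrects bursts up to
the Singleton bound. -/
theorem exists_correctsBursts {F : Type u} [Field F] [Finite F] {n : ℕ} {pts : Fin n → F}
    (hpts : Function.Injective pts) {k : ℕ} (hk : 1 ≤ k) (hkn : k < n) {ε : ℝ} {e : ℕ}
    (hε : 1 / (n : ℝ) ≤ ε) (he : 1 ≤ e) :
    ∃ dec : (Fin n → F) → (Fin n → F), CorrectsBursts (RSCode pts k) dec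
      ((n : ℝ) - k - n * ε * (e + 2)) (ε / (Nat.card F : ℝ) ^ (e - 1)) := by
  classical
  -- `y` is explained by the codeword `c` and a burst of length `l`
  let P : (Fin n → F) → ℕ → Prop := fun y l => ∃ a, ∃ c ∈ RSCode pts k, y - c ∈ burstErrors F n a l
  have hP : ∀ y, ∃ l, P y l := fun y =>
    ⟨n, 0, 0, ⟨0, Submodule.zero_mem _, by funext i; simp⟩, fun i _ => ⟨by omega, by omega⟩⟩
  choose A dec hdec hA using fun y => Nat.find_spec (hP y)
  refine ⟨dec, ?_⟩
  intro l hl a hal c hc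
  have hn : 0 < n := by omega
  have hnR : (0 : ℝ) < n := by exact_mod_cast hn
  have hnε : 1 ≤ n * ε := by
    have := mul_le_mul_of_nonneg_left hε hnR.le
    rwa [mul_one_div_cancel hnR.ne'] at this
  -- the burst is shorter than the redundancy by at least `e + 3`
  have hlk : k + l + e + 3 ≤ n := by
    have h1 : (e + 2 : ℝ) ≤ n * ε * (e + 2) := by nlinarith [Nat.cast_nonneg (α := ℝ) e]
    have : (k + l + e + 2 : ℝ) < n := by linarith
    have : k + l + e + 2 < n := by exact_mod_cast this
    omega
  set q := Nat.card F with hq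
  have hnq : n ≤ q := length_le_card_of_injective hpts
  have hq2 : 2 ≤ q := two_le_card F
  let W : ℕ → Finset (Fin n) := fun a' =>
    Finset.univ.filter fun i : Fin n => a' ≤ (i : ℕ) ∧ (i : ℕ) < a' + l
  refine miscorrectionProb_le_of_subset (Finset.range (n + 1))
    (fun a' => {x ∈ (burstSubmodule F n a l : Set (Fin n → F)) | ∃ y : Fin n → F,
      (∀ j ∉ W a', y j = 0) ∧ LinearMap.id (R := F) x - y ∈ rsSubmodule pts k ∧
        LinearMap.id (R := F) x ≠ y})
    (w := l) (d := n - k) (N₀ := n + 1) (N₁ := n) ?_ ?_ (by simp) hn hε ?_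
  · intro err herr hne
    have hle : Nat.find (hP (c + err)) ≤ l := Nat.find_min' _ ⟨a, c, hc, by simpa using herr⟩
    have hWsub := hA (c + err)
    refine ⟨min (A (c + err)) n, by simp, herr, c + err - dec (c + err), ?_, ?_, ?_⟩
    · intro j hj
      by_contra h
      have := hWsub j h
      refine hj ?_
      simp only [W, Finset.mem_filter, Finset.mem_univ, true_and]
      have := j.2
      omega
    · have : LinearMap.id (R := F) err - (c + err - dec (c + err)) = dec (c + err) - c := by
        simp; abel
      rw [this]
      exact Submodule.sub_mem _ (mem_rsSubmodule.mpr (hdec _)) (mem_rsSubmodule.mpr hc)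
    · intro h
      apply hne
      have h' : err = c + err - dec (c + err) := h
      have : dec (c + err) - c = 0 := by
        rw [← sub_eq_zero] at h'
        rw [← h']; abel
      exact sub_eq_zero.mp this
  · intro a' _
    have h := card_confusable_mul_le (burstSubmodule F n a l) LinearMap.id (rsSubmodule pts k)
      (n - k) (rsSubmodule_eq_zero hpts hkn.le)
      (Finset.univ.filter fun i : Fin n => a ≤ (i : ℕ) ∧ (i : ℕ) < a + l) (W a') ?_ ?_
    · exact h.trans (Nat.mul_le_mul_left _ (Nat.pow_le_pow_right (by omega)
        (card_filter_window_le n a' l)))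
    · intro x hx j hj
      by_contra h
      exact hj (by simpa using hx j h)
    · intro j hj
      refine ⟨Pi.single j 1, ?_, rfl⟩
      intro i hi
      have : i = j := by
        by_contra h
        simp [h] at hi
      subst this
      simpa using hj
  · calc (n + 1) * n * q ^ (l + (e - 1)) ≤ (q ^ 2) * q * q ^ (l + (e - 1)) := by
          gcongr
          nlinarith
      _ = q ^ (l + (e - 1) + 3) := by ring
      _ ≤ q ^ (n - k) := Nat.pow_le_pow_right (by omega) (by omega)

/-! ### Burst decoding on a coset of a cyclic group -/

namespace CyclicBurst

theorem zpow_eq_zpow_iff_dvd {F : Type u} [Field F] {α : F} (hα : α ≠ 0) (a b : ℤ) :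
    α ^ a = α ^ b ↔ (orderOf α : ℤ) ∣ a - b := by
  have h := orderOf_dvd_sub_iff_zpow_eq_zpow (x := Units.mk0 α hα) (a := a) (b := b)
  rw [← orderOf_units, Units.val_mk0] at h
  rw [h, Units.ext_iff, Units.val_zpow_eq_zpow_val, Units.val_zpow_eq_zpow_val, Units.val_mk0]

section

variable {F : Type u} [Field F] {N k : ℕ} {ξ α : F}

theorem ne_zero_of_orderOf (hN : 0 < N) (hα : orderOf α = N) : α ≠ 0 := by
  rintro rfl
  have := pow_orderOf_eq_one (0 : F)
  rw [hα, zero_pow hN.ne'] at this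
  exact zero_ne_one this

theorem node_injective (hξ : ξ ≠ 0) (hα : orderOf α = N) :
    Function.Injective fun j : Fin N => ξ * α ^ (j : ℕ) := by
  intro i j h
  have h' : α ^ (i : ℕ) = α ^ (j : ℕ) := mul_left_cancel₀ hξ h
  exact Fin.ext (pow_injOn_Iio_orderOf (by simp [hα]) (by simp [hα]) h')

/-- The monic polynomial with the `d` cyclically consecutive roots `ξ α ^ u, ξ α ^ (u + 1), …`. -/
noncomputable def windowPoly (ξ α : F) (d : ℕ) (u : ℤ) : F[X] :=
  ∏ v ∈ Finset.range d, (X - C (ξ * α ^ (u + (v : ℤ))))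

theorem windowPoly_monic (d : ℕ) (u : ℤ) : (windowPoly ξ α d u).Monic :=
  monic_prod_of_monic _ _ fun _ _ => monic_X_sub_C _

theorem natDegree_windowPoly (d : ℕ) (u : ℤ) : (windowPoly ξ α d u).natDegree = d := by
  rw [windowPoly, natDegree_prod_of_monic _ _ fun _ _ => monic_X_sub_C _]
  simp only [natDegree_X_sub_C, Finset.sum_const, Finset.card_range, smul_eq_mul, mul_one]

theorem windowPoly_sub (d : ℕ) (u : ℤ) :
    windowPoly ξ α (d + 1) u - windowPoly ξ α (d + 1) (u - 1) =
      C (ξ * α ^ (u - 1) - ξ * α ^ (u + (d : ℤ))) * windowPoly ξ α d u := by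
  have h1 : windowPoly ξ α (d + 1) u = windowPoly ξ α d u * (X - C (ξ * α ^ (u + (d : ℤ)))) := by
    rw [windowPoly, Finset.prod_range_succ, ← windowPoly]
  have h2 : windowPoly ξ α (d + 1) (u - 1) = windowPoly ξ α d u * (X - C (ξ * α ^ (u - 1))) := by
    rw [windowPoly, Finset.prod_range_succ']
    congr 1
    · refine Finset.prod_congr rfl fun v _ => ?_
      congr 4
      push_cast
      ring
    · simp
  rw [h1, h2, C_sub]
  ring

/-- The parity check of `y` attached to the polynomial `P`: the coefficient of `x ^ (N - 1)` in the
product of `P` and the polynomial that interpolates `y`, modulo `x ^ N - ξ ^ N`. -/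
noncomputable def parityCheck (ξ α : F) (y : Fin N → F) (P : F[X]) : F :=
  ∑ j : Fin N, y j * (∏ i ∈ Finset.univ.erase j, (ξ * α ^ (j : ℕ) - ξ * α ^ (i : ℕ))⁻¹) *
    P.eval (ξ * α ^ (j : ℕ))

theorem parityCheck_sub_right (y : Fin N → F) (P Q : F[X]) :
    parityCheck ξ α y (P - Q) = parityCheck ξ α y P - parityCheck ξ α y Q := by
  simp only [parityCheck, eval_sub, mul_sub, Finset.sum_sub_distrib]

theorem parityCheck_C_mul (y : Fin N → F) (a : F) (P : F[X]) :
    parityCheck ξ α y (C a * P) = a * parityCheck ξ α y P := by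
  simp only [parityCheck, eval_mul, eval_C, Finset.mul_sum]
  exact Finset.sum_congr rfl fun _ _ => by ring

theorem parityCheck_sub_left (y z : Fin N → F) (P : F[X]) :
    parityCheck ξ α (y - z) P = parityCheck ξ α y P - parityCheck ξ α z P := by
  simp only [parityCheck, Pi.sub_apply, sub_mul, Finset.sum_sub_distrib]

theorem parityCheck_eval (hξ : ξ ≠ 0) (hα : orderOf α = N) {g P : F[X]}
    (hdeg : (g * P).degree < N) :
    parityCheck ξ α (fun j : Fin N => g.eval (ξ * α ^ (j : ℕ))) P = (g * P).coeff (N - 1) := by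
  have h := Lagrange.coeff_eq_sum (s := Finset.univ) (P := g * P)
    ((node_injective (N := N) hξ hα).injOn) (by simpa using hdeg)
  rw [Finset.card_univ, Fintype.card_fin] at h
  rw [h, parityCheck]
  refine Finset.sum_congr rfl fun j _ => ?_
  rw [eval_mul, Finset.prod_inv_distrib, div_eq_mul_inv]
  ring

/-- The value of `Γ` at `α ^ u` is the parity check that is blind to the `N - k - 1` positions
following `u`. -/
theorem eval_Γ (hξ : ξ ≠ 0) (hα : α ≠ 0) (hk : k < N) (y : Fin N → F) (u : ℤ) :
    (Γ N k ξ α y).eval (α ^ u) = parityCheck ξ α y (windowPoly ξ α (N - k - 1) u) := by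
  obtain ⟨d, hd⟩ : ∃ d, N - k = d + 1 := ⟨N - k - 1, by omega⟩
  have hdeg : (locator N k ξ α).natDegree < d + 1 := by
    rw [locator, Nat.lt_succ_iff]
    refine (natDegree_prod_le _ _).trans ?_
    calc ∑ j ∈ Finset.range (N - k - 1), (1 - C (ξ * α ^ j) * X : F[X]).natDegree
        ≤ ∑ j ∈ Finset.range (N - k - 1), 1 := Finset.sum_le_sum fun j _ => by
          compute_degree
      _ = d := by simp; omega
  simp only [Γ, syndrome, parityCheck, eval_finsetSum, eval_mul, eval_C, eval_pow, eval_X, hd,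
    Nat.add_sub_cancel]
  simp only [Finset.sum_mul]
  rw [Finset.sum_comm]
  refine Finset.sum_congr rfl fun j _ => ?_
  set x := ξ * α ^ (j : ℕ) with hx
  have hx0 : x ≠ 0 := mul_ne_zero hξ (pow_ne_zero _ hα)
  -- reversing the locator: `x ^ d * Λ (α ^ u / x)`
  have key : (windowPoly ξ α d u).eval x = x ^ d * (locator N k ξ α).eval (α ^ u / x) := by
    rw [windowPoly, locator, eval_prod, eval_prod, hd, Nat.add_sub_cancel]
    calc ∏ v ∈ Finset.range d, eval x (X - C (ξ * α ^ (u + (v : ℤ))))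
        = ∏ v ∈ Finset.range d, x * eval (α ^ u / x) (1 - C (ξ * α ^ v) * X) := by
          refine Finset.prod_congr rfl fun v _ => ?_
          simp only [eval_sub, eval_X, eval_C, eval_one, eval_mul]
          rw [zpow_add₀ hα, zpow_natCast]
          field_simp
      _ = _ := by rw [Finset.prod_mul_distrib, Finset.prod_const, Finset.card_range]
  rw [key, eval_eq_sum_range' hdeg, Finset.mul_sum, Finset.mul_sum]
  refine Finset.sum_congr rfl fun h hh => ?_
  have hh' : h ≤ d := by simpa [Nat.lt_succ_iff] using hh
  have : x ^ d = x ^ (d - h) * x ^ h := by rw [← pow_add]; congr 1; omega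
  rw [this, div_pow]
  field_simp

/-- A word supported on a cyclic window passes the parity checks blind to that window. -/
theorem parityCheck_windowPoly_eq_zero (hN : 0 < N) (hα : orderOf α = N) {i l d : ℕ} {u : ℤ}
    {y : Fin N → F} (hy : ∀ j, ¬ Erased N i l j → y j = 0) (hu : u ≤ i)
    (hd : (i : ℤ) + l ≤ u + d) : parityCheck ξ α y (windowPoly ξ α d u) = 0 := by
  have hα0 := ne_zero_of_orderOf hN hα
  refine Finset.sum_eq_zero fun j _ => ?_
  by_cases hj : Erased N i l j
  · obtain ⟨h, hh, hj⟩ := hj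
    have : (windowPoly ξ α d u).eval (ξ * α ^ (j : ℕ)) = 0 := by
      rw [windowPoly, eval_prod]
      refine Finset.prod_eq_zero (i := (i + h - u : ℤ).toNat) ?_ ?_
      · rw [Finset.mem_range]; omega
      · have e : u + (((i + h - u : ℤ).toNat : ℕ) : ℤ) = ((i + h : ℕ) : ℤ) := by
          push_cast; omega
        rw [e, zpow_natCast, hj, ← hα, pow_mod_orderOf]
        simp
    rw [this, mul_zero]
  · rw [hy j hj, zero_mul, zero_mul]

theorem erased_mod_iff {i l : ℕ} {j : Fin N} : Erased N (i % N) l j ↔ Erased N i l j := by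
  simp [Erased]

theorem Erased.mono {i l l' : ℕ} (h : l ≤ l') {j : Fin N} (hj : Erased N i l j) :
    Erased N i l' j := by
  obtain ⟨a, ha, e⟩ := hj
  exact ⟨a, by omega, e⟩

open Classical in
/-- The positions of a cyclic window. -/
noncomputable def window (N i l : ℕ) : Finset (Fin N) := Finset.univ.filter (Erased N i l)

theorem mem_window {i l : ℕ} {j : Fin N} : j ∈ window N i l ↔ Erased N i l j := by
  simp [window]

theorem window_eq_image (hN : 0 < N) (i l : ℕ) :
    window N i l = (Finset.range l).image fun h => (⟨(i + h) % N, Nat.mod_lt _ hN⟩ : Fin N) := by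
  ext j
  simp only [mem_window, Erased, Finset.mem_image, Finset.mem_range, Fin.ext_iff, eq_comm]

theorem card_window_le (hN : 0 < N) (i l : ℕ) : (window N i l).card ≤ l := by
  rw [window_eq_image hN]
  exact Finset.card_image_le.trans (by simp)

theorem card_window (hN : 0 < N) (i : ℕ) {l : ℕ} (hl : l ≤ N) : (window N i l).card = l := by
  rw [window_eq_image hN, Finset.card_image_of_injOn, Finset.card_range]
  intro a ha b hb h
  simp only [Finset.coe_range, Set.mem_Iio] at ha hb
  have h' : i + a ≡ i + b [MOD N] := congrArg Fin.val h
  have := Nat.ModEq.add_left_cancel' i h'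
  rwa [Nat.ModEq, Nat.mod_eq_of_lt (by omega), Nat.mod_eq_of_lt (by omega)] at this

/-- A run of `R` roots of `Γ` reveals a window of `N - k - R` positions outside which `y` agrees
with a codeword. By induction on `R`: differences of consecutive values of `Γ` are values of the
`Γ` of dimension `k + 1`, so a codeword of dimension `k + 1` agrees with `y` outside the window, and
one more root of `Γ` makes its coefficient of `x ^ k` vanish. -/
theorem exists_degreeLT_of_isRun (hN : 0 < N) (hξ : ξ ≠ 0) (hα : orderOf α = N) {y : Fin N → F}
    {i : ℕ} : ∀ {R k : ℕ}, k ≤ N → R ≤ N - k → IsRun N k ξ α y i R →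
      ∃ g ∈ degreeLT F k, ∀ j : Fin N, ¬ Erased N i (N - k - R) j →
        y j = g.eval (ξ * α ^ (j : ℕ)) := by
  classical
  have hα0 := ne_zero_of_orderOf hN hα
  intro R
  induction R with
  | zero =>
    intro k hk _ _
    have hcard : ((window N i (N - k))ᶜ).card = k := by
      rw [Finset.card_compl, card_window hN i (by omega), Fintype.card_fin]; omega
    have hinj := (node_injective hξ hα).injOn (s := ((window N i (N - k))ᶜ : Finset (Fin N)))
    refine ⟨Lagrange.interpolate (window N i (N - k))ᶜ (fun j : Fin N => ξ * α ^ (j : ℕ)) y, ?_, ?_⟩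
    · rw [mem_degreeLT]
      have h := Lagrange.degree_interpolate_lt (r := y) hinj
      rwa [hcard] at h
    · intro j hj
      exact (Lagrange.eval_interpolate_at_node y hinj
        (by rw [Finset.mem_compl, mem_window]; simpa using hj)).symm
  | succ R ih =>
    intro k hk hR hrun
    have hrun' : IsRun N (k + 1) ξ α y i R := by
      intro h hh
      have h0 := hrun h (by omega)
      have h1 := hrun (h + 1) (by omega)
      obtain ⟨d, hd⟩ : ∃ d, N - k - 1 = d + 1 := ⟨N - k - 2, by omega⟩
      rw [eval_Γ hξ hα0 (by omega)] at h0 h1 ⊢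
      have e1 : ((i : ℤ) - ((h + 1 : ℕ) : ℤ)) = (i : ℤ) - h - 1 := by push_cast; ring
      rw [e1] at h1
      rw [hd] at h0 h1
      rw [show N - (k + 1) - 1 = d by omega]
      have h2 : parityCheck ξ α y (C (ξ * α ^ ((i : ℤ) - h - 1) -
          ξ * α ^ ((i : ℤ) - h + (d : ℤ))) * windowPoly ξ α d ((i : ℤ) - h)) = 0 := by
        rw [← windowPoly_sub, parityCheck_sub_right, h0, h1, sub_zero]
      rw [parityCheck_C_mul] at h2
      refine (mul_eq_zero.mp h2).resolve_left ?_
      rw [← mul_sub]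
      refine mul_ne_zero hξ (sub_ne_zero.mpr ?_)
      rw [Ne, zpow_eq_zpow_iff_dvd hα0, hα]
      intro hdvd
      have e2 : (i : ℤ) - h - 1 - ((i : ℤ) - h + d) = -((d + 1 : ℕ) : ℤ) := by push_cast; ring
      rw [e2, dvd_neg, Int.natCast_dvd_natCast] at hdvd
      have := Nat.le_of_dvd (by omega) hdvd
      omega
    obtain ⟨g, hg, hgy⟩ := ih (by omega) (by omega) hrun'
    rw [show N - (k + 1) - R = N - k - (R + 1) by omega] at hgy
    refine ⟨g, ?_, hgy⟩
    have h0 := hrun 0 (by omega)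
    rw [eval_Γ hξ hα0 (by omega)] at h0
    have hgdeg : g.natDegree ≤ k := by
      have := mem_degreeLT.mp hg
      exact natDegree_le_iff_degree_le.mpr (Order.lt_succ_iff.mp (by exact_mod_cast this))
    have hwdeg := natDegree_windowPoly (ξ := ξ) (α := α) (N - k - 1) ((i : ℤ) - (0 : ℕ))
    have hz : parityCheck ξ α (y - fun j : Fin N => g.eval (ξ * α ^ (j : ℕ)))
        (windowPoly ξ α (N - k - 1) ((i : ℤ) - (0 : ℕ))) = 0 :=
      parityCheck_windowPoly_eq_zero hN hα (i := i) (l := N - k - (R + 1))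
        (fun j hj => by simp [hgy j hj]) (by simp) (by push_cast; omega)
    rw [parityCheck_sub_left, h0, zero_sub, neg_eq_zero, parityCheck_eval hξ hα] at hz
    · have e : N - 1 = k + (N - k - 1) := by omega
      rw [e, coeff_mul_add_eq_of_natDegree_le hgdeg hwdeg.le] at hz
      have hone : (windowPoly ξ α (N - k - 1) ((i : ℤ) - (0 : ℕ))).coeff (N - k - 1) = 1 := by
        have := (windowPoly_monic (ξ := ξ) (α := α) (N - k - 1) ((i : ℤ) - (0 : ℕ))).coeff_natDegree
        rwa [hwdeg] at this
      rw [hone, mul_one] at hz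
      rw [mem_degreeLT, degree_lt_iff_coeff_zero]
      intro a ha
      rcases Nat.lt_or_ge k a with h | h
      · exact coeff_eq_zero_of_natDegree_lt (by omega)
      · rwa [show a = k by omega]
    · refine degree_le_natDegree.trans_lt (Nat.cast_lt.mpr ?_)
      have h3 := natDegree_mul_le (p := g)
        (q := windowPoly ξ α (N - k - 1) ((i : ℤ) - (0 : ℕ)))
      omega

/-- A burst on a window of length `l` produces a run of `N - k - l` roots of `Γ`. -/
theorem isRun_of_eq_off_window (hN : 0 < N) (hξ : ξ ≠ 0) (hα : orderOf α = N) {y : Fin N → F}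
    {i l : ℕ} {g : F[X]} (hg : g ∈ degreeLT F k)
    (hy : ∀ j : Fin N, ¬ Erased N i l j → y j = g.eval (ξ * α ^ (j : ℕ))) :
    IsRun N k ξ α y i (N - k - l) := by
  have hα0 := ne_zero_of_orderOf hN hα
  intro h hh
  rw [eval_Γ hξ hα0 (by omega)]
  have hz : parityCheck ξ α (y - fun j : Fin N => g.eval (ξ * α ^ (j : ℕ)))
      (windowPoly ξ α (N - k - 1) ((i : ℤ) - h)) = 0 :=
    parityCheck_windowPoly_eq_zero hN hα (i := i) (l := l)
      (fun j hj => by simp [hy j hj]) (by omega) (by omega)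
  have hdeg : (g * windowPoly ξ α (N - k - 1) ((i : ℤ) - h)).degree < ((N - 1 : ℕ) : WithBot ℕ) := by
    by_cases hg0 : g = 0
    · rw [hg0, zero_mul, degree_zero]
      exact WithBot.bot_lt_coe _
    rw [degree_mul, degree_eq_natDegree (windowPoly_monic _ _).ne_zero, natDegree_windowPoly]
    have := mem_degreeLT.mp hg
    rw [degree_eq_natDegree hg0] at this ⊢
    norm_cast at this ⊢
    omega
  rw [parityCheck_sub_left, parityCheck_eval hξ hα (hdeg.trans_le (by norm_cast; omega)),
    coeff_eq_zero_of_degree_lt hdeg, sub_zero] at hz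
  exact hz

theorem eval_erasureLocator_eq_zero (hα : orderOf α = N) {i l : ℕ} {j : Fin N}
    (hj : Erased N i l j) : (erasureLocator ξ α i l).eval (ξ * α ^ (j : ℕ)) = 0 := by
  obtain ⟨h, hh, hj⟩ := hj
  rw [erasureLocator, eval_prod]
  refine Finset.prod_eq_zero (i := h) (by simpa using hh) ?_
  rw [hj, ← hα, pow_mod_orderOf]
  simp

theorem natDegree_erasureLocator (i l : ℕ) : (erasureLocator ξ α i l).natDegree = l := by
  rw [erasureLocator, natDegree_prod_of_monic _ _ fun _ _ => monic_X_sub_C _]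
  simp only [natDegree_X_sub_C, Finset.sum_const, Finset.card_range, smul_eq_mul, mul_one]

/-- Erasure decoding recovers the codeword if it agrees with the received word outside a window
whose length is at most the redundancy. -/
theorem erasureDecode_eq (hN : 0 < N) (hξ : ξ ≠ 0) (hα : orderOf α = N) (hk : k ≤ N)
    {y : Fin N → F} {i l : ℕ} (hl : l ≤ N - k) {g : F[X]} (hg : g ∈ degreeLT F k)
    (hy : ∀ j : Fin N, ¬ Erased N i l j → y j = g.eval (ξ * α ^ (j : ℕ))) :
    erasureDecode N ξ α i l y = fun j : Fin N => g.eval (ξ * α ^ (j : ℕ)) := by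
  classical
  have hinj := (node_injective hξ hα).injOn (s := ((Finset.univ : Finset (Fin N)) : Set (Fin N)))
  have hdeg : (erasureLocator ξ α i l * g).degree < (Finset.univ : Finset (Fin N)).card := by
    rw [Finset.card_univ, Fintype.card_fin]
    by_cases hg0 : g = 0
    · rw [hg0, mul_zero, degree_zero]
      exact WithBot.bot_lt_coe _
    have hl0 : erasureLocator ξ α i l ≠ 0 := (monic_prod_of_monic _ _ fun _ _ => monic_X_sub_C _).ne_zero
    rw [degree_mul, degree_eq_natDegree hl0, natDegree_erasureLocator]
    have := mem_degreeLT.mp hg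
    rw [degree_eq_natDegree hg0] at this ⊢
    norm_cast at this ⊢
    omega
  have hG : Lagrange.interpolate Finset.univ (fun j : Fin N => ξ * α ^ (j : ℕ))
      (fun j => if Erased N i l j then 0
        else (erasureLocator ξ α i l).eval (ξ * α ^ (j : ℕ)) * y j) =
      erasureLocator ξ α i l * g := by
    refine (Lagrange.eq_interpolate_of_eval_eq _ hinj hdeg fun j _ => ?_).symm
    rw [eval_mul]
    split_ifs with h
    · rw [eval_erasureLocator_eq_zero hα h, zero_mul]
    · rw [hy j h]
  funext j
  simp only [erasureDecode, hG]
  split_ifs with h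
  · rw [derivative_mul, eval_add, eval_mul, eval_mul, eval_erasureLocator_eq_zero hα h, zero_mul,
      add_zero, mul_div_cancel_left₀]
    -- the locator has simple roots, because a window of at most `N` positions has no repetition
    obtain ⟨h', hh', hj⟩ := h
    have hxj : ξ * α ^ (j : ℕ) = ξ * α ^ (i + h') := by rw [hj, ← hα, pow_mod_orderOf]
    have hsplit : erasureLocator ξ α i l = (X - C (ξ * α ^ (j : ℕ))) *
        ∏ a ∈ (Finset.range l).erase h', (X - C (ξ * α ^ (i + a))) := by
      rw [hxj]
      exact (Finset.mul_prod_erase (Finset.range l) (fun a => X - C (ξ * α ^ (i + a)))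
        (by simpa using hh')).symm
    rw [hsplit, derivative_mul, eval_add, eval_mul, eval_mul, eval_sub, eval_X, eval_C, sub_self,
      zero_mul, add_zero, derivative_X_sub_C, eval_one, one_mul, eval_prod, Finset.prod_ne_zero_iff]
    intro a ha
    rw [eval_sub, eval_X, eval_C, hxj, sub_ne_zero, Ne, mul_right_inj' hξ]
    intro hcon
    have hα0 := ne_zero_of_orderOf hN hα
    rw [pow_add, pow_add, mul_right_inj' (pow_ne_zero _ hα0)] at hcon
    simp only [Finset.mem_erase, Finset.mem_range] at ha
    exact ha.1 (pow_injOn_Iio_orderOf (by simp; omega) (by simp; omega) hcon).symm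
  · exact hy j h

/-- A run of roots of `Γ` of admissible length determines a window on which erasure decoding
returns a codeword. -/
theorem erasureDecode_of_isRun (hN : 0 < N) (hξ : ξ ≠ 0) (hα : orderOf α = N) (hk : k ≤ N)
    {y : Fin N → F} {i R : ℕ} (hR : R ≤ N - k) (hrun : IsRun N k ξ α y i R) :
    ∃ g ∈ degreeLT F k,
      (erasureDecode N ξ α i (N - k - R) y = fun j : Fin N => g.eval (ξ * α ^ (j : ℕ))) ∧
      ∀ j : Fin N, ¬ Erased N i (N - k - R) j → y j = g.eval (ξ * α ^ (j : ℕ)) := by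
  obtain ⟨g, hg, hgy⟩ := exists_degreeLT_of_isRun hN hξ hα hk hR hrun
  exact ⟨g, hg, erasureDecode_eq hN hξ hα hk (Nat.sub_le _ _) hg hgy, hgy⟩

end

end CyclicBurst

/-! ### The polynomials of the chain of subgroups -/

/-- The polynomial `∏ v ∈ V, (x + v)` of a finite additive subgroup `V`. -/
noncomputable def subgroupPoly {F : Type u} [Field F] [Finite F] (V : AddSubgroup F) : F[X] :=
  ∏ v ∈ (Set.toFinite (V : Set F)).toFinset, (X + C v)

section

variable {F : Type u} [Field F] [Finite F] (V : AddSubgroup F)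

theorem subgroupPoly_monic : (subgroupPoly V).Monic :=
  monic_prod_of_monic _ _ fun _ _ => monic_X_add_C _

theorem natDegree_subgroupPoly : (subgroupPoly V).natDegree = Nat.card V := by
  rw [subgroupPoly, natDegree_prod_of_monic _ _ fun _ _ => monic_X_add_C _]
  simp only [natDegree_X_add_C, Finset.sum_const, smul_eq_mul, mul_one]
  rw [← Set.ncard_eq_toFinset_card _ (Set.toFinite _)]
  rfl

theorem eval_subgroupPoly_eq_zero_iff {x : F} : (subgroupPoly V).eval x = 0 ↔ x ∈ V := by
  rw [subgroupPoly, eval_prod, Finset.prod_eq_zero_iff]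
  simp only [Set.Finite.mem_toFinset, SetLike.mem_coe, eval_add, eval_X, eval_C]
  constructor
  · rintro ⟨v, hv, h⟩
    rw [eq_neg_of_add_eq_zero_left h]
    exact V.neg_mem hv
  · intro h
    exact ⟨-x, V.neg_mem h, by simp⟩

theorem eval_subgroupPoly_add {v : F} (hv : v ∈ V) (x : F) :
    (subgroupPoly V).eval (x + v) = (subgroupPoly V).eval x := by
  rw [subgroupPoly, eval_prod, eval_prod]
  refine Finset.prod_bij (fun a _ => v + a) ?_ ?_ ?_ ?_
  · intro a ha
    simp only [Set.Finite.mem_toFinset, SetLike.mem_coe] at ha ⊢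
    exact V.add_mem hv ha
  · intro a _ a' _ h
    exact add_left_cancel h
  · intro a ha
    simp only [Set.Finite.mem_toFinset, SetLike.mem_coe] at ha ⊢
    exact ⟨-v + a, V.add_mem (V.neg_mem hv) ha, by abel⟩
  · intro a _
    simp [add_assoc]

end

namespace GFFTData

section

variable {K F : Type u} [Field K] [Field F] [Algebra K F] (D : GFFTData K F)

theorem m_succ (s : ℕ) : D.m (s + 1) = D.m s * D.p s := Finset.prod_range_succ _ _

theorem m_dvd_m {i j : ℕ} (h : i ≤ j) : D.m i ∣ D.m j :=
  Finset.prod_dvd_prod_of_subset _ _ _ (Finset.range_subset_range.mpr h)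

theorem m_of_le {i : ℕ} (hi : i ≤ D.w) : D.m i = Nat.card K ^ i := by
  rw [m, Finset.prod_congr rfl (g := fun _ => Nat.card K), Finset.prod_const, Finset.card_range]
  intro j hj
  rw [Finset.mem_range] at hj
  rw [p, if_pos (by omega)]

theorem m_add (i : ℕ) : D.m (D.w + i) = Nat.card K ^ D.w * ∏ j ∈ Finset.range i, D.q j := by
  rw [m, Finset.prod_range_add, ← D.m_of_le le_rfl, m]
  congr 1
  refine Finset.prod_congr rfl fun j _ => ?_
  rw [p, if_neg (by omega), Nat.add_sub_cancel_left]

variable [Finite K]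

theorem two_le_p {j : ℕ} (hj : j < D.r) : 2 ≤ D.p j := by
  unfold p
  split_ifs with h
  · exact Finite.one_lt_card
  · exact D.two_le_q _ (by unfold r at hj; omega)

theorem m_pos {s : ℕ} (hs : s ≤ D.r) : 0 < D.m s :=
  Finset.prod_pos fun j hj => by
    have := D.two_le_p (j := j) (by rw [Finset.mem_range] at hj; omega)
    omega

theorem ns_pos (s : ℕ) : 0 < D.ns s :=
  Finset.prod_pos fun j hj => by
    have := D.two_le_p (j := j) (by rw [Finset.mem_Ico] at hj; omega)
    omega

theorem card_T {i : ℕ} (hi : i ≤ D.μ) : Nat.card (D.T i) = ∏ j ∈ Finset.range i, D.q j := by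
  have hdvd : (∏ j ∈ Finset.range i, D.q j) ∣ Nat.card Kˣ := by
    rw [Nat.card_units]
    exact (Finset.prod_dvd_prod_of_subset _ _ _ (Finset.range_subset_range.mpr hi)).trans D.q_dvd
  have h := IsCyclic.card_powMonoidHom_ker (G := Kˣ) (∏ j ∈ Finset.range i, D.q j)
  rw [Nat.gcd_eq_right hdvd] at h
  exact h

end

section

variable {K F : Type u} [Field K] [Field F] [Algebra K F] [Finite K] [Finite F]
  (D : GFFTData K F)

/-- The group acts on `x` by translations by `W` up to scalars, so `x_i` is a power of the polynomial
of a subspace. -/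
theorem xpoly_eq {i : ℕ} (hi : i ≤ D.r) : D.xpoly i =
    subgroupPoly (D.W (min i D.w)).toAddSubgroup ^ ∏ j ∈ Finset.range (i - D.w), D.q j := by
  rw [← D.card_T (i := i - D.w) (by unfold r at hi; omega), xpoly]
  have key : ∀ β : Kˣ, ∏ v ∈ (Set.toFinite {v : F | v ∈ D.W (min i D.w)}).toFinset,
      C (algebraMap K F β)⁻¹ * (C (algebraMap K F β) * X + C v) =
        subgroupPoly (D.W (min i D.w)).toAddSubgroup := by
    intro β
    have hβ : algebraMap K F β ≠ 0 := by simp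
    rw [subgroupPoly]
    refine Finset.prod_bij (fun v _ => (β⁻¹ : Kˣ).1 • v) ?_ ?_ ?_ ?_
    · intro v hv
      simp only [Set.Finite.mem_toFinset, Set.mem_ofPred_eq, SetLike.mem_coe,
        Submodule.mem_toAddSubgroup] at hv ⊢
      exact Submodule.smul_mem _ _ hv
    · intro v _ v' _ h
      exact smul_right_injective F (Units.ne_zero β⁻¹) h
    · intro v hv
      simp only [Set.Finite.mem_toFinset, Set.mem_ofPred_eq, SetLike.mem_coe,
        Submodule.mem_toAddSubgroup] at hv ⊢
      exact ⟨β.1 • v, Submodule.smul_mem _ _ hv, by rw [smul_smul]; simp⟩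
    · intro v _
      rw [mul_add, ← mul_assoc, ← C_mul, inv_mul_cancel₀ hβ, C_1, one_mul, ← C_mul,
        Algebra.smul_def, Units.val_inv_eq_inv_val, map_inv₀]
  rw [Finset.prod_congr rfl (fun β _ => key β), Finset.prod_const]
  congr 1
  rw [← Set.ncard_eq_toFinset_card _ (Set.toFinite _)]
  rfl

theorem xpoly_monic {i : ℕ} (hi : i ≤ D.r) : (D.xpoly i).Monic := by
  rw [D.xpoly_eq hi]
  exact (subgroupPoly_monic _).pow _

theorem natDegree_xpoly {i : ℕ} (hi : i ≤ D.r) : (D.xpoly i).natDegree = D.m i := by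
  have hcard : Nat.card (D.W (min i D.w)).toAddSubgroup = Nat.card K ^ min i D.w := by
    have h := Module.natCard_eq_pow_finrank (K := K) (V := D.W (min i D.w))
    rw [D.finrank_W _ (min_le_right _ _)] at h
    exact h
  rw [D.xpoly_eq hi, (subgroupPoly_monic _).natDegree_pow, natDegree_subgroupPoly, hcard]
  rcases le_total i D.w with h | h
  · rw [min_eq_left h, D.m_of_le h, Nat.sub_eq_zero_of_le h]
    simp
  · obtain ⟨a, rfl⟩ := Nat.exists_eq_add_of_le h
    rw [min_eq_right h, D.m_add, Nat.add_sub_cancel_left, mul_comm]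

theorem basisPoly_zero : D.basisPoly 0 = 1 := by
  simp [basisPoly]

/-- The digits of `u * m_s + i` are those of `i`, followed by `u`. -/
theorem basisPoly_add {s u i : ℕ} (hs : s < D.r) (hu : u < D.p s) (hi : i < D.m s) :
    D.basisPoly (u * D.m s + i) = D.xpoly s ^ u * D.basisPoly i := by
  have hm : ∀ k ≤ D.r, 0 < D.m k := fun k hk => D.m_pos hk
  have hdig : ∀ k < D.r, (u * D.m s + i) / D.m k % D.p k =
      (if k = s then u else 0) + i / D.m k % D.p k := by
    intro k hk
    rcases lt_trichotomy k s with h | h | h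
    · rw [if_neg h.ne, zero_add]
      obtain ⟨c, hc⟩ := D.m_dvd_m (Nat.succ_le_of_lt h)
      rw [Nat.succ_eq_add_one, D.m_succ] at hc
      have : u * D.m s + i = i + D.m k * (D.p k * (c * u)) := by rw [hc]; ring
      rw [this, Nat.add_mul_div_left _ _ (hm k hk.le), Nat.add_mul_mod_self_left]
    · subst h
      rw [if_pos rfl, Nat.div_eq_of_lt hi, Nat.zero_mod, add_zero, add_comm,
        Nat.add_mul_div_right _ _ (hm _ hk.le), Nat.div_eq_of_lt hi, zero_add, Nat.mod_eq_of_lt hu]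
    · rw [if_neg h.ne', zero_add]
      have h1 : D.m s * D.p s ≤ D.m k := by
        rw [← D.m_succ]
        exact Nat.le_of_dvd (hm k hk.le) (D.m_dvd_m h)
      have h2 : u * D.m s + i < D.m s * D.p s := by nlinarith
      rw [Nat.div_eq_of_lt (by omega), Nat.div_eq_of_lt (by nlinarith)]
  rw [basisPoly, basisPoly, Finset.prod_congr rfl (g := fun k =>
    (if k = s then D.xpoly s ^ u else 1) * D.xpoly k ^ (i / D.m k % D.p k)),
    Finset.prod_mul_distrib, Finset.prod_ite_eq' , if_pos (Finset.mem_range.mpr hs)]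
  intro k hk
  rw [hdig k (Finset.mem_range.mp hk), pow_add]
  split_ifs with h
  · rw [h]
  · rw [pow_zero]

end

end GFFTData

/-! ### Bases of polynomials graded by degree -/

/-- The polynomials `b 0, …, b (m - 1)` are monic, and `b i` has degree `i`. -/
def IsGradedBasis {F : Type u} [Field F] (b : ℕ → F[X]) (m : ℕ) : Prop :=
  ∀ i < m, (b i).Monic ∧ (b i).natDegree = i

section

variable {F : Type u} [Field F]

/-- A basis graded up to degree `m` is continued to degree `p m` by the powers of a polynomial `x`
of degree `m`. -/
theorem IsGradedBasis.mul {b : ℕ → F[X]} {x : F[X]} {m p : ℕ} (hm : IsGradedBasis b m)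
    (hx : x.Monic) (hxm : x.natDegree = m)
    (hb : ∀ u < p, ∀ i < m, b (u * m + i) = x ^ u * b i) : IsGradedBasis b (p * m) := by
  intro k hk
  have hm0 : 0 < m := Nat.pos_of_mul_pos_left (by omega : 0 < p * m)
  have h1 : k / m < p := Nat.div_lt_of_lt_mul (by rwa [mul_comm])
  have h2 : k % m < m := Nat.mod_lt _ hm0
  have h3 := hb _ h1 _ h2
  rw [mul_comm, Nat.div_add_mod] at h3
  obtain ⟨h4, h5⟩ := hm _ h2
  rw [h3]
  refine ⟨(hx.pow _).mul h4, ?_⟩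
  rw [(hx.pow _).natDegree_mul h4, hx.natDegree_pow, hxm, h5, mul_comm, Nat.div_add_mod]

/-- Repeated division by `x`: the expansion of a polynomial of degree less than `k` over the
products of powers of `x` with a graded basis. -/
theorem IsGradedBasis.exists_expansion {b : ℕ → F[X]} {x : F[X]} {m : ℕ} (hb : IsGradedBasis b m)
    (hm : 0 < m) (hx : x.Monic) (hxm : x.natDegree = m) :
    ∀ (k : ℕ) (f : F[X]), f ∈ degreeLT F k → ∃ φ : Fin m → F[X],
      (∀ i : Fin m, φ i ∈ degreeLT F ((k + (m - 1 - i)) / m)) ∧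
      f = ∑ i : Fin m, (φ i).comp x * b i := by
  classical
  intro k
  induction k with
  | zero =>
    intro f hf
    refine ⟨0, fun i => Submodule.zero_mem _, ?_⟩
    have : f = 0 := by
      rw [mem_degreeLT] at hf
      by_contra h
      rw [degree_eq_natDegree h] at hf
      norm_cast at hf
    simp [this]
  | succ k ih =>
    intro f hf
    have hr : k % m < m := Nat.mod_lt _ hm
    obtain ⟨hb1, hb2⟩ := hb _ hr
    set g : F[X] := x ^ (k / m) * b (k % m) with hg
    have hgm : g.Monic := (hx.pow _).mul hb1
    have hgd : g.natDegree = k := by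
      rw [hg, (hx.pow _).natDegree_mul hb1, hx.natDegree_pow, hxm, hb2, mul_comm, Nat.div_add_mod]
    have hf' : f - C (f.coeff k) * g ∈ degreeLT F k := by
      rw [mem_degreeLT, degree_lt_iff_coeff_zero] at hf ⊢
      intro a ha
      rw [coeff_sub, coeff_C_mul]
      rcases Nat.lt_or_ge k a with h | h
      · rw [hf a h, coeff_eq_zero_of_natDegree_lt (p := g) (by omega), mul_zero, sub_zero]
      · have : a = k := by omega
        subst this
        have h1 := hgm.coeff_natDegree
        rw [hgd] at h1
        rw [h1, mul_one, sub_self]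
    obtain ⟨φ, hφ, hfφ⟩ := ih _ hf'
    refine ⟨fun i => φ i + if (i : ℕ) = k % m then C (f.coeff k) * X ^ (k / m) else 0, ?_, ?_⟩
    · intro i
      refine Submodule.add_mem _ (degreeLT_mono (Nat.div_le_div_right (by omega)) (hφ i)) ?_
      split_ifs with h
      · have e : (k + 1 + (m - 1 - (i : ℕ))) / m = k / m + 1 := by
          have h1 := Nat.div_add_mod k m
          have : k + 1 + (m - 1 - (i : ℕ)) = m * (k / m + 1) := by
            rw [mul_add, mul_one]; omega
          rw [this, Nat.mul_div_cancel_left _ hm]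
        rw [e, mem_degreeLT]
        exact (degree_C_mul_X_pow_le _ _).trans_lt (by exact_mod_cast Nat.lt_succ_self _)
      · exact Submodule.zero_mem _
    · have : f = (f - C (f.coeff k) * g) + C (f.coeff k) * g := by ring
      conv_lhs => rw [this, hfφ]
      simp only [add_comp, add_mul, Finset.sum_add_distrib]
      congr 1
      · rw [Finset.sum_eq_single (⟨k % m, hr⟩ : Fin m)]
        · simp [hg, mul_assoc]
        · intro i _ hi
          have : ¬ (i : ℕ) = k % m := fun h => hi (Fin.ext h)
          simp [this]
        · simp

end

namespace GFFTData

section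

variable {K F : Type u} [Field K] [Field F] [Algebra K F] [Finite K] [Finite F]
  (D : GFFTData K F)

theorem isGradedBasis_basisPoly {s : ℕ} (hs : s ≤ D.r) : IsGradedBasis D.basisPoly (D.m s) := by
  induction s with
  | zero =>
    intro i hi
    have : i = 0 := by simpa [m] using hi
    subst this
    rw [D.basisPoly_zero]
    exact ⟨monic_one, natDegree_one⟩
  | succ s ih =>
    rw [m_succ, mul_comm]
    exact (ih (by omega)).mul (D.xpoly_monic (by omega)) (D.natDegree_xpoly (by omega))
      fun u hu i hi => D.basisPoly_add (by omega) hu hi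

end

end GFFTData

/-! ### Folding a word into rows -/

namespace GFFTData

section

variable {K F : Type u} [Field K] [Field F] [Algebra K F] (D : GFFTData K F) {s : ℕ} (hs : s ≤ D.r)

theorem val_pos (j : Fin (D.ns s)) (a : Fin (D.m s)) :
    (D.pos hs j a : ℕ) = a + D.m s * j := by
  simp [pos]

theorem exists_pos_eq (c : Fin D.n) : ∃ j a, D.pos hs j a = c := by
  obtain ⟨⟨j, a⟩, h⟩ := finProdFinEquiv.surjective (Fin.cast (D.ns_mul_m hs).symm c)
  exact ⟨j, a, by rw [pos, h]; simp⟩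

theorem pos_inj {j j' : Fin (D.ns s)} {a a' : Fin (D.m s)}
    (h : D.pos hs j a = D.pos hs j' a') : j = j' ∧ a = a' := by
  simpa [pos] using h

end

section

variable {K F : Type u} [Field K] [Field F] [Algebra K F] [Finite K] [Finite F]
  {D : GFFTData K F} {s : ℕ} {hs : s ≤ D.r} (A : D.Arrangement hs) (b : ℕ → F[X])

/-- `x_s` does not vanish on the evaluation points, which lie outside `W`. -/
theorem Arrangement.ξ_ne_zero : A.ξ ≠ 0 := by
  have h := A.xpoly_eval ⟨0, D.ns_pos s⟩ ⟨0, D.m_pos hs⟩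
  rw [pow_zero, mul_one] at h
  rw [← h, D.xpoly_eq hs, eval_pow]
  refine pow_ne_zero _ ?_
  rw [Ne, eval_subgroupPoly_eq_zero_iff]
  obtain ⟨β, _, v, hv, hx⟩ : A.pts (D.pos hs ⟨0, D.ns_pos s⟩ ⟨0, D.m_pos hs⟩) ∈ D.points :=
    A.range_eq ▸ Set.mem_range_self _
  rw [hx]
  intro hmem
  have hle : ∀ j, j ≤ D.w → D.W j ≤ D.W D.w := by
    intro j hj
    exact Nat.decreasingInduction (motive := fun j _ => D.W j ≤ D.W D.w)
      (fun i hi ih => (D.W_le i hi).trans ih) le_rfl hj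
  have h1 : β.1 • (D.γ + v) ∈ D.W D.w := by
    rw [Algebra.smul_def]
    exact hle _ (min_le_right _ _) hmem
  have h2 : D.γ + v ∈ D.W D.w := by
    have := Submodule.smul_mem _ (β⁻¹ : Kˣ).1 h1
    rwa [smul_smul, Units.inv_mul, one_smul] at this
  exact D.γ_notMem (by simpa using Submodule.sub_mem _ h2 hv)

/-- Evaluation of the polynomials `b 0, b 1, …` at the points of the `j`-th block. -/
noncomputable def blockMatrix (j : Fin (D.ns s)) : Matrix (Fin (D.m s)) (Fin (D.m s)) F :=
  Matrix.of fun a i => (b i).eval (A.pts (D.pos hs j a))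

/-- The `i`-th row of the folded word: the `i`-th coefficients, in the basis `b`, of the polynomials
that interpolate the blocks. -/
noncomputable def foldRow (i : Fin (D.m s)) : (Fin D.n → F) →ₗ[F] (Fin (D.ns s) → F) :=
  LinearMap.pi fun j => LinearMap.proj i ∘ₗ Matrix.mulVecLin (blockMatrix A b j)⁻¹ ∘ₗ
    LinearMap.funLeft F F (D.pos hs j)

theorem foldRow_apply (i : Fin (D.m s)) (y : Fin D.n → F) (j : Fin (D.ns s)) :
    foldRow A b i y j = ((blockMatrix A b j)⁻¹.mulVec fun a => y (D.pos hs j a)) i := rfl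

/-- The word whose folded rows are `Z`. -/
noncomputable def unfoldRows (Z : Fin (D.m s) → Fin (D.ns s) → F) : Fin D.n → F := fun c =>
  (∑ i : Fin (D.m s), (Lagrange.interpolate Finset.univ
    (fun j : Fin (D.ns s) => A.ξ * A.α ^ (j : ℕ)) (Z i)).comp (D.xpoly s) * b i).eval (A.pts c)

theorem burstDecode_eq (k : ℕ) (y : Fin D.n → F) :
    D.burstDecode A k y = unfoldRows A D.basisPoly fun i =>
      CyclicBurst.decode (D.ns s) (D.rowDim s k i) A.ξ A.α (foldRow A D.basisPoly i y) := rfl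

theorem Arrangement.node_injective :
    Function.Injective fun j : Fin (D.ns s) => A.ξ * A.α ^ (j : ℕ) :=
  CyclicBurst.node_injective A.ξ_ne_zero A.orderOf_α

theorem unfoldRows_pos (Z : Fin (D.m s) → Fin (D.ns s) → F) (j : Fin (D.ns s))
    (a : Fin (D.m s)) : unfoldRows A b Z (D.pos hs j a) =
      ∑ i : Fin (D.m s), Z i j * (b i).eval (A.pts (D.pos hs j a)) := by
  rw [unfoldRows, eval_finsetSum]
  refine Finset.sum_congr rfl fun i _ => ?_
  rw [eval_mul, eval_comp, A.xpoly_eval, Lagrange.eval_interpolate_at_node _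
    A.node_injective.injOn (Finset.mem_univ j)]

variable {b}

theorem isUnit_blockMatrix (hb : IsGradedBasis b (D.m s)) (j : Fin (D.ns s)) :
    IsUnit (blockMatrix A b j) := by
  classical
  rw [← Matrix.mulVec_surjective_iff_isUnit]
  intro y
  have hinj : Function.Injective fun a => A.pts (D.pos hs j a) := fun a a' h =>
    (D.pos_inj hs (A.injective h)).2
  set f := Lagrange.interpolate Finset.univ (fun a => A.pts (D.pos hs j a)) y with hf
  have hdeg : f ∈ degreeLT F (D.m s) := by
    rw [mem_degreeLT]
    have h := Lagrange.degree_interpolate_lt (s := Finset.univ) y hinj.injOn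
    rwa [Finset.card_univ, Fintype.card_fin] at h
  obtain ⟨φ, hφ, hfφ⟩ := hb.exists_expansion (D.m_pos hs) (D.xpoly_monic hs)
    (D.natDegree_xpoly hs) _ f hdeg
  refine ⟨fun i => (φ i).eval (A.ξ * A.α ^ (j : ℕ)), ?_⟩
  funext a
  have h1 := Lagrange.eval_interpolate_at_node y (s := Finset.univ)
    (v := fun a => A.pts (D.pos hs j a)) hinj.injOn (Finset.mem_univ a)
  rw [← hf, hfφ, eval_finsetSum] at h1
  rw [← h1, Matrix.mulVec, dotProduct]
  refine Finset.sum_congr rfl fun i _ => ?_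
  rw [eval_mul, eval_comp, A.xpoly_eval, mul_comm]
  rfl

theorem sum_foldRow_mul (hb : IsGradedBasis b (D.m s)) (y : Fin D.n → F) (j : Fin (D.ns s))
    (a : Fin (D.m s)) : ∑ i, foldRow A b i y j * (b i).eval (A.pts (D.pos hs j a)) =
      y (D.pos hs j a) := by
  have h := Matrix.mul_nonsing_inv (blockMatrix A b j)
    ((Matrix.isUnit_iff_isUnit_det _).mp (isUnit_blockMatrix A hb j))
  have h2 : (blockMatrix A b j).mulVec ((blockMatrix A b j)⁻¹.mulVec fun a => y (D.pos hs j a)) =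
      fun a => y (D.pos hs j a) := by
    rw [Matrix.mulVec_mulVec, h, Matrix.one_mulVec]
  rw [← congrFun h2 a, Matrix.mulVec, dotProduct]
  exact Finset.sum_congr rfl fun i _ => by rw [mul_comm]; rfl

theorem unfoldRows_foldRow (hb : IsGradedBasis b (D.m s)) (y : Fin D.n → F) :
    unfoldRows A b (fun i => foldRow A b i y) = y := by
  funext c
  obtain ⟨j, a, rfl⟩ := D.exists_pos_eq hs c
  rw [unfoldRows_pos, sum_foldRow_mul A hb]

/-- The fold is determined by the expansion of the interpolation polynomials. -/
theorem foldRow_eq_of_sum_mul (hb : IsGradedBasis b (D.m s)) {y : Fin D.n → F} {j : Fin (D.ns s)}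
    {z : Fin (D.m s) → F}
    (hz : ∀ a, ∑ i, z i * (b i).eval (A.pts (D.pos hs j a)) = y (D.pos hs j a))
    (i : Fin (D.m s)) : foldRow A b i y j = z i := by
  have h := Matrix.nonsing_inv_mul (blockMatrix A b j)
    ((Matrix.isUnit_iff_isUnit_det _).mp (isUnit_blockMatrix A hb j))
  have h2 : (fun a => y (D.pos hs j a)) = (blockMatrix A b j).mulVec z := by
    funext a
    rw [← hz a, Matrix.mulVec, dotProduct]
    exact Finset.sum_congr rfl fun i _ => by rw [mul_comm]; rfl
  rw [foldRow_apply, h2, Matrix.mulVec_mulVec, h, Matrix.one_mulVec]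

variable (b) in
theorem foldRow_eq_zero {y : Fin D.n → F} {j : Fin (D.ns s)} (hy : ∀ a, y (D.pos hs j a) = 0)
    (i : Fin (D.m s)) : foldRow A b i y j = 0 := by
  rw [foldRow_apply, funext hy]
  exact congrFun (Matrix.mulVec_zero _) i

/-- The rows of a codeword of dimension `k` are codewords of dimensions `rowDim s k i`. -/
theorem exists_foldRow_eq_eval (hb : IsGradedBasis b (D.m s)) {k : ℕ} {c : Fin D.n → F}
    (hc : c ∈ RSCode A.pts k) : ∃ φ : Fin (D.m s) → F[X],
      (∀ i : Fin (D.m s), φ i ∈ degreeLT F (D.rowDim s k i)) ∧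
        ∀ i, foldRow A b i c = fun j : Fin (D.ns s) => (φ i).eval (A.ξ * A.α ^ (j : ℕ)) := by
  obtain ⟨f, hf, rfl⟩ := hc
  obtain ⟨φ, hφ, hfφ⟩ := hb.exists_expansion (D.m_pos hs) (D.xpoly_monic hs)
    (D.natDegree_xpoly hs) _ f hf
  refine ⟨φ, hφ, fun i => ?_⟩
  funext j
  refine foldRow_eq_of_sum_mul A hb (z := fun i => (φ i).eval (A.ξ * A.α ^ (j : ℕ)))
    (fun a => ?_) i
  rw [hfφ, eval_finsetSum]
  exact Finset.sum_congr rfl fun i _ => by rw [eval_mul, eval_comp, A.xpoly_eval]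

/-- Rows that are codewords of dimension `κ` unfold to a codeword of dimension `m κ`. -/
theorem unfoldRows_mem_RSCode (hb : IsGradedBasis b (D.m s)) {κ : ℕ}
    {Z : Fin (D.m s) → Fin (D.ns s) → F}
    (hZ : ∀ i, ∃ g ∈ degreeLT F κ, Z i = fun j : Fin (D.ns s) => g.eval (A.ξ * A.α ^ (j : ℕ))) :
    unfoldRows A b Z ∈ RSCode A.pts (D.m s * κ) := by
  choose g hg hZg using hZ
  refine ⟨∑ i, (g i).comp (D.xpoly s) * b i, Submodule.sum_mem _ fun i _ => ?_, ?_⟩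
  · by_cases h0 : g i = 0
    · simp only [h0, zero_comp, zero_mul, Submodule.zero_mem]
    have h1 := mem_degreeLT.mp (hg i)
    rw [degree_eq_natDegree h0] at h1
    norm_cast at h1
    rw [mem_degreeLT]
    refine degree_le_natDegree.trans_lt (Nat.cast_lt.mpr ?_)
    refine natDegree_mul_le.trans_lt ?_
    rw [natDegree_comp, D.natDegree_xpoly hs, (hb i i.2).2]
    have := i.2
    have h2 : D.m s * ((g i).natDegree + 1) ≤ D.m s * κ := Nat.mul_le_mul_left _ h1
    rw [mul_add, mul_one] at h2
    rw [mul_comm]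
    omega
  · funext c
    obtain ⟨j, a, rfl⟩ := D.exists_pos_eq hs c
    rw [unfoldRows_pos, eval_finsetSum]
    exact Finset.sum_congr rfl fun i _ => by rw [eval_mul, eval_comp, A.xpoly_eval, hZg]

/-- The number of blocks that a window of `l` positions starting at `a` may touch. -/
noncomputable def blockLen (D : GFFTData K F) (s a l : ℕ) : ℕ :=
  (a % D.m s + l + (D.m s - 1)) / D.m s

omit [Finite F] in
theorem blockLen_mul_le (hs : s ≤ D.r) (a l : ℕ) :
    D.m s * D.blockLen s a l + 2 ≤ l + 2 * D.m s := by
  have hm := D.m_pos hs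
  have h1 := Nat.mul_div_le (a % D.m s + l + (D.m s - 1)) (D.m s)
  have h2 := Nat.mod_lt a hm
  rw [blockLen]
  omega

omit [Finite F] in
variable (hs) in
/-- A burst on a window is supported on the blocks that the window touches. -/
theorem eq_zero_of_not_erased {a l : ℕ} {err : Fin D.n → F}
    (herr : err ∈ burstErrors F D.n a l) {j : Fin (D.ns s)}
    (hj : ¬ CyclicBurst.Erased (D.ns s) (a / D.m s) (D.blockLen s a l) j) (a' : Fin (D.m s)) :
    err (D.pos hs j a') = 0 := by
  by_contra h
  have h1 := herr _ h
  rw [D.val_pos hs] at h1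
  refine hj ⟨j - a / D.m s, ?_, ?_⟩
  · have hm := D.m_pos hs
    have h2 := Nat.div_add_mod a (D.m s)
    have h3 : a / D.m s ≤ j := by
      rw [← Nat.lt_succ_iff, Nat.div_lt_iff_lt_mul hm, Nat.succ_mul, mul_comm]
      have := a'.2
      omega
    obtain ⟨d, hd⟩ := Nat.exists_eq_add_of_le h3
    rw [hd, Nat.add_sub_cancel_left, blockLen, Nat.lt_div_iff_mul_lt hm]
    rw [hd, mul_add, mul_comm] at h1
    rw [mul_comm] at h2
    rw [mul_comm (D.m s) d] at h1
    omega
  · have hm := D.m_pos hs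
    have h3 : a / D.m s ≤ j := by
      rw [← Nat.lt_succ_iff, Nat.div_lt_iff_lt_mul hm, Nat.succ_mul, mul_comm]
      have := a'.2
      omega
    rw [Nat.add_sub_cancel' h3, Nat.mod_eq_of_lt j.2]

omit [Finite F] in
/-- Since `n ε ≥ m`, a burst within the radius leaves a slack of `m (e + 2)` positions. -/
theorem lt_of_radius (hs : s ≤ D.r) {κ l e : ℕ} {ε : ℝ} (hε : 1 / (D.ns s : ℝ) ≤ ε)
    (hl : (l : ℝ) < D.n - κ - D.n * ε * (e + 2)) : κ + l + D.m s * (e + 2) < D.n := by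
  have hN : (0 : ℝ) < D.ns s := by exact_mod_cast D.ns_pos s
  have h1 : (D.m s : ℝ) ≤ D.n * ε := by
    rw [← D.ns_mul_m hs]
    push_cast
    have := mul_le_mul_of_nonneg_left hε hN.le
    rw [mul_one_div_cancel hN.ne'] at this
    have hm : (0 : ℝ) ≤ D.m s := Nat.cast_nonneg _
    nlinarith
  have h2 : (D.m s : ℝ) * (e + 2) ≤ D.n * ε * (e + 2) := by gcongr
  have h3 : (κ + l + D.m s * (e + 2) : ℝ) < D.n := by linarith
  exact_mod_cast h3

end

end GFFTData

/-! ### The generalized Wu algorithm fails only on confusable errors -/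

namespace CyclicBurst

variable {F : Type u} [Field F] {N k : ℕ} {ξ α : F}

/-- If the algorithm misdecodes a burst on a window of length `l`, then another window of length `l`
explains the received word by another codeword. -/
theorem exists_confusion_of_decode_ne (hN : 0 < N) (hξ : ξ ≠ 0) (hα : orderOf α = N) (hk : k ≤ N)
    {y : Fin N → F} {i l : ℕ} {g : F[X]} (hg : g ∈ degreeLT F k)
    (hy : ∀ j : Fin N, ¬ Erased N i l j → y j = g.eval (ξ * α ^ (j : ℕ)))
    (hne : decode N k ξ α y ≠ fun j : Fin N => g.eval (ξ * α ^ (j : ℕ))) :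
    ∃ u < N, ∃ z : Fin N → F, (∀ j ∉ window N u l, z j = 0) ∧
      (y - fun j : Fin N => g.eval (ξ * α ^ (j : ℕ))) - z ∈
        rsSubmodule (fun j : Fin N => ξ * α ^ (j : ℕ)) k ∧
      (y - fun j : Fin N => g.eval (ξ * α ^ (j : ℕ))) ≠ z := by
  classical
  have hex : ∃ i, IsRun N k ξ α y i (N - k - l) := ⟨i, isRun_of_eq_off_window hN hξ hα hg hy⟩
  have hR1 : N - k - l ≤ maxRun N k ξ α y :=
    Nat.le_findGreatest (P := fun R => ∃ i, IsRun N k ξ α y i R) (Nat.sub_le _ _) hex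
  have hR2 : maxRun N k ξ α y ≤ N - k := Nat.findGreatest_le _
  have hex2 : ∃ i, IsRun N k ξ α y i (maxRun N k ξ α y) :=
    Nat.findGreatest_spec (P := fun R => ∃ i, IsRun N k ξ α y i R) (Nat.sub_le _ _) hex
  have hrun : IsRun N k ξ α y (start N k ξ α y) (maxRun N k ξ α y) := Nat.sInf_mem hex2
  obtain ⟨g', hg', hdec, hy'⟩ := erasureDecode_of_isRun hN hξ hα hk hR2 hrun
  refine ⟨start N k ξ α y % N, Nat.mod_lt _ hN, y - fun j : Fin N => g'.eval (ξ * α ^ (j : ℕ)),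
    ?_, ?_, ?_⟩
  · intro j hj
    rw [mem_window, erased_mod_iff] at hj
    rw [Pi.sub_apply, hy' j fun h => hj (h.mono (by omega)), sub_self]
  · refine mem_rsSubmodule.mpr ⟨g' - g, Submodule.sub_mem _ hg' hg, ?_⟩
    funext j
    simp
  · intro h
    apply hne
    rw [decode, len, hdec]
    exact (sub_right_injective h).symm

end CyclicBurst

/-! ### The row-by-row algorithm -/

namespace GFFTData

variable {K F : Type u} [Field K] [Field F] [Algebra K F] [Finite K] [Finite F]
  {D : GFFTData K F} {s : ℕ} {hs : s ≤ D.r} (A : D.Arrangement hs)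

omit [Finite F] in
theorem rowDim_le (hs : s ≤ D.r) {k κ : ℕ} (hκ : k ≤ D.m s * κ) (i : ℕ) : D.rowDim s k i ≤ κ := by
  have hm := D.m_pos hs
  rw [rowDim, ← Nat.lt_succ_iff, Nat.div_lt_iff_lt_mul hm, Nat.succ_mul, mul_comm]
  omega

/-- A row of the fold maps a uniform burst to a uniform error on some of the blocks, so confusable
rows are rare. -/
theorem card_confusable_row_le (a l : ℕ) (i : Fin (D.m s)) {κ : ℕ} (hκ : κ ≤ D.ns s)
    (W : Finset (Fin (D.ns s))) :
    {x ∈ (burstSubmodule F D.n a l : Set (Fin D.n → F)) | ∃ y : Fin (D.ns s) → F,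
      (∀ j ∉ W, y j = 0) ∧ foldRow A D.basisPoly i x - y ∈
        rsSubmodule (fun j : Fin (D.ns s) => A.ξ * A.α ^ (j : ℕ)) κ ∧
        foldRow A D.basisPoly i x ≠ y}.ncard * Nat.card F ^ (D.ns s - κ) ≤
      (burstSubmodule F D.n a l : Set (Fin D.n → F)).ncard * Nat.card F ^ W.card := by
  classical
  refine card_confusable_mul_le (burstSubmodule F D.n a l) (foldRow A D.basisPoly i) _ _
    (rsSubmodule_eq_zero A.node_injective hκ)
    (Finset.univ.filter fun j => ∃ x ∈ burstSubmodule F D.n a l, foldRow A D.basisPoly i x j ≠ 0)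
    W ?_ ?_
  · intro x hx j hj
    by_contra h
    exact hj (by simpa using ⟨x, hx, h⟩)
  · intro j hj
    obtain ⟨x, hx, hxj⟩ : ∃ x ∈ burstSubmodule F D.n a l, foldRow A D.basisPoly i x j ≠ 0 := by
      simpa using hj
    -- restrict `x` to the block and normalize
    refine ⟨fun c => if ∃ a', D.pos hs j a' = c then
      (foldRow A D.basisPoly i x j)⁻¹ * x c else 0, ?_, ?_⟩
    · intro c hc
      refine hx c fun h => ?_
      simp [h] at hc
    · funext j'
      by_cases h : j' = j
      · subst h
        rw [Pi.single_eq_same, ← inv_mul_cancel₀ hxj, ← smul_eq_mul, ← Pi.smul_apply,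
          ← map_smul, foldRow_apply, foldRow_apply]
        congr 2
        funext a'
        simp
      · rw [Pi.single_eq_of_ne h]
        refine foldRow_eq_zero A _ (fun a' => if_neg ?_) i
        rintro ⟨a'', h'⟩
        exact h (D.pos_inj hs h').1.symm

theorem burstDecode_correctsBursts {k : ℕ} {ε : ℝ} {e : ℕ}
    (hε : 1 / (D.ns s : ℝ) ≤ ε) (he : 1 ≤ e) :
    CorrectsBursts (RSCode A.pts k) (D.burstDecode A k)
      ((D.n : ℝ) - D.m s * ⌈(k : ℝ) / D.m s⌉₊ - D.n * ε * (e + 2))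
      (ε / (Nat.card F : ℝ) ^ (e - 1)) := by
  classical
  intro l hl a hal c hc
  set κ := ⌈(k : ℝ) / D.m s⌉₊ with hκdef
  have hm := D.m_pos hs
  have hmR : (0 : ℝ) < D.m s := by exact_mod_cast hm
  have hκ : k ≤ D.m s * κ := by
    have h1 := Nat.le_ceil ((k : ℝ) / D.m s)
    rw [div_le_iff₀ hmR, mul_comm] at h1
    exact_mod_cast h1
  have hrad : D.m s * κ + l + D.m s * (e + 2) < D.n :=
    lt_of_radius hs hε (by push_cast; exact hl)
  set L := D.blockLen s a l with hL
  have hLm := D.blockLen_mul_le (s := s) hs a l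
  rw [← hL] at hLm
  have hn := D.ns_mul_m hs
  have hslack : κ + L + e < D.ns s := by
    have : D.m s * (κ + L + e) < D.m s * D.ns s := by
      rw [mul_comm (D.m s) (D.ns s), hn]
      simp only [mul_add] at hrad ⊢
      omega
    exact Nat.lt_of_mul_lt_mul_left this
  obtain ⟨φ, hφ, hrow⟩ := exists_foldRow_eq_eval A (D.isGradedBasis_basisPoly hs) hc
  have hdim : ∀ i : Fin (D.m s), D.rowDim s k i ≤ κ := fun i => D.rowDim_le hs hκ i
  set q := Nat.card F with hq
  have hnq : D.n ≤ q := length_le_card_of_injective A.injective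
  have hNq : D.ns s ≤ q := length_le_card_of_injective A.node_injective
  have hq2 : 2 ≤ q := two_le_card F
  refine miscorrectionProb_le_of_subset
    ((Finset.univ : Finset (Fin (D.m s))) ×ˢ Finset.range (D.ns s))
    (fun p => {x ∈ (burstSubmodule F D.n a l : Set (Fin D.n → F)) | ∃ y : Fin (D.ns s) → F,
      (∀ j ∉ CyclicBurst.window (D.ns s) p.2 L, y j = 0) ∧ foldRow A D.basisPoly p.1 x - y ∈
        rsSubmodule (fun j : Fin (D.ns s) => A.ξ * A.α ^ (j : ℕ)) (D.rowDim s k p.1) ∧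
        foldRow A D.basisPoly p.1 x ≠ y})
    (w := L) (d := D.ns s - κ) (N₀ := D.n) (N₁ := D.ns s) ?_ ?_ ?_ (D.ns_pos s) hε ?_
  · intro err herr hne
    have hfail : ∃ i : Fin (D.m s), CyclicBurst.decode (D.ns s) (D.rowDim s k i) A.ξ A.α
        (foldRow A D.basisPoly i (c + err)) ≠ foldRow A D.basisPoly i c := by
      by_contra! hall
      apply hne
      rw [burstDecode_eq, funext hall]
      exact unfoldRows_foldRow A (D.isGradedBasis_basisPoly hs) c
    obtain ⟨i, hi⟩ := hfail
    rw [hrow] at hi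
    obtain ⟨u, hu, z, hz1, hz2, hz3⟩ := CyclicBurst.exists_confusion_of_decode_ne (D.ns_pos s)
      A.ξ_ne_zero A.orderOf_α ((hdim i).trans (by omega)) (i := a / D.m s) (l := L) (hφ i) (by
        intro j hj
        rw [map_add, Pi.add_apply, hrow,
          foldRow_eq_zero A _ (eq_zero_of_not_erased hs herr hj) i, add_zero]) hi
    have e1 : (foldRow A D.basisPoly i (c + err) -
        fun j : Fin (D.ns s) => (φ i).eval (A.ξ * A.α ^ (j : ℕ))) =
        foldRow A D.basisPoly i err := by
      rw [map_add, hrow, add_sub_cancel_left]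
    rw [e1] at hz2 hz3
    exact ⟨(i, u), by simpa using hu, herr, z, hz1, hz2, hz3⟩
  · rintro ⟨i, u⟩ _
    calc _ ≤ _ := Nat.mul_le_mul_left _ (Nat.pow_le_pow_right (by omega)
            (Nat.sub_le_sub_left (hdim i) (D.ns s)))
      _ ≤ _ := card_confusable_row_le A a l i ((hdim i).trans (by omega)) _
      _ ≤ _ := Nat.mul_le_mul_left _ (Nat.pow_le_pow_right (by omega)
            (CyclicBurst.card_window_le (D.ns_pos s) u L))
  · simp only [Finset.card_product, Finset.card_univ, Fintype.card_fin, Finset.card_range]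
    rw [mul_comm, hn]
  · calc D.n * D.ns s * q ^ (L + (e - 1)) ≤ q * q * q ^ (L + (e - 1)) := by gcongr
      _ = q ^ (L + (e - 1) + 2) := by ring
      _ ≤ q ^ (D.ns s - κ) := Nat.pow_le_pow_right (by omega) (by omega)

end GFFTData

/-! ### Decoding all rows with a common window -/

namespace GFFTData

variable {K F : Type u} [Field K] [Field F] [Algebra K F] [Finite K] [Finite F]
  {D : GFFTData K F} {s : ℕ} {hs : s ≤ D.r} (A : D.Arrangement hs) (b : ℕ → F[X]) (κ : ℕ)

/-- The same run of roots appears in all rows, regarded as words of the code of dimension `κ`. -/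
def IsJointRun (y : Fin D.n → F) (i R : ℕ) : Prop :=
  ∀ row, CyclicBurst.IsRun (D.ns s) κ A.ξ A.α (foldRow A b row y) i R

open Classical in
/-- The length of the longest run of roots common to all rows. -/
noncomputable def jointMaxRun (y : Fin D.n → F) : ℕ :=
  Nat.findGreatest (fun R => ∃ i, IsJointRun A b κ y i R) (D.ns s - κ)

/-- The least starting exponent of a longest common run. -/
noncomputable def jointStart (y : Fin D.n → F) : ℕ :=
  sInf {i | IsJointRun A b κ y i (jointMaxRun A b κ y)}

/-- Erasure decoding of all rows on the window given by a longest common run of roots. Rows are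
expanded in an arbitrary graded basis `b`. -/
noncomputable def jointDecode (y : Fin D.n → F) : Fin D.n → F :=
  unfoldRows A b fun row => CyclicBurst.erasureDecode (D.ns s) A.ξ A.α (jointStart A b κ y)
    (D.ns s - κ - jointMaxRun A b κ y) (foldRow A b row y)

variable {b κ}

/-- Since one wrong window must explain all the `m` rows at once, the miscorrection probability is
so small that it absorbs the loss from rounding `k` up to a multiple `m κ`. -/
theorem jointDecode_correctsBursts (hb : IsGradedBasis b (D.m s)) {k : ℕ}
    (hκ : k ≤ D.m s * κ) (hκ' : D.m s * κ < k + D.m s) {ε : ℝ} {e : ℕ}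
    (hε : 1 / (D.ns s : ℝ) ≤ ε) (he : 1 ≤ e) :
    CorrectsBursts (RSCode A.pts k) (jointDecode A b κ)
      ((D.n : ℝ) - k - D.n * ε * (e + 2)) (ε / (Nat.card F : ℝ) ^ (e - 1)) := by
  classical
  intro l hl a hal c hc
  have hm := D.m_pos hs
  have hrad : k + l + D.m s * (e + 2) < D.n := lt_of_radius hs hε hl
  set L := D.blockLen s a l with hL
  have hLm := D.blockLen_mul_le (s := s) hs a l
  rw [← hL] at hLm
  have hn := D.ns_mul_m hs
  have hme : D.m s + e ≤ D.m s * e + 1 := by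
    obtain ⟨e', rfl⟩ := Nat.exists_eq_add_of_le' he
    nlinarith
  have hslack : D.m s * κ + D.m s * L + e + 3 ≤ D.n := by
    rw [mul_add] at hrad
    omega
  have hκL : κ + L ≤ D.ns s := by
    have : D.m s * (κ + L) ≤ D.m s * D.ns s := by
      rw [mul_comm (D.m s) (D.ns s), hn, mul_add]
      omega
    exact Nat.le_of_mul_le_mul_left this hm
  obtain ⟨φ, hφ, hrow⟩ := exists_foldRow_eq_eval A hb hc
  have hφ' : ∀ i, φ i ∈ degreeLT F κ := fun i => degreeLT_mono (D.rowDim_le hs hκ i) (hφ i)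
  set q := Nat.card F with hq
  have hNq : D.ns s ≤ q := length_le_card_of_injective A.node_injective
  have hq2 : 2 ≤ q := two_le_card F
  let W : ℕ → Finset (Fin D.n) := fun u =>
    (CyclicBurst.window (D.ns s) u L ×ˢ Finset.univ).image fun p => D.pos hs p.1 p.2
  have hWcard : ∀ u, (W u).card ≤ D.m s * L := by
    intro u
    refine Finset.card_image_le.trans ?_
    rw [Finset.card_product, Finset.card_univ, Fintype.card_fin, mul_comm]
    exact Nat.mul_le_mul_left _ (CyclicBurst.card_window_le (D.ns_pos s) u L)
  refine miscorrectionProb_le_of_subset (Finset.range (D.ns s))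
    (fun u => {x ∈ (burstSubmodule F D.n a l : Set (Fin D.n → F)) | ∃ y : Fin D.n → F,
      (∀ j ∉ W u, y j = 0) ∧ LinearMap.id (R := F) x - y ∈ rsSubmodule A.pts (D.m s * κ) ∧
        LinearMap.id (R := F) x ≠ y})
    (w := D.m s * L) (d := D.n - D.m s * κ) (N₀ := D.ns s) (N₁ := D.ns s) ?_ ?_ (by simp)
    (D.ns_pos s) hε ?_
  · intro err herr hne
    set y := c + err with hy
    have hex : ∃ i, IsJointRun A b κ y i (D.ns s - κ - L) := by
      refine ⟨a / D.m s, fun i => CyclicBurst.isRun_of_eq_off_window (D.ns_pos s) A.ξ_ne_zero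
        A.orderOf_α (hφ' i) fun j hj => ?_⟩
      rw [hy, map_add, Pi.add_apply, hrow,
        foldRow_eq_zero A _ (eq_zero_of_not_erased hs herr hj) i, add_zero]
    have hR1 : D.ns s - κ - L ≤ jointMaxRun A b κ y :=
      Nat.le_findGreatest (P := fun R => ∃ i, IsJointRun A b κ y i R) (Nat.sub_le _ _) hex
    have hR2 : jointMaxRun A b κ y ≤ D.ns s - κ := Nat.findGreatest_le _
    have hex2 : ∃ i, IsJointRun A b κ y i (jointMaxRun A b κ y) :=
      Nat.findGreatest_spec (P := fun R => ∃ i, IsJointRun A b κ y i R) (Nat.sub_le _ _) hex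
    have hrun : IsJointRun A b κ y (jointStart A b κ y) (jointMaxRun A b κ y) := Nat.sInf_mem hex2
    have hdec := fun row => CyclicBurst.erasureDecode_of_isRun (D.ns_pos s) A.ξ_ne_zero
      A.orderOf_α (by omega) hR2 (hrun row)
    choose g hg hgdec hgy using hdec
    have hcode : jointDecode A b κ y ∈ RSCode A.pts (D.m s * κ) :=
      unfoldRows_mem_RSCode A hb fun row => ⟨g row, hg row, hgdec row⟩
    refine ⟨jointStart A b κ y % D.ns s, by simpa using Nat.mod_lt _ (D.ns_pos s), herr,
      y - jointDecode A b κ y, ?_, ?_, ?_⟩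
    · intro p hp
      obtain ⟨j, a', rfl⟩ := D.exists_pos_eq hs p
      have hj : ¬ CyclicBurst.Erased (D.ns s) (jointStart A b κ y) L j := by
        intro hj
        refine hp (Finset.mem_image.mpr ⟨(j, a'), ?_, rfl⟩)
        simpa [CyclicBurst.mem_window, CyclicBurst.erased_mod_iff] using hj
      rw [Pi.sub_apply, jointDecode, unfoldRows_pos, ← sum_foldRow_mul A hb y j a', ← Finset.sum_sub_distrib]
      refine Finset.sum_eq_zero fun row _ => ?_
      rw [hgdec row, hgy row j fun h => hj (h.mono (by omega)), sub_self]
    · have : LinearMap.id (R := F) err - (y - jointDecode A b κ y) = jointDecode A b κ y - c := by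
        rw [hy, LinearMap.id_apply]; abel
      rw [this]
      exact Submodule.sub_mem _ (mem_rsSubmodule.mpr hcode)
        (mem_rsSubmodule.mpr (RSCode_mono hκ hc))
    · intro h
      apply hne
      have h' : err = y - jointDecode A b κ y := h
      have : jointDecode A b κ y - c = 0 := by
        rw [← sub_eq_zero] at h'
        rw [← h', hy]; abel
      exact sub_eq_zero.mp this
  · intro u _
    have h := card_confusable_mul_le (burstSubmodule F D.n a l) LinearMap.id
      (rsSubmodule A.pts (D.m s * κ)) (D.n - D.m s * κ)
      (rsSubmodule_eq_zero A.injective (by omega))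
      (Finset.univ.filter fun i : Fin D.n => a ≤ (i : ℕ) ∧ (i : ℕ) < a + l) (W u) ?_ ?_
    · exact h.trans (Nat.mul_le_mul_left _ (Nat.pow_le_pow_right (by omega) (hWcard u)))
    · intro x hx j hj
      by_contra h
      exact hj (by simpa using hx j h)
    · intro j hj
      refine ⟨Pi.single j 1, ?_, rfl⟩
      intro i hi
      have : i = j := by
        by_contra h
        simp [h] at hi
      subst this
      simpa using hj
  · calc D.ns s * D.ns s * q ^ (D.m s * L + (e - 1))
        ≤ q * q * q ^ (D.m s * L + (e - 1)) := by gcongr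
      _ = q ^ (D.m s * L + (e - 1) + 2) := by ring
      _ ≤ q ^ (D.n - D.m s * κ) := Nat.pow_le_pow_right (by omega) (by omega)

end GFFTData

/-! ### Computation trees without registers -/

/-- A computation tree with at most `c` instructions computes `target` on the inputs in `D`,
starting from any configuration in which the values of the functions in `known` are held in
registers. The registers `0, …, n - 1` are reserved for the output, and the registers from `M` on
are free. -/
def Solves {F : Type u} [Field F] {I : Type*} {n : ℕ} (target : I → Fin n → F) (D : Set I)
    (known : Set (I → F)) (c : ℕ) : Prop :=
  ∀ (M : ℕ) (reg : (I → F) → ℕ), n ≤ M → (∀ g ∈ known, n ≤ reg g ∧ reg g < M) →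
    ∃ t : CompTree F, t.cost ≤ c ∧ ∀ x ∈ D, ∀ σ : ℕ → F,
      (∀ g ∈ known, σ (reg g) = g x) → ∀ i : Fin n, t.run σ i = target x i

/-- From the values of the functions in `S`, the values of the functions in `T` are obtained by
`c` further instructions, whatever is computed afterwards. -/
def Gen {F : Type u} [Field F] {I : Type*} (S T : Set (I → F)) (c : ℕ) : Prop :=
  ∀ (n : ℕ) (target : I → Fin n → F) (D : Set I) (known : Set (I → F)) (c₀ : ℕ), S ⊆ known →
    Solves target D (known ∪ T) c₀ → Solves target D known (c₀ + c)

section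

variable {F : Type u} [Field F] {I : Type*} {n : ℕ} {target : I → Fin n → F} {D : Set I}
  {known : Set (I → F)} {c : ℕ}

theorem Solves.mono {known' : Set (I → F)} {c' : ℕ} (h : Solves target D known c)
    (hk : known ⊆ known') (hc : c ≤ c') : Solves target D known' c' := by
  intro M reg hM hreg
  obtain ⟨t, ht, ht'⟩ := h M reg hM fun g hg => hreg g (hk hg)
  exact ⟨t, ht.trans hc, fun x hx σ hσ => ht' x hx σ fun g hg => hσ g (hk hg)⟩

/-- One instruction `mk` that writes the value of `h` to a free register. -/
theorem Solves.of_insert {h : I → F}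
    (H : ∀ (reg : (I → F) → ℕ) (M : ℕ), ∃ mk : CompTree F → CompTree F,
      (∀ t, (mk t).cost = t.cost + 1) ∧ ∀ x σ t, (∀ g ∈ known, σ (reg g) = g x) →
        (mk t).run σ = t.run (Function.update σ M (h x)))
    (hs : Solves target D (insert h known) c) : Solves target D known (c + 1) := by
  classical
  intro M reg hM hreg
  obtain ⟨mk, hmk, hrun⟩ := H reg M
  obtain ⟨t, ht, ht'⟩ := hs (M + 1) (Function.update reg h M) (by omega) (by
    intro g hg
    by_cases hgh : g = h
    · subst hgh
      simp only [Function.update_self]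
      omega
    · rw [Function.update_of_ne hgh]
      have := hreg g (hg.resolve_left hgh)
      omega)
  refine ⟨mk t, by rw [hmk]; omega, fun x hx σ hσ i => ?_⟩
  rw [hrun x σ t hσ]
  refine ht' x hx _ (fun g hg => ?_) i
  by_cases hgh : g = h
  · subst hgh
    simp
  · have hg' := hg.resolve_left hgh
    have := hreg g hg'
    rw [Function.update_of_ne hgh, Function.update_of_ne (by omega), hσ g hg']

theorem Solves.branch {g : I → F} (hg : g ∈ known)
    (h₁ : Solves target (D ∩ {x | g x = 0}) known c)
    (h₂ : Solves target (D ∩ {x | g x ≠ 0}) known c) : Solves target D known (c + 1) := by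
  intro M reg hM hreg
  obtain ⟨t₁, ht₁, ht₁'⟩ := h₁ M reg hM hreg
  obtain ⟨t₂, ht₂, ht₂'⟩ := h₂ M reg hM hreg
  refine ⟨.ifZero (reg g) t₁ t₂, by simp only [CompTree.cost]; omega, fun x hx σ hσ i => ?_⟩
  simp only [CompTree.run]
  split_ifs with h
  · exact ht₁' x ⟨hx, by rwa [hσ g hg] at h⟩ σ hσ i
  · exact ht₂' x ⟨hx, by rwa [hσ g hg] at h⟩ σ hσ i

/-- Zero tests of finitely many known functions: the remaining computation may depend, at no further
cost, on the whole pattern of zeros. -/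
theorem Solves.branch_finset {ι : Type*} (s : Finset ι) (g : ι → I → F) (hg : ∀ i ∈ s, g i ∈ known)
    (h : ∀ x₀ ∈ D, Solves target (D ∩ {x | ∀ i ∈ s, g i x = 0 ↔ g i x₀ = 0}) known c) :
    Solves target D known (c + s.card) := by
  classical
  induction s using Finset.induction_on generalizing D with
  | empty =>
    by_cases hD : D.Nonempty
    · obtain ⟨x₀, hx₀⟩ := hD
      refine fun M reg hM hreg => ?_
      obtain ⟨t, ht, ht'⟩ := h x₀ hx₀ M reg hM hreg
      exact ⟨t, by simpa using ht, fun x hx => ht' x ⟨hx, by simp⟩⟩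
    · exact fun M reg hM hreg => ⟨.halt, by simp [CompTree.cost], fun x hx => (hD ⟨x, hx⟩).elim⟩
  | insert a s ha ih =>
    rw [Finset.card_insert_of_notMem ha, ← add_assoc]
    have hset : ∀ (Z : Set I) (x₀ : I), (∀ x, x ∈ Z → (g a x = 0 ↔ g a x₀ = 0)) →
        D ∩ Z ∩ {x | ∀ i ∈ s, g i x = 0 ↔ g i x₀ = 0} ⊆
          D ∩ {x | ∀ i ∈ insert a s, g i x = 0 ↔ g i x₀ = 0} := by
      rintro Z x₀ hZ x ⟨⟨hx, hxZ⟩, hx'⟩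
      refine ⟨hx, fun i hi => ?_⟩
      rcases Finset.mem_insert.mp hi with rfl | hi
      · exact hZ x hxZ
      · exact hx' i hi
    refine Solves.branch (hg a (Finset.mem_insert_self a s)) ?_ ?_ <;>
    · refine ih (fun i hi => hg i (Finset.mem_insert_of_mem hi)) fun x₀ hx₀ M reg hM hreg => ?_
      obtain ⟨t, ht, ht'⟩ := h x₀ hx₀.1 M reg hM hreg
      refine ⟨t, ht, fun x hx => ht' x (hset _ x₀ (fun x hx => ?_) hx)⟩
      have h0 := hx₀.2
      simp only [Set.mem_ofPred_eq] at hx h0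
      simp [hx, h0]

/-- Copying registers: the register `z` holds `0`. -/
theorem exists_copy (dst src : ℕ → ℕ) (z : ℕ) (t : CompTree F) (k : ℕ) (hz : ∀ i < k, dst i ≠ z)
    (hsrc : ∀ i < k, ∀ j < k, dst i ≠ src j)
    (hdst : ∀ i < k, ∀ j < k, dst i = dst j → i = j) :
    ∃ t' : CompTree F, t'.cost = t.cost + k ∧ ∀ σ : ℕ → F, σ z = 0 →
      ∃ σ' : ℕ → F, t'.run σ = t.run σ' ∧ (∀ i < k, σ' (dst i) = σ (src i)) ∧
        ∀ r, (∀ i < k, dst i ≠ r) → σ' r = σ r := by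
  induction k with
  | zero =>
    exact ⟨t, rfl, fun σ _ => ⟨σ, rfl, fun i hi => absurd hi (Nat.not_lt_zero i), fun _ _ => rfl⟩⟩
  | succ k ih =>
    obtain ⟨t', ht', hrun⟩ := ih (fun i hi => hz i (by omega))
      (fun i hi j hj => hsrc i (by omega) j (by omega))
      (fun i hi j hj => hdst i (by omega) j (by omega))
    refine ⟨.add (dst k) (src k) z t', by rw [CompTree.cost, ht']; omega, fun σ hσ => ?_⟩
    have hσz : Function.update σ (dst k) (σ (src k) + σ z) z = 0 := by
      rw [Function.update_of_ne (hz k (by omega)).symm, hσ]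
    obtain ⟨σ', h1, h2, h3⟩ := hrun _ hσz
    refine ⟨σ', h1, ?_, ?_⟩
    · intro i hi
      rcases Nat.lt_succ_iff_lt_or_eq.mp hi with h | rfl
      · rw [h2 i h, Function.update_of_ne (hsrc k (by omega) i hi).symm]
      · rw [h3 _ fun j hj h => by have := hdst j (by omega) i hi h; omega]
        simp [hσ]
    · intro r hr
      rw [h3 r fun i hi => hr i (by omega), Function.update_of_ne (hr k (by omega)).symm]

/-- If the output values are known, they remain to be copied to the output registers. -/
theorem Solves.of_known (h : ∀ i : Fin n, ∃ g ∈ known, ∀ x ∈ D, g x = target x i) :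
    Solves target D known (n + 1) := by
  intro M reg hM hreg
  choose g hg hgx using h
  obtain ⟨t', ht', hrun⟩ := exists_copy (F := F) (fun i => i)
    (fun i => if hi : i < n then reg (g ⟨i, hi⟩) else M) M .halt n (fun i hi => by omega) (by
      intro i hi j hj
      rw [dif_pos hj]
      have := hreg _ (hg ⟨j, hj⟩)
      omega) (fun i _ j _ h => h)
  refine ⟨.const M 0 t', by rw [CompTree.cost, ht', CompTree.cost]; omega, fun x hx σ hσ i => ?_⟩
  obtain ⟨σ', h1, h2, -⟩ := hrun (Function.update σ M 0) (by simp)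
  rw [CompTree.run, h1, CompTree.run, h2 i i.2, dif_pos i.2]
  have := hreg _ (hg i)
  rw [Function.update_of_ne (by simp only [Fin.eta]; omega), Fin.eta, hσ _ (hg i), hgx i x hx]

/-- Initially the coordinates of the input are known, once they are copied away from the output
registers. -/
theorem exists_tree_of_solves {f : (Fin n → F) → Fin n → F} {c : ℕ}
    (h : Solves f Set.univ (Set.range fun i (y : Fin n → F) => y i) c) :
    ∃ t : CompTree F, t.toMap n = f ∧ t.cost ≤ c + n := by
  classical
  obtain ⟨t, ht, ht'⟩ := h (2 * n) (fun g => if hg : ∃ i : Fin n, g = fun y => y i then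
    n + hg.choose else 0) (by omega) (by
      rintro _ ⟨i, rfl⟩
      have hg : ∃ j : Fin n, (fun y : Fin n → F => y i) = fun y => y j := ⟨i, rfl⟩
      rw [dif_pos hg]
      have := hg.choose.2
      omega)
  obtain ⟨t', ht1, hrun⟩ := exists_copy (fun i => n + i) (fun i => i) (2 * n) t n
    (fun i hi => by omega) (fun i _ j hj => by omega) (fun i _ j _ h => by omega)
  refine ⟨t', ?_, by omega⟩
  funext y i
  obtain ⟨σ', h1, h2, -⟩ := hrun (CompTree.load y) (by
    rw [CompTree.load, dif_neg (by omega)])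
  rw [CompTree.toMap, h1]
  refine ht' y (Set.mem_univ _) σ' ?_ i
  rintro _ ⟨i, rfl⟩
  have hg : ∃ j : Fin n, (fun y : Fin n → F => y i) = fun y => y j := ⟨i, rfl⟩
  rw [dif_pos hg, h2 _ hg.choose.2]
  have := congrFun hg.choose_spec y
  simp only [CompTree.load, hg.choose.2, dite_true, Fin.eta]
  exact this.symm

end

namespace Gen

variable {F : Type u} [Field F] {I : Type*} {S T U : Set (I → F)} {c c' : ℕ}

theorem mono {S' T' : Set (I → F)} (h : Gen S T c) (hS : S ⊆ S') (hT : T' ⊆ T) (hc : c ≤ c') :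
    Gen S' T' c' := fun n target D known c₀ hk hs =>
  (h n target D known c₀ (hS.trans hk)
    (hs.mono (Set.union_subset_union_right _ hT) le_rfl)).mono subset_rfl (by omega)

theorem of_subset (h : T ⊆ S) : Gen S T 0 := fun _ _ _ _ _ hk hs =>
  hs.mono (Set.union_subset subset_rfl (h.trans hk)) le_rfl

/-- Both the intermediate and the final values are available afterwards. -/
theorem trans (h₁ : Gen S T c) (h₂ : Gen (S ∪ T) U c') : Gen S (T ∪ U) (c + c') := by
  intro n target D known c₀ hk hs
  have h := h₂ n target D (known ∪ T) c₀ (Set.union_subset_union_left _ hk)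
    (by rwa [Set.union_assoc])
  have := h₁ n target D known _ hk h
  exact this.mono subset_rfl (by omega)

theorem comp (h₁ : Gen S T c) (h₂ : Gen T U c') : Gen S U (c + c') :=
  (h₁.trans (h₂.mono Set.subset_union_right subset_rfl le_rfl)).mono subset_rfl
    Set.subset_union_right le_rfl

theorem biUnion {ι : Type*} (s : Finset ι) {T : ι → Set (I → F)} {c : ℕ}
    (h : ∀ i ∈ s, Gen S (T i) c) : Gen S (⋃ i ∈ s, T i) (s.card * c) := by
  classical
  induction s using Finset.induction_on with
  | empty => simpa using (of_subset (Set.empty_subset S) : Gen S ∅ 0)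
  | insert a s ha ih =>
    rw [Finset.card_insert_of_notMem ha, add_mul, one_mul, add_comm, Finset.set_biUnion_insert]
    exact (h a (Finset.mem_insert_self a s)).trans
      ((ih fun i hi => h i (Finset.mem_insert_of_mem hi)).mono Set.subset_union_left subset_rfl
        le_rfl)

theorem of_insert {h : I → F}
    (H : ∀ (reg : (I → F) → ℕ) (M : ℕ), ∃ mk : CompTree F → CompTree F,
      (∀ t, (mk t).cost = t.cost + 1) ∧ ∀ x σ t, (∀ g ∈ S, σ (reg g) = g x) →
        (mk t).run σ = t.run (Function.update σ M (h x))) : Gen S {h} 1 := by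
  intro n target D known c₀ hk hs
  rw [Set.union_singleton] at hs
  refine hs.of_insert fun reg M => ?_
  obtain ⟨mk, h1, h2⟩ := H reg M
  exact ⟨mk, h1, fun x σ t hσ => h2 x σ t fun g hg => hσ g (hk hg)⟩

theorem const (a : F) : Gen S {fun _ => a} 1 :=
  of_insert fun _ M => ⟨.const M a, fun _ => rfl, fun _ _ _ _ => rfl⟩

theorem add {g h : I → F} (hg : g ∈ S) (hh : h ∈ S) : Gen S {fun x => g x + h x} 1 :=
  of_insert fun reg M => ⟨.add M (reg g) (reg h), fun _ => rfl, fun x σ t hσ => by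
    rw [CompTree.run, hσ g hg, hσ h hh]⟩

theorem mul {g h : I → F} (hg : g ∈ S) (hh : h ∈ S) : Gen S {fun x => g x * h x} 1 :=
  of_insert fun reg M => ⟨.mul M (reg g) (reg h), fun _ => rfl, fun x σ t hσ => by
    rw [CompTree.run, hσ g hg, hσ h hh]⟩

theorem const_mul (a : F) {g : I → F} (hg : g ∈ S) : Gen S {fun x => a * g x} 2 := by
  have h2 : Gen (S ∪ {fun _ => a}) {fun x => a * g x} 1 :=
    mul (g := fun _ => a) (h := g) (Set.mem_union_right _ rfl) (Set.mem_union_left _ hg)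
  exact ((const a).trans h2).mono subset_rfl Set.subset_union_right le_rfl

theorem linearComb {ι : Type*} (s : Finset ι) (κ : ι → F) {g : ι → I → F}
    (hg : ∀ i ∈ s, g i ∈ S) : Gen S {fun x => ∑ i ∈ s, κ i * g i x} (3 * s.card + 1) := by
  classical
  induction s using Finset.induction_on with
  | empty => simpa using (const 0 : Gen S {fun _ => (0 : F)} 1)
  | insert a s ha ih =>
    have h1 := ih fun i hi => hg i (Finset.mem_insert_of_mem hi)
    have h2 := (const_mul (κ a) (hg a (Finset.mem_insert_self a s))).mono
      (S' := S ∪ {fun x => ∑ i ∈ s, κ i * g i x}) Set.subset_union_left subset_rfl le_rfl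
    have h3 := h1.trans h2
    have h4 := h3.trans (add (g := fun x => κ a * g a x) (h := fun x => ∑ i ∈ s, κ i * g i x)
      (Set.mem_union_right _ (Set.mem_union_right _ rfl))
      (Set.mem_union_right _ (Set.mem_union_left _ rfl)))
    refine h4.mono subset_rfl ?_ (by rw [Finset.card_insert_of_notMem ha]; omega)
    simp only [Finset.sum_insert ha]
    exact Set.subset_union_right

/-- Multiplying known functions by constants. -/
theorem scale (m : ℕ) (κ : ℕ → F) {g : ℕ → I → F} (hg : ∀ i < m, g i ∈ S) :
    Gen S ((fun i x => κ i * g i x) '' Set.Iio m) (m * 2) := by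
  have h := biUnion (Finset.range m) fun i hi => const_mul (κ i) (hg i (Finset.mem_range.mp hi))
  rw [Finset.card_range] at h
  refine h.mono subset_rfl ?_ le_rfl
  rintro _ ⟨i, hi, rfl⟩
  exact Set.mem_biUnion (Finset.mem_coe.mpr (Finset.mem_range.mpr hi)) rfl

end Gen

/-! ### Fast evaluation and interpolation along a tower of polynomials -/

/-- The values at `P` of the polynomial with coefficients `a 0, …, a (m - 1)` in the basis `b`. -/
def basisValue {F : Type u} [Field F] {I : Type*} (b : ℕ → F[X]) (m : ℕ) (a : ℕ → I → F) (P : F) :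
    I → F :=
  fun x => ∑ i ∈ Finset.range m, a i x * (b i).eval P

/-- Passing from the coefficients in the basis `b` of a polynomial of degree less than `m` to its
values on `S`, and back, takes at most `c` instructions. -/
def FastTransform {F : Type u} [Field F] (b : ℕ → F[X]) (m : ℕ) (S : Finset F) (c : ℕ) : Prop :=
  ∀ (I : Type u) (a : ℕ → I → F),
    Gen (a '' Set.Iio m) (basisValue b m a '' S) c ∧ Gen (basisValue b m a '' S) (a '' Set.Iio m) c

/-- Fast transforms on all the full fibres of the polynomial `x` of degree `m`. -/
def FastOnFibres {F : Type u} [Field F] (b : ℕ → F[X]) (x : F[X]) (m c : ℕ) : Prop :=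
  ∀ S : Finset F, S.card = m → (∃ y, ∀ P ∈ S, x.eval P = y) → FastTransform b m S c

section

variable {F : Type u} [Field F]

theorem FastTransform.mono {b : ℕ → F[X]} {m : ℕ} {S : Finset F} {c c' : ℕ}
    (h : FastTransform b m S c) (hc : c ≤ c') : FastTransform b m S c' := fun I a =>
  ⟨(h I a).1.mono subset_rfl subset_rfl hc, (h I a).2.mono subset_rfl subset_rfl hc⟩

theorem FastOnFibres.mono {b : ℕ → F[X]} {x : F[X]} {m c c' : ℕ}
    (h : FastOnFibres b x m c) (hc : c ≤ c') : FastOnFibres b x m c' :=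
  fun S hS hy => (h S hS hy).mono hc

theorem basisValue_congr {I : Type*} {b b' : ℕ → F[X]} {m : ℕ} (h : ∀ i < m, b i = b' i)
    (a : ℕ → I → F) : basisValue b m a = basisValue b' m a := by
  funext P x
  exact Finset.sum_congr rfl fun i hi => by rw [h i (Finset.mem_range.mp hi)]

theorem FastOnFibres.congr {b b' : ℕ → F[X]} {x : F[X]} {m c : ℕ}
    (h : FastOnFibres b x m c) (hb : ∀ i < m, b i = b' i) : FastOnFibres b' x m c := by
  intro S hS hy I a
  rw [← basisValue_congr hb]
  exact h S hS hy I a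

theorem sum_range_mul {M : Type*} [AddCommMonoid M] (f : ℕ → M) (p m : ℕ) :
    ∑ k ∈ Finset.range (p * m), f k =
      ∑ u ∈ Finset.range p, ∑ i ∈ Finset.range m, f (u * m + i) := by
  induction p with
  | zero => simp
  | succ p ih => rw [Finset.sum_range_succ, ← ih, add_mul, one_mul, Finset.sum_range_add]

/-- The inverse of a Vandermonde matrix, from Lagrange interpolation. -/
theorem exists_vandermonde_inverse [DecidableEq F] (Y : Finset F) (u : ℕ) :
    ∃ κ : F → F, ∀ u' < Y.card, ∑ c ∈ Y, κ c * c ^ u' = if u' = u then 1 else 0 := by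
  refine ⟨fun c => (Lagrange.basis Y id c).coeff u, fun u' hu' => ?_⟩
  have h := Lagrange.eq_interpolate (s := Y) (v := id) (f := (X ^ u' : F[X]))
    Function.injective_id.injOn (by rw [degree_X_pow]; exact_mod_cast hu')
  have h2 := congrArg (fun f => coeff f u) h
  simp only [Lagrange.interpolate_apply, finsetSum_coeff, coeff_C_mul, coeff_X_pow, eval_pow, eval_X,
    id] at h2
  simp only [eq_comm (a := u'), h2]
  exact Finset.sum_congr rfl fun c _ => mul_comm _ _

/-- One level of the fast transform: `S` is cut into `p` fibres of `x`, on each of which a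
polynomial of degree less than `p m` becomes one of degree less than `m`, by linear combinations of
`p` coefficients. The combinations are inverted by a Vandermonde matrix. -/
theorem FastTransform.step [DecidableEq F] {b : ℕ → F[X]} {x : F[X]} {m p c : ℕ} {S : Finset F}
    (hb : ∀ u < p, ∀ i < m, b (u * m + i) = x ^ u * b i)
    (hp : (S.image fun P => x.eval P).card = p)
    (hS : ∀ y ∈ S.image fun P => x.eval P, FastTransform b m (S.filter fun P => x.eval P = y) c) :
    FastTransform b (p * m) S (p * c + p * m * (3 * p + 1)) := by
  intro I a
  set Y := S.image fun P => x.eval P with hY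
  -- the coefficients on the fibre over `y`
  let w : F → ℕ → I → F := fun y i x' => ∑ u ∈ Finset.range p, y ^ u * a (u * m + i) x'
  have hval : ∀ y, ∀ P ∈ S.filter fun P => x.eval P = y,
      basisValue b (p * m) a P = basisValue b m (w y) P := by
    intro y P hP
    have hPy : x.eval P = y := (Finset.mem_filter.mp hP).2
    funext x'
    simp only [basisValue, w]
    rw [sum_range_mul]
    simp only [Finset.sum_mul]
    rw [Finset.sum_comm]
    refine Finset.sum_congr rfl fun i hi => Finset.sum_congr rfl fun u hu => ?_
    rw [hb u (Finset.mem_range.mp hu) i (Finset.mem_range.mp hi), eval_mul, eval_pow, hPy]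
    ring
  constructor
  · have h1 : Gen (a '' Set.Iio (p * m)) (⋃ q ∈ Y ×ˢ Finset.range m, {w q.1 q.2})
        (p * m * (3 * p + 1)) := by
      have h := Gen.biUnion (S := a '' Set.Iio (p * m)) (Y ×ˢ Finset.range m)
        (T := fun q => {w q.1 q.2}) (c := 3 * p + 1) fun q hq => by
          have := Gen.linearComb (S := a '' Set.Iio (p * m)) (Finset.range p) (fun u => q.1 ^ u)
            (g := fun u => a (u * m + q.2)) fun u hu => by
              refine ⟨u * m + q.2, ?_, rfl⟩
              have h1 := Finset.mem_range.mp hu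
              have h2 := Finset.mem_range.mp (Finset.mem_product.mp hq).2
              rw [Set.mem_Iio]
              nlinarith
          rwa [Finset.card_range] at this
      rwa [Finset.card_product, Finset.card_range, hp] at h
    have h2 := Gen.biUnion (S := ⋃ q ∈ Y ×ˢ Finset.range m, {w q.1 q.2}) Y
      (T := fun y => basisValue b m (w y) '' (S.filter fun P => x.eval P = y)) (c := c)
      fun y hy => (hS y hy I (w y)).1.mono (by
        rintro _ ⟨i, hi, rfl⟩
        exact Set.mem_biUnion (x := (y, i)) (by simpa using ⟨by simpa using hy, hi⟩) rfl)
        subset_rfl le_rfl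
    rw [hp] at h2
    refine (h1.comp h2).mono subset_rfl ?_ (by omega)
    rintro _ ⟨P, hP, rfl⟩
    refine Set.mem_biUnion (x := x.eval P) (Finset.mem_coe.mpr (Finset.mem_image_of_mem _ hP)) ?_
    have hP' : P ∈ S.filter fun P' => x.eval P' = x.eval P := by simpa using hP
    exact ⟨P, hP', (hval _ P hP').symm⟩
  · have h1 := Gen.biUnion (S := basisValue b (p * m) a '' S) Y
      (T := fun y => w y '' Set.Iio m) (c := c)
      fun y hy => (hS y hy I (w y)).2.mono (by
        rintro _ ⟨P, hP, rfl⟩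
        exact ⟨P, (Finset.mem_filter.mp hP).1, hval _ P hP⟩) subset_rfl le_rfl
    rw [hp] at h1
    choose κ hκ using exists_vandermonde_inverse Y
    have h2 := Gen.biUnion (S := ⋃ y ∈ Y, w y '' Set.Iio m) (Finset.range (p * m))
      (T := fun k => {a k}) (c := 3 * p + 1) fun k hk => by
        have hk' := Finset.mem_range.mp hk
        have hm : 0 < m := Nat.pos_of_mul_pos_left (by omega : 0 < p * m)
        have h := Gen.linearComb (S := ⋃ y ∈ Y, w y '' Set.Iio m) Y (κ (k / m))
          (g := fun y => w y (k % m)) fun y hy =>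
            Set.mem_biUnion hy ⟨k % m, Nat.mod_lt _ hm, rfl⟩
        rw [hp] at h
        refine h.mono subset_rfl ?_ le_rfl
        rw [Set.singleton_subset_iff, Set.mem_singleton_iff]
        funext x'
        simp only [w, Finset.mul_sum]
        rw [Finset.sum_comm]
        have : ∀ u ∈ Finset.range p, ∑ y ∈ Y, κ (k / m) y * (y ^ u * a (u * m + k % m) x') =
            if u = k / m then a (u * m + k % m) x' else 0 := by
          intro u hu
          have h3 := hκ (k / m) u (by rw [hp]; exact Finset.mem_range.mp hu)
          calc _ = (∑ y ∈ Y, κ (k / m) y * y ^ u) * a (u * m + k % m) x' := by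
                rw [Finset.sum_mul]
                exact Finset.sum_congr rfl fun y _ => by ring
            _ = _ := by rw [h3]; split_ifs <;> simp
        rw [Finset.sum_congr rfl this, Finset.sum_ite_eq',
          if_pos (Finset.mem_range.mpr (Nat.div_lt_of_lt_mul (by rwa [mul_comm]))), mul_comm,
          Nat.div_add_mod]
    rw [Finset.card_range] at h2
    refine (h1.comp h2).mono subset_rfl ?_ le_rfl
    rintro _ ⟨k, hk, rfl⟩
    exact Set.mem_biUnion (Finset.mem_coe.mpr (Finset.mem_range.mpr hk)) rfl

/-- If `x' = g(x)`, a full fibre of `x'` is cut into full fibres of `x`. The cost per coefficient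
grows by a constant. -/
theorem FastOnFibres.step {b : ℕ → F[X]} {x x' g : F[X]} {m p B : ℕ} (hm : 0 < m)
    (hp : 2 ≤ p) (hpB : p ≤ B) (hx : x.natDegree = m) (hg : g.natDegree = p) (hx' : x' = g.comp x)
    (hb : ∀ u < p, ∀ i < m, b (u * m + i) = x ^ u * b i)
    (h : FastOnFibres b x m ((3 * B + 1) * (m * Nat.log 2 m))) :
    FastOnFibres b x' (p * m) ((3 * B + 1) * (p * m * Nat.log 2 (p * m))) := by
  classical
  intro S hS ⟨y, hy⟩
  set Y := S.image fun P => x.eval P with hY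
  have hYp : Y.card ≤ p := by
    have hg0 : g - C y ≠ 0 := by
      intro h0
      have := natDegree_sub_C (p := g) (a := y)
      rw [h0, natDegree_zero] at this
      omega
    have hsub : Y ⊆ (g - C y).roots.toFinset := by
      intro z hz
      obtain ⟨P, hP, rfl⟩ := Finset.mem_image.mp hz
      rw [Multiset.mem_toFinset, mem_roots hg0, IsRoot.def, eval_sub, eval_C, ← eval_comp, ← hx',
        hy P hP, sub_self]
    calc Y.card ≤ _ := Finset.card_le_card hsub
      _ ≤ _ := Multiset.toFinset_card_le _
      _ ≤ _ := card_roots' _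
      _ = p := by rw [natDegree_sub_C, hg]
  have hfib : ∀ z ∈ Y, (S.filter fun P => x.eval P = z).card ≤ m := by
    intro z _
    have hx0 : x - C z ≠ 0 := by
      intro h0
      have := natDegree_sub_C (p := x) (a := z)
      rw [h0, natDegree_zero] at this
      omega
    have hsub : (S.filter fun P => x.eval P = z) ⊆ (x - C z).roots.toFinset := by
      intro P hP
      rw [Multiset.mem_toFinset, mem_roots hx0, IsRoot.def, eval_sub, eval_C,
        (Finset.mem_filter.mp hP).2, sub_self]
    calc _ ≤ _ := Finset.card_le_card hsub
      _ ≤ _ := Multiset.toFinset_card_le _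
      _ ≤ _ := card_roots' _
      _ = m := by rw [natDegree_sub_C, hx]
  have hsum : ∑ z ∈ Y, (S.filter fun P => x.eval P = z).card = p * m := by
    rw [← hS, Finset.card_eq_sum_card_fiberwise (f := fun P => x.eval P) (t := Y)
      fun P hP => Finset.mem_image_of_mem _ hP]
  have hYcard : Y.card = p := by
    refine le_antisymm hYp ?_
    have h1 : p * m ≤ Y.card * m := by
      rw [← hsum, ← smul_eq_mul]
      exact Finset.sum_le_card_nsmul _ _ _ hfib
    exact Nat.le_of_mul_le_mul_right h1 hm
  have hfib' : ∀ z ∈ Y, (S.filter fun P => x.eval P = z).card = m := by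
    have h1 : ∑ z ∈ Y, (S.filter fun P => x.eval P = z).card = ∑ z ∈ Y, m := by
      rw [hsum, Finset.sum_const, hYcard, smul_eq_mul]
    exact (Finset.sum_eq_sum_iff_of_le hfib).mp h1
  have hstep := FastTransform.step (S := S) hb hYcard fun z hz =>
    h _ (hfib' z hz) ⟨z, fun P hP => (Finset.mem_filter.mp hP).2⟩
  refine hstep.mono ?_
  have hlog : Nat.log 2 m + 1 ≤ Nat.log 2 (p * m) := by
    rw [← Nat.log_mul_base (by norm_num) hm.ne']
    exact Nat.log_mono_right (by nlinarith)
  have h3 : 3 * p + 1 ≤ 3 * B + 1 := by omega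
  calc p * ((3 * B + 1) * (m * Nat.log 2 m)) + p * m * (3 * p + 1)
      ≤ p * ((3 * B + 1) * (m * Nat.log 2 m)) + p * m * (3 * B + 1) := by gcongr
    _ = (3 * B + 1) * (p * m * (Nat.log 2 m + 1)) := by ring
    _ ≤ _ := by gcongr

/-- The transform of length one. -/
theorem fastOnFibres_one {b : ℕ → F[X]} (hb : b 0 = 1) (x : F[X]) (c : ℕ) :
    FastOnFibres b x 1 c := by
  intro S hS _ I a
  obtain ⟨P, rfl⟩ := Finset.card_eq_one.mp hS
  have h1 : basisValue b 1 a '' (({P} : Finset F) : Set F) = a '' Set.Iio 1 := by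
    have h0 : Set.Iio 1 = {0} := by
      ext i
      simp
    rw [Finset.coe_singleton, Set.image_singleton, h0, Set.image_singleton]
    congr 1
    funext x
    simp [basisValue, hb]
  rw [h1]
  exact ⟨(Gen.of_subset subset_rfl).mono subset_rfl subset_rfl (Nat.zero_le _),
    (Gen.of_subset subset_rfl).mono subset_rfl subset_rfl (Nat.zero_le _)⟩

end

/-! ### The towers that carry the fast transforms -/

section

variable {F : Type u} [Field F]

/-- The discrete Fourier transform of smooth length. -/
theorem fastOnFibres_X_pow {N B : ℕ} (hN : N ≠ 0) (hB : ∀ p : ℕ, p.Prime → p ∣ N → p ≤ B) :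
    FastOnFibres (fun i => (X : F[X]) ^ i) (X ^ N) N ((3 * B + 1) * (N * Nat.log 2 N)) := by
  induction N using induction_on_primes with
  | zero => exact absurd rfl hN
  | one => exact fastOnFibres_one (by simp) _ _
  | prime_mul p a hp ih =>
    have ha : a ≠ 0 := right_ne_zero_of_mul hN
    refine FastOnFibres.step (x := X ^ a) (g := X ^ p) (Nat.pos_of_ne_zero ha) hp.two_le
      (hB p hp (dvd_mul_right _ _)) (natDegree_X_pow _) (natDegree_X_pow _) ?_ ?_
      (ih ha fun q hq hqa => hB q hq (hqa.mul_left _))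
    · rw [X_pow_comp, ← pow_mul, mul_comm]
    · intro u _ i _
      rw [← pow_mul, ← pow_add, mul_comm]

/-- A fast graded basis is continued along a composition with a polynomial of bounded degree. -/
theorem FastOnFibres.exists_extension {b : ℕ → F[X]} {x g : F[X]} {m p B : ℕ} (hm : 0 < m)
    (hp : 2 ≤ p) (hpB : p ≤ B) (hxm : x.Monic) (hx : x.natDegree = m) (hg : g.natDegree = p)
    (hb : IsGradedBasis b m) (h : FastOnFibres b x m ((3 * B + 1) * (m * Nat.log 2 m))) :
    ∃ b', IsGradedBasis b' (p * m) ∧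
      FastOnFibres b' (g.comp x) (p * m) ((3 * B + 1) * (p * m * Nat.log 2 (p * m))) := by
  have h0 : ∀ i < m, b i = x ^ (i / m) * b (i % m) := by
    intro i hi
    rw [Nat.div_eq_of_lt hi, Nat.mod_eq_of_lt hi, pow_zero, one_mul]
  have hmul : ∀ u < p, ∀ i < m, x ^ ((u * m + i) / m) * b ((u * m + i) % m) =
      x ^ u * (x ^ (i / m) * b (i % m)) := by
    intro u _ i hi
    rw [← h0 i hi, add_comm, Nat.add_mul_div_right _ _ hm, Nat.div_eq_of_lt hi, zero_add,
      Nat.add_mul_mod_self_right, Nat.mod_eq_of_lt hi]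
  have hb' : IsGradedBasis (fun k => x ^ (k / m) * b (k % m)) m := by
    intro i hi
    simp only [← h0 i hi]
    exact hb i hi
  exact ⟨fun k => x ^ (k / m) * b (k % m), hb'.mul hxm hx hmul,
    FastOnFibres.step hm hp hpB hx hg rfl hmul (h.congr h0)⟩

theorem exists_fastOnFibres_pow {x : F[X]} {m B : ℕ} (hm : 0 < m) (hxm : x.Monic)
    (hx : x.natDegree = m) (h : ∃ b, IsGradedBasis b m ∧
      FastOnFibres b x m ((3 * B + 1) * (m * Nat.log 2 m))) {t : ℕ} (ht : t ≠ 0)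
    (hB : ∀ p : ℕ, p.Prime → p ∣ t → p ≤ B) :
    ∃ b, IsGradedBasis b (t * m) ∧
      FastOnFibres b (x ^ t) (t * m) ((3 * B + 1) * (t * m * Nat.log 2 (t * m))) := by
  induction t using induction_on_primes with
  | zero => exact absurd rfl ht
  | one => simpa using h
  | prime_mul p a hp ih =>
    have ha : a ≠ 0 := right_ne_zero_of_mul ht
    obtain ⟨b, hb, hfast⟩ := ih ha fun q hq hqa => hB q hq (hqa.mul_left _)
    have := hfast.exists_extension (g := X ^ p) (Nat.mul_pos (Nat.pos_of_ne_zero ha) hm) hp.two_le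
      (hB p hp (dvd_mul_right _ _)) (hxm.pow _) (by rw [hxm.natDegree_pow, hx]) (natDegree_X_pow _)
      hb
    rwa [X_pow_comp, ← pow_mul, mul_comm a p, ← mul_assoc] at this

/-- The polynomial of a subgroup factors through that of a smaller one: it is the composition with
`∏ (x - z)` over the values `z` on the larger subgroup. -/
theorem exists_comp_subgroupPoly [Finite F] {V V' : AddSubgroup F} (hV : V ≤ V') {p : ℕ}
    (hcard : Nat.card V' = p * Nat.card V) :
    ∃ g : F[X], g.natDegree = p ∧ subgroupPoly V' = g.comp (subgroupPoly V) := by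
  classical
  set x := subgroupPoly V with hx
  set S := (Set.toFinite (V' : Set F)).toFinset with hS
  have hScard : S.card = Nat.card V' := by
    rw [hS, ← Set.ncard_eq_toFinset_card _ (Set.toFinite _)]; rfl
  have hVpos : 0 < Nat.card V := Nat.card_pos
  set U := S.image fun v => x.eval v with hU
  have hfib : ∀ z ∈ U, Nat.card V ≤ (S.filter fun v => x.eval v = z).card := by
    intro z hz
    obtain ⟨v, hv, rfl⟩ := Finset.mem_image.mp hz
    have hT : (Set.toFinite (V : Set F)).toFinset.card = Nat.card V := by
      rw [← Set.ncard_eq_toFinset_card _ (Set.toFinite _)]; rfl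
    rw [← hT]
    refine Finset.card_le_card_of_injOn (fun a => v + a) ?_ fun a _ a' _ h => add_left_cancel h
    intro a ha
    have ha' : a ∈ V := by simpa using ha
    have hv' : v ∈ V' := by simpa [hS] using hv
    have h1 : v + a ∈ S := by simpa [hS] using V'.add_mem hv' (hV ha')
    simpa [h1] using eval_subgroupPoly_add V ha' v
  have hUp : U.card ≤ p := by
    have h1 : U.card * Nat.card V ≤ p * Nat.card V := by
      rw [← hcard, ← hScard, Finset.card_eq_sum_card_fiberwise (f := fun v => x.eval v) (t := U)
        fun v hv => Finset.mem_image_of_mem _ hv, ← smul_eq_mul]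
      exact Finset.card_nsmul_le_sum _ _ _ hfib
    exact Nat.le_of_mul_le_mul_right h1 hVpos
  set g : F[X] := ∏ z ∈ U, (X - C z) with hg
  have hgm : g.Monic := monic_prod_of_monic _ _ fun _ _ => monic_X_sub_C _
  have hgd : g.natDegree = U.card := by
    rw [hg, natDegree_prod_of_monic _ _ fun _ _ => monic_X_sub_C _]
    simp only [natDegree_X_sub_C, Finset.sum_const, smul_eq_mul, mul_one]
  have hxd : x.natDegree = Nat.card V := natDegree_subgroupPoly V
  have hxm : x.Monic := subgroupPoly_monic V
  have hcm : (g.comp x).Monic := hgm.comp hxm (by omega)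
  have hvan : ∀ v ∈ S, (g.comp x).eval v = 0 := by
    intro v hv
    rw [eval_comp, hg, eval_prod]
    exact Finset.prod_eq_zero (Finset.mem_image_of_mem _ hv) (by simp)
  have hUp' : U.card = p := by
    refine le_antisymm hUp ?_
    have h1 : S.card ≤ (g.comp x).natDegree := by
      refine (Finset.card_le_card (t := (g.comp x).roots.toFinset) ?_).trans
        ((Multiset.toFinset_card_le _).trans (card_roots' _))
      intro v hv
      rw [Multiset.mem_toFinset, mem_roots hcm.ne_zero]
      exact hvan v hv
    rw [natDegree_comp, hgd, hxd, hScard, hcard] at h1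
    exact Nat.le_of_mul_le_mul_right h1 hVpos
  refine ⟨g, by rw [hgd, hUp'], ?_⟩
  have hm' := subgroupPoly_monic V'
  have hd' : (subgroupPoly V').natDegree = S.card := by rw [natDegree_subgroupPoly, hScard]
  have hd : (g.comp x).natDegree = S.card := by
    rw [natDegree_comp, hgd, hxd, hUp', hScard, hcard]
  refine Polynomial.eq_of_degree_sub_lt_of_eval_finset_eq S ?_ fun v hv => ?_
  · rw [← hd', ← degree_eq_natDegree hm'.ne_zero]
    refine degree_sub_lt_left ?_ hm'.ne_zero (by rw [hm'.leadingCoeff, hcm.leadingCoeff])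
    rw [degree_eq_natDegree hm'.ne_zero, degree_eq_natDegree hcm.ne_zero, hd, hd']
  · rw [hvan v hv, eval_subgroupPoly_eq_zero_iff]
    simpa [hS] using hv

/-- A nontrivial additive subgroup of a finite field has a subgroup of prime index. -/
theorem exists_addSubgroup_card_eq [Finite F] (V : AddSubgroup F) (hV : 1 < Nat.card V) :
    ∃ p : ℕ, p.Prime ∧ ∃ V' ≤ V, Nat.card V = p * Nat.card V' := by
  obtain ⟨p, hp⟩ := CharP.exists F
  have hprime : p.Prime := (CharP.char_is_prime_or_zero F p).resolve_right
    (CharP.char_ne_zero_of_finite F p)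
  have := Fact.mk hprime
  have hpg : IsPGroup p (Multiplicative V) := by
    intro v
    refine ⟨1, ?_⟩
    rw [pow_one]
    apply Multiplicative.toAdd.injective
    apply Subtype.ext
    rw [toAdd_pow, toAdd_one, AddSubgroup.coe_nsmul, nsmul_eq_mul, CharP.cast_eq_zero, zero_mul]
    rfl
  obtain ⟨d, hd⟩ := IsPGroup.iff_card.mp hpg
  have hd' : Nat.card V = p ^ d := hd
  obtain ⟨e, rfl⟩ : ∃ e, d = e + 1 := by
    refine Nat.exists_eq_succ_of_ne_zero ?_
    rintro rfl
    rw [pow_zero] at hd'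
    omega
  obtain ⟨H, hH⟩ := Sylow.exists_subgroup_card_pow_prime p (G := Multiplicative V) (n := e)
    (hd ▸ pow_dvd_pow p (Nat.le_succ e))
  refine ⟨p, hprime, (Subgroup.toAddSubgroup' H).map V.subtype, ?_, ?_⟩
  · rintro _ ⟨v, _, rfl⟩
    exact v.2
  · have h1 : Nat.card ((Subgroup.toAddSubgroup' H).map V.subtype) = p ^ e := by
      rw [AddSubgroup.card_map_of_injective V.subtype_injective]
      exact hH
    rw [h1, hd', pow_succ, mul_comm]

/-- The additive fast Fourier transform, along a chain of subgroups of prime index. -/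
theorem exists_fastOnFibres_subgroupPoly [Finite F] {B : ℕ} (V : AddSubgroup F)
    (hB : ∀ p : ℕ, p.Prime → p ∣ Nat.card V → p ≤ B) :
    ∃ b, IsGradedBasis b (Nat.card V) ∧ FastOnFibres b (subgroupPoly V) (Nat.card V)
      ((3 * B + 1) * (Nat.card V * Nat.log 2 (Nat.card V))) := by
  induction hn : Nat.card V using Nat.strong_induction_on generalizing V with
  | _ n ih =>
    have hpos : 0 < Nat.card V := Nat.card_pos
    rcases Nat.lt_or_ge 1 (Nat.card V) with h | h
    · obtain ⟨p, hp, V', hV', hcard⟩ := exists_addSubgroup_card_eq V h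
      have hpos' : 0 < Nat.card V' := Nat.card_pos
      obtain ⟨b, hb, hfast⟩ := ih (Nat.card V') (by rw [← hn, hcard]; nlinarith [hp.two_le]) V'
        (fun q hq hqV => hB q hq (hcard ▸ hqV.mul_left _)) rfl
      obtain ⟨g, hg, hcomp⟩ := exists_comp_subgroupPoly hV' hcard
      rw [← hn, hcard, hcomp]
      exact hfast.exists_extension hpos' hp.two_le (hB p hp (hcard ▸ dvd_mul_right _ _))
        (subgroupPoly_monic _) (natDegree_subgroupPoly _) hg hb
    · have h1 : n = 1 := by omega
      subst h1
      refine ⟨fun _ => 1, fun i hi => ⟨monic_one, by rw [natDegree_one]; omega⟩,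
        fastOnFibres_one rfl _ _⟩

end

namespace GFFTData

variable {K F : Type u} [Field K] [Field F] [Algebra K F] [Finite K] [Finite F]
  (D : GFFTData K F)

theorem exists_xpoly_succ_eq_comp {s : ℕ} (hs : s < D.r) :
    ∃ g : F[X], g.natDegree = D.p s ∧ D.xpoly (s + 1) = g.comp (D.xpoly s) := by
  rw [D.xpoly_eq hs, D.xpoly_eq hs.le]
  rcases Nat.lt_or_ge s D.w with h | h
  · rw [min_eq_left h.le, min_eq_left (Nat.succ_le_of_lt h), Nat.sub_eq_zero_of_le h.le,
      Nat.sub_eq_zero_of_le (Nat.succ_le_of_lt h), Finset.range_zero, Finset.prod_empty, pow_one,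
      pow_one]
    refine exists_comp_subgroupPoly (fun v hv => D.W_le s h hv) ?_
    have h1 := Module.natCard_eq_pow_finrank (K := K) (V := D.W s)
    have h2 := Module.natCard_eq_pow_finrank (K := K) (V := D.W (s + 1))
    rw [D.finrank_W _ h.le] at h1
    rw [D.finrank_W _ h, pow_succ, mul_comm, ← h1] at h2
    rw [p, if_pos h]
    exact h2
  · refine ⟨X ^ D.p s, natDegree_X_pow _, ?_⟩
    rw [min_eq_right h, min_eq_right (h.trans (Nat.le_succ s)), X_pow_comp, ← pow_mul, p,
      if_neg (by omega), Nat.succ_sub h, Finset.prod_range_succ]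

/-- The G-FFT of the given chain, when its radices are bounded. -/
theorem fastOnFibres_basisPoly {B : ℕ} (hB : ∀ j < D.r, D.p j ≤ B) {s : ℕ} (hs : s ≤ D.r) :
    FastOnFibres D.basisPoly (D.xpoly s) (D.m s) ((3 * B + 1) * (D.m s * Nat.log 2 (D.m s))) := by
  induction s with
  | zero =>
    have : D.m 0 = 1 := Finset.prod_range_zero _
    rw [this]
    exact fastOnFibres_one D.basisPoly_zero _ _
  | succ s ih =>
    obtain ⟨g, hg, hcomp⟩ := D.exists_xpoly_succ_eq_comp hs
    rw [m_succ, mul_comm (D.m s)]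
    exact FastOnFibres.step (D.m_pos (by omega)) (D.two_le_p hs) (hB s hs)
      (D.natDegree_xpoly (by omega)) hg hcomp (fun u hu i hi => D.basisPoly_add hs hu hi)
      (ih (by omega))

/-- A fast transform for another graded basis, when only the prime factors of the length are
bounded: the chain of subgroups is refined to one of prime indices. -/
theorem exists_fastOnFibres_xpoly {B s : ℕ} (hs : s ≤ D.r) (hws : D.w ≤ s)
    (hB : ∀ p : ℕ, p.Prime → p ∣ D.m s → p ≤ B) :
    ∃ b, IsGradedBasis b (D.m s) ∧ FastOnFibres b (D.xpoly s) (D.m s)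
      ((3 * B + 1) * (D.m s * Nat.log 2 (D.m s))) := by
  obtain ⟨i, rfl⟩ := Nat.exists_eq_add_of_le hws
  have hcard : Nat.card (D.W D.w).toAddSubgroup = Nat.card K ^ D.w := by
    have h := Module.natCard_eq_pow_finrank (K := K) (V := D.W D.w)
    rw [D.finrank_W _ le_rfl] at h
    exact h
  have hpos := D.m_pos hs
  have hm := D.m_add i
  rw [← hcard, mul_comm] at hm
  rw [hm] at hB hpos ⊢
  rw [D.xpoly_eq hs, min_eq_right hws, Nat.add_sub_cancel_left]
  exact exists_fastOnFibres_pow Nat.card_pos (subgroupPoly_monic _) (natDegree_subgroupPoly _)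
    (exists_fastOnFibres_subgroupPoly _ fun p hp h => hB p hp (h.mul_left _))
    (by rintro h; rw [h] at hpos; simp at hpos) fun p hp h => hB p hp (h.mul_right _)

end GFFTData

/-! ### Running time of the decoders -/

namespace CyclicBurst

variable {F : Type u} [Field F] {N k : ℕ} {ξ α : F}

/-- Evaluation and interpolation on a coset of a cyclic group, for coefficients indexed by `ℕ`. -/
theorem gen_dft (hξ : ξ ≠ 0) (hα : orderOf α = N) {c : ℕ}
    (h : FastOnFibres (fun i => (X : F[X]) ^ i) (X ^ N) N c) (I : Type u) (a : ℕ → I → F) :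
    Gen (a '' Set.Iio N) (Set.range fun (j : Fin N) (x : I) =>
      ∑ i ∈ Finset.range N, a i x * (ξ * α ^ (j : ℕ)) ^ i) c ∧
    Gen (Set.range fun (j : Fin N) (x : I) =>
      ∑ i ∈ Finset.range N, a i x * (ξ * α ^ (j : ℕ)) ^ i) (a '' Set.Iio N) c := by
  classical
  have hinj := node_injective (N := N) hξ hα
  have h1 := h (Finset.univ.image fun j : Fin N => ξ * α ^ (j : ℕ))
    (by rw [Finset.card_image_of_injective _ hinj, Finset.card_univ, Fintype.card_fin])
    ⟨ξ ^ N, fun P hP => by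
      obtain ⟨j, _, rfl⟩ := Finset.mem_image.mp hP
      have hαN : α ^ N = 1 := hα ▸ pow_orderOf_eq_one α
      rw [eval_pow, eval_X, mul_pow, ← pow_mul, mul_comm (j : ℕ), pow_mul, hαN, one_pow, mul_one]⟩ I a
  have h2 : basisValue (fun i => (X : F[X]) ^ i) N a ''
      ((Finset.univ.image fun j : Fin N => ξ * α ^ (j : ℕ) : Finset F) : Set F) =
      Set.range fun (j : Fin N) (x : I) =>
        ∑ i ∈ Finset.range N, a i x * (ξ * α ^ (j : ℕ)) ^ i := by
    rw [Finset.coe_image, Finset.coe_univ, Set.image_univ, ← Set.range_comp]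
    congr 1
    funext j x
    simp [basisValue]
  rwa [h2] at h1

/-- The values of `Γ` at all powers of `α`, by two Fourier transforms. -/
theorem gen_Γ (hN : 0 < N) (hα : orderOf α = N) {c : ℕ}
    (h : FastOnFibres (fun i => (X : F[X]) ^ i) (X ^ N) N c) {I : Type u} (y : Fin N → I → F) :
    Gen (Set.range y) (Set.range fun (u : Fin N) (x : I) =>
      (Γ N k ξ α fun j => y j x).eval (α ^ (u : ℕ))) (2 * c + 4 * N) := by
  classical
  -- the received word, weighted
  let w : ℕ → F := fun j => ∏ i ∈ Finset.univ.filter fun i : Fin N => (i : ℕ) ≠ j,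
    (ξ * α ^ j - ξ * α ^ (i : ℕ))⁻¹
  let y' : ℕ → I → F := fun j => if hj : j < N then y ⟨j, hj⟩ else 0
  let a : ℕ → I → F := fun j x => w j * y' j x
  have h1 : Gen (Set.range y) (a '' Set.Iio N) (N * 2) :=
    Gen.scale N w fun j hj => ⟨⟨j, hj⟩, by simp only [y', dif_pos hj]⟩
  let Z : ℕ → I → F := fun h x => ∑ i ∈ Finset.range N, a i x * (1 * α ^ h) ^ i
  have h2 := (gen_dft one_ne_zero hα h I a).1
  let κ : ℕ → F := fun h =>
    if h < N - k then ξ ^ (N - k - 1 - h) * (locator N k ξ α).coeff h else 0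
  let d : ℕ → I → F := fun h x => κ h * Z (N - k - 1 - h) x
  have h3 : Gen (Set.range fun (j : Fin N) (x : I) =>
      ∑ i ∈ Finset.range N, a i x * (1 * α ^ (j : ℕ)) ^ i) (d '' Set.Iio N) (N * 2) :=
    Gen.scale N κ fun h _ => ⟨⟨N - k - 1 - h, by omega⟩, rfl⟩
  have h4 := (gen_dft one_ne_zero hα h I d).1
  refine (((h1.comp h2).comp h3).comp h4).mono subset_rfl ?_ (by omega)
  rintro _ ⟨u, rfl⟩
  refine ⟨u, ?_⟩
  funext x
  have hsyn : ∀ h', syndrome N ξ α (fun j => y j x) h' = ξ ^ h' * Z h' x := by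
    intro h'
    simp only [syndrome, Z, a]
    rw [Finset.mul_sum, ← Fin.sum_univ_eq_sum_range
      (fun i => ξ ^ h' * (w i * y' i x * (1 * α ^ h') ^ i)) N]
    refine Finset.sum_congr rfl fun j _ => ?_
    have hw : w j = ∏ i ∈ Finset.univ.erase j, (ξ * α ^ (j : ℕ) - ξ * α ^ (i : ℕ))⁻¹ := by
      refine Finset.prod_congr ?_ fun _ _ => rfl
      ext i
      simp [Fin.ext_iff]
    have hy : y' j x = y j x := by simp [y']
    rw [hw, hy, one_mul, mul_pow, ← pow_mul, ← pow_mul, mul_comm h' (j : ℕ)]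
    ring
  simp only [Γ, eval_finsetSum, eval_mul, eval_C, eval_pow, eval_X, hsyn, d, κ, one_mul]
  symm
  rw [← Finset.sum_subset (Finset.range_subset_range.mpr (Nat.sub_le N k))]
  · refine Finset.sum_congr rfl fun h' hh => ?_
    rw [if_pos (Finset.mem_range.mp hh)]
    ring
  · intro h' _ hh
    rw [Finset.mem_range] at hh
    simp [hh]

/-- Erasure decoding on a fixed window, by two Fourier transforms. -/
theorem gen_erasureDecode (hN : 0 < N) (hξ : ξ ≠ 0) (hα : orderOf α = N) {c : ℕ}
    (h : FastOnFibres (fun i => (X : F[X]) ^ i) (X ^ N) N c) {I : Type u} (y : Fin N → I → F)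
    (i l : ℕ) :
    Gen (Set.range y) (Set.range fun (j : Fin N) (x : I) =>
      erasureDecode N ξ α i l (fun j => y j x) j) (2 * c + 6 * N) := by
  classical
  have hinj := node_injective (N := N) hξ hα
  set lam := erasureLocator ξ α i l with hlam
  let z : Fin N → I → F := fun j x =>
    if Erased N i l j then 0 else lam.eval (ξ * α ^ (j : ℕ)) * y j x
  let G : I → F[X] := fun x => Lagrange.interpolate Finset.univ
    (fun j : Fin N => ξ * α ^ (j : ℕ)) (fun j => z j x)
  have hG : ∀ x, (G x).natDegree < N := by
    intro x
    have h0 := Lagrange.degree_interpolate_lt (s := Finset.univ) (fun j => z j x) hinj.injOn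
    rw [Finset.card_univ, Fintype.card_fin] at h0
    by_cases hG0 : G x = 0
    · rw [hG0, natDegree_zero]; exact hN
    · exact (natDegree_lt_iff_degree_lt hG0).mpr h0
  have h1 : Gen (Set.range y) (Set.range z) (N * 2) := by
    have := Gen.biUnion (S := Set.range y) (Finset.univ : Finset (Fin N)) (T := fun j => {z j})
      (c := 2) fun j _ => by
        have := Gen.const_mul (if Erased N i l j then 0 else lam.eval (ξ * α ^ (j : ℕ)))
          (Set.mem_range_self (f := y) j)
        simpa only [ite_mul, zero_mul] using this
    rw [Finset.card_univ, Fintype.card_fin] at this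
    refine this.mono subset_rfl ?_ le_rfl
    rintro _ ⟨j, rfl⟩
    exact Set.mem_biUnion (Finset.mem_coe.mpr (Finset.mem_univ j)) rfl
  have h2 : Gen (Set.range z) ((fun h x => (G x).coeff h) '' Set.Iio N) c := by
    refine (gen_dft hξ hα h I fun h x => (G x).coeff h).2.mono ?_ subset_rfl le_rfl
    rintro _ ⟨j, rfl⟩
    refine ⟨j, ?_⟩
    funext x
    rw [← Lagrange.eval_interpolate_at_node (fun j => z j x) (s := Finset.univ)
      (v := fun j : Fin N => ξ * α ^ (j : ℕ)) hinj.injOn (Finset.mem_univ j)]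
    exact eval_eq_sum_range' (hG x) (ξ * α ^ (j : ℕ))
  -- the coefficient of `x ^ (N - 1)` in the derivative vanishes
  let κ : ℕ → F := fun h => if h + 1 < N then (h : F) + 1 else 0
  let d : ℕ → I → F := fun h x => κ h * (G x).coeff (if h + 1 < N then h + 1 else 0)
  have h3 : Gen ((fun h x => (G x).coeff h) '' Set.Iio N) (d '' Set.Iio N) (N * 2) :=
    Gen.scale N κ (g := fun h x => (G x).coeff (if h + 1 < N then h + 1 else 0)) fun h _ =>
      ⟨if h + 1 < N then h + 1 else 0, by rw [Set.mem_Iio]; split_ifs <;> omega, rfl⟩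
  have h4 := (gen_dft hξ hα h I d).1
  have hder : ∀ (j : Fin N) (x : I), ∑ i ∈ Finset.range N, d i x * (ξ * α ^ (j : ℕ)) ^ i =
      (derivative (G x)).eval (ξ * α ^ (j : ℕ)) := by
    intro j x
    have hdeg : (derivative (G x)).natDegree < N := by
      have h0 := natDegree_derivative_le (G x)
      have := hG x
      omega
    rw [eval_eq_sum_range' hdeg]
    refine Finset.sum_congr rfl fun h' hh => ?_
    rw [coeff_derivative]
    simp only [d, κ]
    split_ifs with hlt
    · ring
    · rw [coeff_eq_zero_of_natDegree_lt (n := h' + 1) (by have := hG x; omega)]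
      ring
  have h5 := ((h1.comp h2).comp h3).comp h4
  have h6 := (Gen.of_subset (subset_refl (Set.range y))).trans
    (h5.mono Set.subset_union_left subset_rfl le_rfl)
  have h7 := Gen.biUnion (Finset.univ : Finset (Fin N)) (c := 2)
    (T := fun j => {fun x : I => erasureDecode N ξ α i l (fun j => y j x) j})
    (S := Set.range y ∪ Set.range fun (j : Fin N) (x : I) =>
      ∑ i ∈ Finset.range N, d i x * (ξ * α ^ (j : ℕ)) ^ i) fun j _ => by
        by_cases hj : Erased N i l j
        · have := Gen.const_mul ((derivative lam).eval (ξ * α ^ (j : ℕ)))⁻¹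
            (S := Set.range y ∪ Set.range fun (j : Fin N) (x : I) =>
              ∑ i ∈ Finset.range N, d i x * (ξ * α ^ (j : ℕ)) ^ i)
            (Set.mem_union_right _ (Set.mem_range_self j))
          refine this.mono subset_rfl ?_ le_rfl
          rw [Set.singleton_subset_iff, Set.mem_singleton_iff]
          funext x
          rw [hder]
          simp only [erasureDecode, if_pos hj]
          rw [div_eq_mul_inv, mul_comm]
        · refine (Gen.of_subset ?_).mono subset_rfl subset_rfl (Nat.zero_le _)
          rw [Set.singleton_subset_iff]
          refine Or.inl ⟨j, ?_⟩
          funext x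
          simp only [erasureDecode, if_neg hj]
  rw [Finset.card_univ, Fintype.card_fin] at h7
  refine (h6.comp h7).mono subset_rfl ?_ (by omega)
  rintro _ ⟨j, rfl⟩
  exact Set.mem_biUnion (Finset.mem_coe.mpr (Finset.mem_univ j)) rfl

/-- Runs of roots depend only on the values of `Γ` at `1, α, …, α ^ (N - 1)`. -/
theorem isRun_congr (hN : 0 < N) (hα : orderOf α = N) {y y' : Fin N → F}
    (h : ∀ u : Fin N, (Γ N k ξ α y).eval (α ^ (u : ℕ)) = 0 ↔
      (Γ N k ξ α y').eval (α ^ (u : ℕ)) = 0) (i R : ℕ) :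
    IsRun N k ξ α y i R ↔ IsRun N k ξ α y' i R := by
  have hα0 := ne_zero_of_orderOf hN hα
  have key : ∀ z : ℤ, (Γ N k ξ α y).eval (α ^ z) = 0 ↔ (Γ N k ξ α y').eval (α ^ z) = 0 := by
    intro z
    have hpos : 0 ≤ z % N := Int.emod_nonneg _ (by omega)
    have hlt : z % N < N := Int.emod_lt_of_pos _ (by omega)
    have e : α ^ z = α ^ (z % N).toNat := by
      rw [← zpow_natCast, Int.toNat_of_nonneg hpos, zpow_eq_zpow_iff_dvd hα0, hα]
      exact Int.dvd_self_sub_emod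
    rw [e]
    exact h ⟨(z % N).toNat, by omega⟩
  exact forall₂_congr fun h _ => key _

end CyclicBurst

namespace GFFTData

variable {K F : Type u} [Field K] [Field F] [Algebra K F] [Finite K] [Finite F]
  {D : GFFTData K F} {s : ℕ} {hs : s ≤ D.r} (A : D.Arrangement hs) {b : ℕ → F[X]}

theorem fastTransform_block {c : ℕ} (h : FastOnFibres b (D.xpoly s) (D.m s) c) [DecidableEq F]
    (j : Fin (D.ns s)) :
    FastTransform b (D.m s) (Finset.univ.image fun a => A.pts (D.pos hs j a)) c := by
  refine h _ ?_ ⟨A.ξ * A.α ^ (j : ℕ), fun P hP => ?_⟩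
  · rw [Finset.card_image_of_injective _ fun a a' h => (D.pos_inj hs (A.injective h)).2,
      Finset.card_univ, Fintype.card_fin]
  · obtain ⟨a, _, rfl⟩ := Finset.mem_image.mp hP
    exact A.xpoly_eval j a

/-- Folding all the blocks. -/
theorem gen_foldRow (hb : IsGradedBasis b (D.m s)) {c : ℕ}
    (h : FastOnFibres b (D.xpoly s) (D.m s) c) :
    Gen (Set.range fun i (y : Fin D.n → F) => y i)
      (Set.range fun (p : Fin (D.m s) × Fin (D.ns s)) y => foldRow A b p.1 y p.2)
      (D.ns s * c) := by
  classical
  have := Gen.biUnion (S := Set.range fun i (y : Fin D.n → F) => y i)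
    (Finset.univ : Finset (Fin (D.ns s))) (c := c)
    (T := fun j => Set.range fun (i : Fin (D.m s)) y => foldRow A b i y j) fun j _ => by
      let a : ℕ → (Fin D.n → F) → F := fun i y =>
        if hi : i < D.m s then foldRow A b ⟨i, hi⟩ y j else 0
      refine (fastTransform_block A h j _ a).2.mono ?_ ?_ le_rfl
      · rintro _ ⟨P, hP, rfl⟩
        rw [Finset.mem_coe, Finset.mem_image] at hP
        obtain ⟨a', _, rfl⟩ := hP
        refine ⟨D.pos hs j a', ?_⟩
        funext y
        change y (D.pos hs j a') = _
        rw [← sum_foldRow_mul A hb y j a', basisValue, ← Fin.sum_univ_eq_sum_range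
          (fun i => a i y * (b i).eval (A.pts (D.pos hs j a')))]
        refine Finset.sum_congr rfl fun i _ => ?_
        simp only [a, i.2, dite_true, Fin.eta]
      · rintro _ ⟨i, rfl⟩
        refine ⟨i, i.2, ?_⟩
        funext y
        simp only [a, i.2, dite_true, Fin.eta]
  rw [Finset.card_univ, Fintype.card_fin] at this
  refine this.mono subset_rfl ?_ le_rfl
  rintro _ ⟨p, rfl⟩
  exact Set.mem_biUnion (Finset.mem_coe.mpr (Finset.mem_univ p.2)) ⟨p.1, rfl⟩

/-- Unfolding all the rows. -/
theorem gen_unfoldRows {c : ℕ} (h : FastOnFibres b (D.xpoly s) (D.m s) c) {I : Type u}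
    (Z : Fin (D.m s) → Fin (D.ns s) → I → F) :
    Gen (Set.range fun p : Fin (D.m s) × Fin (D.ns s) => Z p.1 p.2)
      (Set.range fun (q : Fin D.n) x => unfoldRows A b (fun i j => Z i j x) q)
      (D.ns s * c) := by
  classical
  have := Gen.biUnion (S := Set.range fun p : Fin (D.m s) × Fin (D.ns s) => Z p.1 p.2)
    (Finset.univ : Finset (Fin (D.ns s))) (c := c)
    (T := fun j => Set.range fun (a' : Fin (D.m s)) x =>
      unfoldRows A b (fun i j => Z i j x) (D.pos hs j a')) fun j _ => by
      let a : ℕ → I → F := fun i x => if hi : i < D.m s then Z ⟨i, hi⟩ j x else 0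
      refine (fastTransform_block A h j _ a).1.mono ?_ ?_ le_rfl
      · rintro _ ⟨i, hi, rfl⟩
        refine ⟨(⟨i, hi⟩, j), ?_⟩
        funext x
        simp only [a, dif_pos (Set.mem_Iio.mp hi)]
      · rintro _ ⟨a', rfl⟩
        refine ⟨A.pts (D.pos hs j a'), by simp, ?_⟩
        funext x
        refine Eq.trans ?_ (unfoldRows_pos A b _ j a').symm
        rw [basisValue, ← Fin.sum_univ_eq_sum_range
          (fun i => a i x * (b i).eval (A.pts (D.pos hs j a')))]
        refine Finset.sum_congr rfl fun i _ => ?_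
        simp only [a, i.2, dite_true, Fin.eta]
  rw [Finset.card_univ, Fintype.card_fin] at this
  refine this.mono subset_rfl ?_ le_rfl
  rintro _ ⟨q, rfl⟩
  obtain ⟨j, a', rfl⟩ := D.exists_pos_eq hs q
  exact Set.mem_biUnion (Finset.mem_coe.mpr (Finset.mem_univ j)) ⟨a', rfl⟩

variable (b) in
/-- The values of the polynomials `Γ` of all the rows. -/
theorem gen_eval_Γ_foldRow {c : ℕ}
    (h : FastOnFibres (fun i => (X : F[X]) ^ i) (X ^ D.ns s) (D.ns s) c) (κ : Fin (D.m s) → ℕ) :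
    Gen (Set.range fun (p : Fin (D.m s) × Fin (D.ns s)) (y : Fin D.n → F) => foldRow A b p.1 y p.2)
      (Set.range fun (p : Fin (D.m s) × Fin (D.ns s)) (y : Fin D.n → F) =>
        (CyclicBurst.Γ (D.ns s) (κ p.1) A.ξ A.α (foldRow A b p.1 y)).eval (A.α ^ (p.2 : ℕ)))
      (D.m s * (2 * c + 4 * D.ns s)) := by
  have h := Gen.biUnion (S := Set.range fun (p : Fin (D.m s) × Fin (D.ns s)) (y : Fin D.n → F) =>
      foldRow A b p.1 y p.2) (Finset.univ : Finset (Fin (D.m s))) (c := 2 * c + 4 * D.ns s)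
    (T := fun i => Set.range fun (u : Fin (D.ns s)) (y : Fin D.n → F) =>
      (CyclicBurst.Γ (D.ns s) (κ i) A.ξ A.α (foldRow A b i y)).eval (A.α ^ (u : ℕ))) fun i _ => by
      refine (CyclicBurst.gen_Γ (k := κ i) (ξ := A.ξ) (D.ns_pos s) A.orderOf_α h
        (fun j (y : Fin D.n → F) => foldRow A b i y j)).mono ?_ subset_rfl le_rfl
      rintro _ ⟨j, rfl⟩
      exact ⟨(i, j), rfl⟩
  rw [Finset.card_univ, Fintype.card_fin] at h
  refine h.mono subset_rfl ?_ le_rfl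
  rintro _ ⟨p, rfl⟩
  exact Set.mem_biUnion (Finset.mem_coe.mpr (Finset.mem_univ p.1)) ⟨p.2, rfl⟩

/-- Erasure decoding of all the rows on fixed windows, and unfolding. -/
theorem gen_unfoldRows_erasureDecode {c₁ c₂ : ℕ} (h₁ : FastOnFibres b (D.xpoly s) (D.m s) c₁)
    (h₂ : FastOnFibres (fun i => (X : F[X]) ^ i) (X ^ D.ns s) (D.ns s) c₂)
    (w : Fin (D.m s) → ℕ × ℕ) :
    Gen (Set.range fun (p : Fin (D.m s) × Fin (D.ns s)) (y : Fin D.n → F) => foldRow A b p.1 y p.2)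
      (Set.range fun (q : Fin D.n) (y : Fin D.n → F) => unfoldRows A b (fun i =>
        CyclicBurst.erasureDecode (D.ns s) A.ξ A.α (w i).1 (w i).2 (foldRow A b i y)) q)
      (D.m s * (2 * c₂ + 6 * D.ns s) + D.ns s * c₁) := by
  let Z : Fin (D.m s) → Fin (D.ns s) → (Fin D.n → F) → F := fun i j y =>
    CyclicBurst.erasureDecode (D.ns s) A.ξ A.α (w i).1 (w i).2 (foldRow A b i y) j
  have h := Gen.biUnion (S := Set.range fun (p : Fin (D.m s) × Fin (D.ns s)) (y : Fin D.n → F) =>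
      foldRow A b p.1 y p.2) (Finset.univ : Finset (Fin (D.m s))) (c := 2 * c₂ + 6 * D.ns s)
    (T := fun i => Set.range (Z i)) fun i _ => by
      refine (CyclicBurst.gen_erasureDecode (D.ns_pos s) A.ξ_ne_zero A.orderOf_α h₂
        (fun j (y : Fin D.n → F) => foldRow A b i y j) (w i).1 (w i).2).mono ?_ subset_rfl le_rfl
      rintro _ ⟨j, rfl⟩
      exact ⟨(i, j), rfl⟩
  rw [Finset.card_univ, Fintype.card_fin] at h
  have h' : Gen (Set.range fun (p : Fin (D.m s) × Fin (D.ns s)) (y : Fin D.n → F) =>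
      foldRow A b p.1 y p.2) (Set.range fun p : Fin (D.m s) × Fin (D.ns s) => Z p.1 p.2)
      (D.m s * (2 * c₂ + 6 * D.ns s)) := by
    refine h.mono subset_rfl ?_ le_rfl
    rintro _ ⟨p, rfl⟩
    exact Set.mem_biUnion (Finset.mem_coe.mpr (Finset.mem_univ p.1)) ⟨p.2, rfl⟩
  exact h'.comp (gen_unfoldRows A h₁ Z)

/-- A decoder that erases, in every row, a window determined by the roots of the polynomials `Γ` of
all the rows is computed by fast transforms and `n` zero tests. The search for the longest runs costs
nothing: a computation tree may continue differently for every pattern of zeros. -/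
theorem exists_tree_of_window (hb : IsGradedBasis b (D.m s)) {c₁ c₂ : ℕ}
    (h₁ : FastOnFibres b (D.xpoly s) (D.m s) c₁)
    (h₂ : FastOnFibres (fun i => (X : F[X]) ^ i) (X ^ D.ns s) (D.ns s) c₂)
    (κ : Fin (D.m s) → ℕ) (win : (Fin D.n → F) → Fin (D.m s) → ℕ × ℕ)
    (hwin : ∀ y y' : Fin D.n → F, (∀ i (u : Fin (D.ns s)),
      (CyclicBurst.Γ (D.ns s) (κ i) A.ξ A.α (foldRow A b i y)).eval (A.α ^ (u : ℕ)) = 0 ↔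
      (CyclicBurst.Γ (D.ns s) (κ i) A.ξ A.α (foldRow A b i y')).eval (A.α ^ (u : ℕ)) = 0) →
      win y = win y') :
    ∃ t : CompTree F, (t.toMap D.n = fun y => unfoldRows A b fun i =>
        CyclicBurst.erasureDecode (D.ns s) A.ξ A.α (win y i).1 (win y i).2 (foldRow A b i y)) ∧
      t.cost ≤ 2 * (D.ns s * c₁) + 4 * (D.m s * c₂) + 14 * D.n := by
  classical
  have hn : (D.ns s) * (D.m s) = D.n := D.ns_mul_m hs
  have hNpos : 0 < D.ns s := D.ns_pos s
  set target : (Fin D.n → F) → Fin D.n → F := fun y => unfoldRows A b fun i =>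
    CyclicBurst.erasureDecode (D.ns s) A.ξ A.α (win y i).1 (win y i).2 (foldRow A b i y) with htarget
  let R : Set ((Fin D.n → F) → F) := Set.range fun (p : Fin (D.m s) × Fin (D.ns s)) y => foldRow A b p.1 y p.2
  let g : Fin (D.m s) × Fin (D.ns s) → (Fin D.n → F) → F := fun p y =>
    (CyclicBurst.Γ (D.ns s) (κ p.1) A.ξ A.α (foldRow A b p.1 y)).eval (A.α ^ (p.2 : ℕ))
  have hfold : Gen (Set.range fun i (y : Fin D.n → F) => y i) R ((D.ns s) * c₁) := gen_foldRow A hb h₁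
  have hΓ := gen_eval_Γ_foldRow A b h₂ κ
  have hdec := fun y₀ => gen_unfoldRows_erasureDecode A h₁ h₂ fun i => win y₀ i
  obtain ⟨t, ht, htc⟩ := exists_tree_of_solves (f := target)
    (c := D.n + 1 + ((D.m s) * (2 * c₂ + 6 * (D.ns s)) + (D.ns s) * c₁) + D.n + (D.m s) * (2 * c₂ + 4 * (D.ns s)) + (D.ns s) * c₁) (by
      refine hfold _ _ _ _ _ subset_rfl (hΓ _ _ _ _ _ Set.subset_union_right ?_)
      have hcard : (Finset.univ : Finset (Fin (D.m s) × Fin (D.ns s))).card = D.n := by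
        rw [Finset.card_univ, Fintype.card_prod, Fintype.card_fin, Fintype.card_fin, mul_comm, hn]
      have hbr := Solves.branch_finset (target := target) (D := Set.univ)
        (known := (Set.range fun i (y : Fin D.n → F) => y i) ∪ R ∪ Set.range g)
        (c := D.n + 1 + ((D.m s) * (2 * c₂ + 6 * (D.ns s)) + (D.ns s) * c₁)) (Finset.univ : Finset (Fin (D.m s) × Fin (D.ns s))) g
        (fun p _ => Set.mem_union_right _ (Set.mem_range_self p)) fun y₀ _ => by
          refine hdec y₀ _ _ _ _ _ (fun _ h => Or.inl (Or.inr h)) ?_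
          refine Solves.of_known fun q => ⟨_, Set.mem_union_right _ (Set.mem_range_self q), ?_⟩
          rintro y ⟨_, hy⟩
          have : win y = win y₀ := hwin y y₀ fun i u => hy (i, u) (Finset.mem_univ _)
          simp only [htarget, this]
      rwa [hcard] at hbr)
  refine ⟨t, ht, htc.trans ?_⟩
  have hn1 : 1 ≤ D.n := by
    rw [← hn]
    exact Nat.mul_pos hNpos (D.m_pos hs)
  have e1 : (D.m s) * (2 * c₂ + 6 * (D.ns s)) = 2 * ((D.m s) * c₂) + 6 * D.n := by rw [← hn]; ring
  have e2 : (D.m s) * (2 * c₂ + 4 * (D.ns s)) = 2 * ((D.m s) * c₂) + 4 * D.n := by rw [← hn]; ring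
  rw [e1, e2]
  omega

omit [Finite F] in
/-- Numerical form of quasi-linearity. -/
theorem cost_le (hs : s ≤ D.r) (hn2 : 2 ≤ D.n) {C t : ℕ} {ε : ℝ} (hε0 : 0 < ε) (hε : ε ≤ 1)
    (ht : t ≤ 2 * (D.ns s * (C * (D.m s * Nat.log 2 (D.m s)))) +
      4 * (D.m s * (C * (D.ns s * Nat.log 2 (D.ns s)))) + 14 * D.n) :
    (t : ℝ) ≤ (12 * C + 28 : ℝ) * (1 / ε) * D.n * Real.log D.n := by
  have hn := D.ns_mul_m hs
  have hm : D.m s ≤ D.n := by rw [← hn]; exact Nat.le_mul_of_pos_left _ (D.ns_pos s)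
  have hN : D.ns s ≤ D.n := by rw [← hn]; exact Nat.le_mul_of_pos_right _ (D.m_pos hs)
  have hlog : 1 ≤ Nat.log 2 D.n := Nat.log_pos (by norm_num) hn2
  have h1 : t ≤ (6 * C + 14) * (D.n * Nat.log 2 D.n) := by
    calc t ≤ _ := ht
      _ = 2 * (C * (D.n * Nat.log 2 (D.m s))) + 4 * (C * (D.n * Nat.log 2 (D.ns s))) +
          14 * (D.n * 1) := by rw [← hn]; ring
      _ ≤ 2 * (C * (D.n * Nat.log 2 D.n)) + 4 * (C * (D.n * Nat.log 2 D.n)) +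
          14 * (D.n * Nat.log 2 D.n) := by gcongr
      _ = _ := by ring
  have h2 : (Nat.log 2 D.n : ℝ) ≤ 2 * Real.log D.n := by
    have h3 := Real.natLog_le_logb D.n 2
    have h4 : Real.logb (2 : ℕ) D.n = Real.log D.n / Real.log 2 := by
      rw [Real.logb]; norm_num
    rw [h4] at h3
    have h5 : (1 : ℝ) / 2 ≤ Real.log 2 := by have := Real.log_two_gt_d9; linarith
    have h6 : 0 ≤ Real.log D.n := Real.log_natCast_nonneg _
    refine h3.trans ?_
    rw [div_le_iff₀ (by linarith)]
    nlinarith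
  have h7 : (1 : ℝ) ≤ 1 / ε := by rw [le_div_iff₀ hε0]; linarith
  calc (t : ℝ) ≤ ((6 * C + 14) * (D.n * Nat.log 2 D.n) : ℕ) := by exact_mod_cast h1
    _ = (6 * C + 14 : ℝ) * (D.n * Nat.log 2 D.n) := by push_cast; ring
    _ ≤ (6 * C + 14 : ℝ) * (D.n * (2 * Real.log D.n)) := by gcongr
    _ = (12 * C + 28 : ℝ) * 1 * D.n * Real.log D.n := by ring
    _ ≤ _ := by
      have : 0 ≤ Real.log D.n := Real.log_natCast_nonneg _
      gcongr

omit [Finite F] in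
theorem fastOnFibres_ns {B : ℕ} (hB : ∀ ℓ : ℕ, ℓ.Prime → ℓ ∣ D.n → ℓ ≤ B) (hs : s ≤ D.r) :
    FastOnFibres (fun i => (X : F[X]) ^ i) (X ^ D.ns s) (D.ns s)
      ((3 * B + 1) * (D.ns s * Nat.log 2 (D.ns s))) :=
  fastOnFibres_X_pow (D.ns_pos s).ne' fun p hp h =>
    hB p hp (h.trans (D.ns_mul_m hs ▸ dvd_mul_right _ _))

/-- The row-by-row algorithm in quasi-linear time. -/
theorem exists_tree_burstDecode {B : ℕ} (hB : ∀ ℓ : ℕ, ℓ.Prime → ℓ ∣ D.n → ℓ ≤ B)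
    (hp : ∀ j < D.r, D.p j ≤ B) (k : ℕ) :
    ∃ t : CompTree F, t.toMap D.n = D.burstDecode A k ∧
      t.cost ≤ 2 * (D.ns s * ((3 * B + 1) * (D.m s * Nat.log 2 (D.m s)))) +
        4 * (D.m s * ((3 * B + 1) * (D.ns s * Nat.log 2 (D.ns s)))) + 14 * D.n := by
  refine exists_tree_of_window A (D.isGradedBasis_basisPoly hs) (D.fastOnFibres_basisPoly hp hs)
    (fastOnFibres_ns hB hs) (fun i => D.rowDim s k i)
    (fun y i => (CyclicBurst.start (D.ns s) (D.rowDim s k i) A.ξ A.α (foldRow A D.basisPoly i y),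
      CyclicBurst.len (D.ns s) (D.rowDim s k i) A.ξ A.α (foldRow A D.basisPoly i y))) ?_
  intro y y' h
  funext i
  have hrun := CyclicBurst.isRun_congr (D.ns_pos s) A.orderOf_α (h i)
  have hmax : CyclicBurst.maxRun (D.ns s) (D.rowDim s k i) A.ξ A.α (foldRow A D.basisPoly i y) =
      CyclicBurst.maxRun (D.ns s) (D.rowDim s k i) A.ξ A.α (foldRow A D.basisPoly i y') := by
    unfold CyclicBurst.maxRun
    congr! 4
    exact hrun _ _
  simp only [CyclicBurst.start, CyclicBurst.len, hmax, hrun]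

/-- The joint decoder in quasi-linear time. -/
theorem exists_tree_jointDecode {B : ℕ} (hB : ∀ ℓ : ℕ, ℓ.Prime → ℓ ∣ D.n → ℓ ≤ B)
    (hb : IsGradedBasis b (D.m s))
    (hfast : FastOnFibres b (D.xpoly s) (D.m s) ((3 * B + 1) * (D.m s * Nat.log 2 (D.m s))))
    (κ : ℕ) : ∃ t : CompTree F, t.toMap D.n = jointDecode A b κ ∧
      t.cost ≤ 2 * (D.ns s * ((3 * B + 1) * (D.m s * Nat.log 2 (D.m s)))) +
        4 * (D.m s * ((3 * B + 1) * (D.ns s * Nat.log 2 (D.ns s)))) + 14 * D.n := by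
  refine exists_tree_of_window A hb hfast (fastOnFibres_ns hB hs) (fun _ => κ)
    (fun y _ => (jointStart A b κ y, D.ns s - κ - jointMaxRun A b κ y)) ?_
  intro y y' h
  have hrun : ∀ i R, IsJointRun A b κ y i R ↔ IsJointRun A b κ y' i R := fun i R =>
    forall_congr' fun row => CyclicBurst.isRun_congr (D.ns_pos s) A.orderOf_α (h row) i R
  have hmax : jointMaxRun A b κ y = jointMaxRun A b κ y' := by
    unfold jointMaxRun
    congr! 4
    exact hrun _ _
  simp only [jointStart, hmax, hrun]

end GFFTData

theorem theorem2 :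
    -- the code corrects bursts up to the Singleton bound with small miscorrection probability
    (∀ (K F : Type u) [Field K] [Field F] [Algebra K F] [Finite K] [Finite F]
      (D : GFFTData K F) (pts : Fin D.n → F),
      Function.Injective pts → Set.range pts = D.points →
      ∀ k : ℕ, 1 ≤ k → k < D.n →
      ∀ (ε : ℝ) (e : ℕ), 1 / (D.n : ℝ) ≤ ε → 1 ≤ e →
      ∃ dec : (Fin D.n → F) → (Fin D.n → F),
        CorrectsBursts (RSCode pts k) dec
          ((D.n : ℝ) - k - D.n * ε * (e + 2)) (ε / (Nat.card F : ℝ) ^ (e - 1))) ∧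
    -- the row-by-row algorithm does so, `k` being rounded up to a multiple of the folding length
    (∀ (K F : Type u) [Field K] [Field F] [Algebra K F] [Finite K] [Finite F]
      (D : GFFTData K F) (s : ℕ) (hs : s ≤ D.r), D.w ≤ s →
      ∀ (A : D.Arrangement hs) (k : ℕ), 1 ≤ k → k < D.n →
      ∀ (ε : ℝ) (e : ℕ), 1 / (D.ns s : ℝ) ≤ ε → 1 ≤ e →
        CorrectsBursts (RSCode A.pts k) (D.burstDecode A k)
          ((D.n : ℝ) - D.m s * ⌈(k : ℝ) / D.m s⌉₊ - D.n * ε * (e + 2))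
          (ε / (Nat.card F : ℝ) ^ (e - 1))) ∧
    -- for smooth lengths, the time is quasi-linear
    (∀ B : ℕ, ∃ c : ℝ, 0 < c ∧
      ∀ (K F : Type u) [Field K] [Field F] [Algebra K F] [Finite K] [Finite F]
        (D : GFFTData K F), (∀ ℓ : ℕ, ℓ.Prime → ℓ ∣ D.n → ℓ ≤ B) →
        ∀ (s : ℕ) (hs : s ≤ D.r), D.w ≤ s →
        ∀ (A : D.Arrangement hs) (k : ℕ), 1 ≤ k → k < D.n →
        ∀ ε : ℝ, 1 / (D.ns s : ℝ) ≤ ε → ε ≤ 1 →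
          -- the row-by-row algorithm runs in this time, if its own radices are bounded by `B`
          ((∀ j < D.r, D.p j ≤ B) →
            ∃ t : CompTree F, t.toMap D.n = D.burstDecode A k ∧
              (t.cost : ℝ) ≤ c * (1 / ε) * D.n * Real.log D.n) ∧
          -- and a decoder that runs in this time reaches the full radius, without rounding `k`
          (∃ t : CompTree F, (t.cost : ℝ) ≤ c * (1 / ε) * D.n * Real.log D.n ∧
            ∀ e : ℕ, 1 ≤ e → CorrectsBursts (RSCode A.pts k) (t.toMap D.n)
              ((D.n : ℝ) - k - D.n * ε * (e + 2)) (ε / (Nat.card F : ℝ) ^ (e - 1)))) := by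
  refine ⟨?_, ?_, ?_⟩
  · intro K F _ _ _ _ _ D pts hpts _ k hk hkn ε e hε he
    exact exists_correctsBursts hpts hk hkn hε he
  · intro K F _ _ _ _ _ D s hs _ A k _ _ ε e hε he
    exact GFFTData.burstDecode_correctsBursts A hε he
  · intro B
    refine ⟨12 * (3 * B + 1 : ℕ) + 28, by positivity, ?_⟩
    intro K F _ _ _ _ _ D hB s hs hws A k hk hkn ε hε hε1
    have hN : (0 : ℝ) < D.ns s := by exact_mod_cast D.ns_pos s
    have hε0 : 0 < ε := (by positivity : (0 : ℝ) < 1 / D.ns s).trans_le hε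
    refine ⟨fun hp => ?_, ?_⟩
    · obtain ⟨t, ht, hc⟩ := GFFTData.exists_tree_burstDecode A hB hp k
      exact ⟨t, ht, GFFTData.cost_le hs (by omega) hε0 hε1 hc⟩
    · obtain ⟨b, hb, hfast⟩ := D.exists_fastOnFibres_xpoly hs hws fun p hp h =>
        hB p hp (h.trans (D.ns_mul_m hs ▸ dvd_mul_left _ _))
      -- `κ` is `k / m` rounded up
      obtain ⟨t, ht, hc⟩ := GFFTData.exists_tree_jointDecode A hB hb hfast
        ((k + (D.m s - 1)) / D.m s)
      refine ⟨t, GFFTData.cost_le hs (by omega) hε0 hε1 hc, fun e he => ?_⟩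
      rw [ht]
      have hm := D.m_pos hs
      have h1 := Nat.div_add_mod (k + (D.m s - 1)) (D.m s)
      have h2 := Nat.mod_lt (k + (D.m s - 1)) hm
      exact GFFTData.jointDecode_correctsBursts A hb (by omega) (by omega) hε he
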